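/- Let $h,g,\lambda\in\mathbb R$ with $\lambda\neq 0$, and put $k=h/\lambda$. The PVTOL control system is $$\ddot x=-u_1\sin\theta+h\,u_2\cos\theta,\qquad \ddot z=u_1\cos\theta+h\,u_2\sin\theta-g,\qquad \ddot\theta=\lambda u_2 .$$ Use coordinates $(t,x,x_1,z,z_1,\theta,\theta_1,u_1,u_2)$ on $\mathbb R^9$, where $x_1,z_1,\theta_1$ are the velocities, let $M\subseteq\mathbb R^9$ be a nonempty connected open set, and let $\mathcal V\subset TM$ be the distribution spanned by $\partial_{u_1}$, $\partial_{u_2}$ and $$\partial_t+x_1\partial_x+(-u_1\sin\theta+hu_2\cos\theta)\partial_{x_1}+z_1\partial_z+(u_1\cos\theta+hu_2\sin\theta-g)\partial_{z_1}+\theta_1\partial_\theta+\lambda u_2\partial_{\theta_1}.$$ An infinitesimal symmetry of $\mathcal V$ is a smooth vector field $X$ on $M$ such that $[X,Y]$ is a section of $\mathcal V$ for every section $Y$ of $\mathcal V$ over $M$; it is an infinitesimal control symmetry if moreover $X(t)=0$. **Theorem.** (1) The infinitesimal control symmetries form an eight-dimensional real Lie algebra $\mathfrak g_8$ with basis the restrictions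 to $M$ of $$\begin{aligned} X_1={}&k\sin^2\theta\cos\theta\,\partial_x+k\theta_1(3\cos^2\theta-1)\sin\theta\,\partial_{x_1}+(x-k\sin\theta\cos^2\theta)\partial_z\\ &+(x_1+2k\theta_1\cos\theta-3k\theta_1\cos^3\theta)\partial_{z_1}+\sin^2\theta\,\partial_\theta+\theta_1\sin 2\theta\,\partial_{\theta_1}\\ &+\cos\theta\sin\theta(5k\theta_1^2-u_1)\partial_{u_1}+\big(\tfrac{2}{\lambda}\theta_1^2\cos2\theta+u_2\sin2\theta\big)\partial_{u_2},\\ X_2={}&k\sin\theta\cos^2\theta\,\partial_x+k\theta_1\cos\theta(3\cos^2\theta-2)\partial_{x_1}-\big(k\cos^3\theta+\tfrac12gt^2+z\big)\partial_z\\ &+(3k\theta_1\cos^2\theta\sin\theta-z_1-gt)\partial_{z_1}+\cos\theta\sin\theta\,\partial_\theta+\theta_1\cos2\theta\,\partial_{\theta_1}\\ &+\big((5k\theta_1^2-u_1)\cos^2\theta-2k\theta_1^2\big)\partial_{u_1}+\big(u_2\cos2\theta-\tfrac2\lambda\theta_1^2\sin2\theta\big)\partial_{u_2},\\ X_3={}&\big(\tfrac12gt^2+z\big)\partial_x+(gt+z_1)\partial_{x_1}-x\partial_z-x_1\partial_{z_1}-\partial_\theta,\\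 X_4={}&(x-k\sin\theta)\partial_x+(x_1-k\theta_1\cos\theta)\partial_{x_1}+\big(\tfrac12gt^2+k\cos\theta+z\big)\partial_z\\ &+(gt+z_1-k\theta_1\sin\theta)\partial_{z_1}+(u_1-k\theta_1^2)\partial_{u_1},\\ X_5={}&t\partial_x+\partial_{x_1},\qquad X_6=\partial_x,\qquad X_7=t\partial_z+\partial_{z_1},\qquad X_8=\partial_z . \end{aligned}$$ (2) $\mathfrak g_8$ has a Levi decomposition (a semidirect sum) $\mathfrak{sl}(2,\mathbb R)\ltimes\mathfrak s_{5,9}$: its radical is isomorphic to $\mathfrak s_{5,9}$, the real Lie algebra with basis $e_1,\dots,e_5$ and nonzero brackets $[e_5,e_i]=e_i$ $(1\le i\le4)$, and the radical has as linear complement a semisimple subalgebra isomorphic to $\mathfrak{sl}(2,\mathbb R)$. The isomorphisms can be chosen so that $\mathfrak{sl}(2,\mathbb R)$ acts on $\mathrm{span}(e_1,e_2)$ and on $\mathrm{span}(e_3,e_4)$ by its standard representation and annihilates $e_5$. (3) $X_1,\dots,X_8,\partial_t$ are a basis of a nine-dimensional Lie algebra $\mathfrak g_9$ of infinitesimal symmetries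 of $\mathcal V$. It has a Levi decomposition $\mathfrak{sl}(2,\mathbb R)\ltimes\mathfrak s_{6,140}$ in the same sense, where $\mathfrak s_{6,140}$ has basis $e_1,\dots,e_6$ and nonzero brackets $[e_3,e_5]=e_1$, $[e_4,e_5]=e_2$, $[e_6,e_i]=e_i$ $(1\le i\le 4)$, and $\mathfrak{sl}(2,\mathbb R)$ acts on $\mathrm{span}(e_1,e_2)$ and on $\mathrm{span}(e_3,e_4)$ by its standard representation and annihilates $e_5,e_6$. The nilradical (largest nilpotent ideal) of $\mathfrak s_{6,140}$ is isomorphic to $\mathfrak n_{5,1}$, the Lie algebra with basis $e_1,\dots,e_5$ and nonzero brackets $[e_3,e_5]=e_1$, $[e_4,e_5]=e_2$. (4) At a point of $\mathbb R^9$ the nine vector fields $X_1,\dots,X_8,\partial_t$ span the tangent space if and only if $\theta_1\neq0$ and $u_1\neq k\theta_1^2$ there; these points form an open dense subset of $\mathbb R^9$. Near all such points of $M$, $M$ is locally a Lie group with Lie algebra $\mathfrak g_9$ and $\mathcal V$ is an invariant distribution on it. That is, there are a Lie group $G$ and a Lie algebra isomorphism $\Psi$ from $\mathfrak g_9$ onto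 the Lie algebra of $G$ such that every such point of $M$ has an open neighbourhood in $M$ with a diffeomorphism $\varphi$ onto an open subset of $G$ that maps each $X\in\mathfrak g_9$ to the left-invariant vector field determined by $\Psi(X)$, and maps $\mathcal V$ to (the restriction of) a right-invariant distribution. -/

import Mathlib

open scoped ContDiff Manifold

noncomputable section

/-! ### Smooth vector fields on an open subset of a normed space -/

section VectorFields

variable {E : Type*} [NormedAddCommGroup E] [NormedSpace ℝ E]

/-- The space of smooth vector fields on the open set `Ω`. A field on `Ω` is represented by its
extension by zero to the whole space, so that two fields are equal iff they agree on `Ω`. -/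
def SmoothVF (Ω : TopologicalSpace.Opens E) : Submodule ℝ (E → E) where
  carrier := {X | ContDiffOn ℝ ∞ X Ω ∧ ∀ p ∉ Ω, X p = 0}
  add_mem' := fun {X Y} hX hY =>
    ⟨hX.1.add hY.1, fun p hp => by simp [hX.2 p hp, hY.2 p hp]⟩
  zero_mem' := ⟨contDiffOn_const, fun _ _ => rfl⟩
  smul_mem' := fun c X hX => ⟨hX.1.const_smul c, fun p hp => by simp [hX.2 p hp]⟩

namespace SmoothVF

variable {Ω : TopologicalSpace.Opens E}

theorem contDiffAt (X : SmoothVF Ω) {p : E} (hp : p ∈ Ω) : ContDiffAt ℝ ∞ X.1 p :=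
  X.2.1.contDiffAt (Ω.isOpen.mem_nhds hp)

theorem differentiableAt (X : SmoothVF Ω) {p : E} (hp : p ∈ Ω) : DifferentiableAt ℝ X.1 p :=
  (SmoothVF.contDiffAt X hp).differentiableAt (by simp)

theorem ext_on {X Y : SmoothVF Ω} (hXY : ∀ p ∈ Ω, X.1 p = Y.1 p) : X = Y := by
  apply Subtype.ext
  funext p
  by_cases hp : p ∈ Ω
  · exact hXY p hp
  · rw [X.2.2 p hp, Y.2.2 p hp]

/-- The Lie bracket of vector fields, `[X, Y] = DY(X) - DX(Y)` on `Ω`. -/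
instance : Bracket (SmoothVF Ω) (SmoothVF Ω) where
  bracket X Y := ⟨(Ω : Set E).indicator (VectorField.lieBracket ℝ X.1 Y.1), by
    refine ⟨?_, fun p hp => Set.indicator_of_notMem (by simpa using hp) _⟩
    intro p hp
    have h1 : ContDiffAt ℝ ∞ (VectorField.lieBracket ℝ X.1 Y.1) p :=
      (SmoothVF.contDiffAt X hp).lieBracket_vectorField (SmoothVF.contDiffAt Y hp) (by simp)
    exact h1.contDiffWithinAt.congr (fun q hq => Set.indicator_of_mem hq _)
      (Set.indicator_of_mem hp _)⟩

theorem lie_apply (X Y : SmoothVF Ω) {p : E} (hp : p ∈ Ω) :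
    (⁅X, Y⁆ : SmoothVF Ω).1 p = VectorField.lieBracket ℝ X.1 Y.1 p :=
  Set.indicator_of_mem (s := (Ω : Set E)) hp _

theorem lie_eventuallyEq (X Y : SmoothVF Ω) {p : E} (hp : p ∈ Ω) :
    (⁅X, Y⁆ : SmoothVF Ω).1 =ᶠ[nhds p] VectorField.lieBracket ℝ X.1 Y.1 :=
  Filter.eventually_of_mem (Ω.isOpen.mem_nhds hp) fun _ hq => lie_apply X Y hq

instance : LieRing (SmoothVF Ω) where
  add_lie X Y Z := ext_on fun p hp => by
    change _ = (⁅X, Z⁆ : SmoothVF Ω).1 p + (⁅Y, Z⁆ : SmoothVF Ω).1 p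
    rw [lie_apply _ _ hp, lie_apply _ _ hp, lie_apply _ _ hp]
    exact VectorField.lieBracket_add_left (SmoothVF.differentiableAt X hp) (SmoothVF.differentiableAt Y hp)
  lie_add X Y Z := ext_on fun p hp => by
    change _ = (⁅X, Y⁆ : SmoothVF Ω).1 p + (⁅X, Z⁆ : SmoothVF Ω).1 p
    rw [lie_apply _ _ hp, lie_apply _ _ hp, lie_apply _ _ hp]
    exact VectorField.lieBracket_add_right (SmoothVF.differentiableAt Y hp) (SmoothVF.differentiableAt Z hp)
  lie_self X := ext_on fun p hp => by
    rw [lie_apply _ _ hp, VectorField.lieBracket_self]; rfl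
  leibniz_lie X Y Z := ext_on fun p hp => by
    change _ = (⁅⁅X, Y⁆, Z⁆ : SmoothVF Ω).1 p + (⁅Y, ⁅X, Z⁆⁆ : SmoothVF Ω).1 p
    rw [lie_apply _ _ hp, lie_apply _ _ hp, lie_apply _ _ hp,
      (Filter.EventuallyEq.refl _ X.1).lieBracket_vectorField_eq (lie_eventuallyEq Y Z hp),
      (lie_eventuallyEq X Y hp).lieBracket_vectorField_eq (Filter.EventuallyEq.refl _ Z.1),
      (Filter.EventuallyEq.refl _ Y.1).lieBracket_vectorField_eq (lie_eventuallyEq X Z hp)]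
    exact VectorField.leibniz_identity_lieBracket (n := ∞) (by
        rw [minSmoothness_of_isRCLikeNormedField]; exact ENat.LEInfty.out)
      (SmoothVF.contDiffAt X hp) (SmoothVF.contDiffAt Y hp) (SmoothVF.contDiffAt Z hp)

instance : LieAlgebra ℝ (SmoothVF Ω) where
  lie_smul c X Y := ext_on fun p hp => by
    change _ = c • (⁅X, Y⁆ : SmoothVF Ω).1 p
    rw [lie_apply _ _ hp, lie_apply _ _ hp]
    exact VectorField.lieBracket_const_smul_right (SmoothVF.differentiableAt Y hp)

end SmoothVF

/-- `X` is a section over `Ω` of the distribution `V`. -/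
def IsSectionOf {Ω : TopologicalSpace.Opens E} (V : E → Submodule ℝ E) (X : SmoothVF Ω) : Prop :=
  ∀ p ∈ Ω, X.1 p ∈ V p

/-- The Lie algebra of infinitesimal symmetries of a distribution `V` on `Ω`: the smooth vector
fields `X` on `Ω` such that `[X, Y]` is a section of `V` whenever `Y` is one. -/
def infinitesimalSymmetries (Ω : TopologicalSpace.Opens E) (V : E → Submodule ℝ E) :
    LieSubalgebra ℝ (SmoothVF Ω) where
  carrier := {X | ∀ Y : SmoothVF Ω, IsSectionOf V Y → IsSectionOf V ⁅X, Y⁆}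
  add_mem' := fun {X X'} hX hX' Y hY p hp => by
    rw [add_lie]
    exact (V p).add_mem (hX Y hY p hp) (hX' Y hY p hp)
  zero_mem' := fun Y _ p _ => by
    rw [zero_lie]
    exact (V p).zero_mem
  smul_mem' := fun c X hX Y hY p hp => by
    rw [smul_lie]
    exact (V p).smul_mem c (hX Y hY p hp)
  lie_mem' := fun {X X'} hX hX' Y hY p hp => by
    rw [lie_lie]
    exact (V p).sub_mem (hX _ (hX' Y hY) p hp) (hX' _ (hX Y hY) p hp)

/-- The Lie algebra of infinitesimal control symmetries of a distribution `V` on `Ω`, relative to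
the time function `τ`: the infinitesimal symmetries `X` of `V` that leave time invariant,
`dτ(X) = 0`. -/
def controlSymmetries (Ω : TopologicalSpace.Opens E) (V : E → Submodule ℝ E) (τ : E →L[ℝ] ℝ) :
    LieSubalgebra ℝ (SmoothVF Ω) where
  carrier := {X | X ∈ infinitesimalSymmetries Ω V ∧ ∀ p ∈ Ω, τ (X.1 p) = 0}
  add_mem' := fun {X Y} hX hY => ⟨add_mem hX.1 hY.1, fun p hp => by
    change τ (X.1 p + Y.1 p) = 0
    rw [map_add, hX.2 p hp, hY.2 p hp, add_zero]⟩
  zero_mem' := ⟨zero_mem _, fun _ _ => map_zero τ⟩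
  smul_mem' := fun c X hX => ⟨(infinitesimalSymmetries Ω V).smul_mem c hX.1, fun p hp => by
    change τ (c • X.1 p) = 0
    rw [map_smul, hX.2 p hp, smul_zero]⟩
  lie_mem' := fun {X Y} hX hY => ⟨LieSubalgebra.lie_mem _ hX.1 hY.1, fun p hp => by
    have key : ∀ Z : SmoothVF Ω, (∀ q ∈ Ω, τ (Z.1 q) = 0) → ∀ v, τ (fderiv ℝ Z.1 p v) = 0 := by
      intro Z hZ v
      have h1 : fderiv ℝ (fun q => τ (Z.1 q)) p = τ.comp (fderiv ℝ Z.1 p) :=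
        (τ.hasFDerivAt.comp p (SmoothVF.differentiableAt Z hp).hasFDerivAt).fderiv
      have h2 : (fun q => τ (Z.1 q)) =ᶠ[nhds p] fun _ => (0 : ℝ) :=
        Filter.eventually_of_mem (Ω.isOpen.mem_nhds hp) fun q hq => hZ q hq
      have h3 := h2.fderiv_eq (𝕜 := ℝ)
      rw [h1] at h3
      simpa using congrArg (fun T : E →L[ℝ] ℝ => T v) h3
    rw [SmoothVF.lie_apply _ _ hp, VectorField.lieBracket, map_sub, key Y hY.2, key X hX.2,
      sub_zero]⟩

end VectorFields

/-! ### The PVTOL control system -/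

/-- The coordinates `(t, x, x₁, z, z₁, θ, θ₁, u₁, u₂)` of the time-state-control space
`ℝ × ℝ⁶ × ℝ²`, where `x₁, z₁, θ₁` stand for the velocities. -/
abbrev PVTOLSpace : Type := Fin 9 → ℝ

/-- The time function `t`. -/
def pvtolTime : PVTOLSpace →L[ℝ] ℝ := ContinuousLinearMap.proj 0

/-- The vector field `∂_t`. -/
def pvtolDt : PVTOLSpace := ![1, 0, 0, 0, 0, 0, 0, 0, 0]

/-- The vector field `∂_t + ∑ fⁱ ∂_{xⁱ}` of the PVTOL equations
`x'' = -u₁ sin θ + h u₂ cos θ`, `z'' = u₁ cos θ + h u₂ sin θ - g`, `θ'' = lam u₂`. -/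
def pvtolDrift (h g lam : ℝ) (p : PVTOLSpace) : PVTOLSpace :=
  ![1,
    p 2, -p 7 * Real.sin (p 5) + h * p 8 * Real.cos (p 5),
    p 4, p 7 * Real.cos (p 5) + h * p 8 * Real.sin (p 5) - g,
    p 6, lam * p 8,
    0, 0]

/-- The PVTOL distribution, spanned by `∂_t + ∑ fⁱ ∂_{xⁱ}`, `∂_{u₁}` and `∂_{u₂}`. -/
def pvtolDistribution (h g lam : ℝ) (p : PVTOLSpace) : Submodule ℝ PVTOLSpace :=
  Submodule.span ℝ
    {pvtolDrift h g lam p, ![0, 0, 0, 0, 0, 0, 0, 1, 0], ![0, 0, 0, 0, 0, 0, 0, 0, 1]}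

/-- The values of the eight vector fields `X₁, …, X₈` at the point with the given coordinates;
here `k` stands for `h / lam`. -/
def pvtolFieldsAt (k g lam t x x₁ z z₁ θ θ₁ u₁ u₂ : ℝ) : Fin 8 → PVTOLSpace :=
  ![ ![0,
       k * Real.sin θ ^ 2 * Real.cos θ,
       k * θ₁ * (3 * Real.cos θ ^ 2 - 1) * Real.sin θ,
       x - k * Real.sin θ * Real.cos θ ^ 2,
       x₁ + 2 * k * θ₁ * Real.cos θ - 3 * k * θ₁ * Real.cos θ ^ 3,
       Real.sin θ ^ 2,
       θ₁ * Real.sin (2 * θ),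
       Real.cos θ * Real.sin θ * (5 * k * θ₁ ^ 2 - u₁),
       2 * θ₁ ^ 2 * Real.cos (2 * θ) / lam + u₂ * Real.sin (2 * θ)],
     ![0,
       k * Real.sin θ * Real.cos θ ^ 2,
       k * θ₁ * Real.cos θ * (3 * Real.cos θ ^ 2 - 2),
       -(k * Real.cos θ ^ 3 + g * t ^ 2 / 2 + z),
       3 * k * θ₁ * Real.cos θ ^ 2 * Real.sin θ - z₁ - g * t,
       Real.cos θ * Real.sin θ,
       θ₁ * Real.cos (2 * θ),
       (5 * k * θ₁ ^ 2 - u₁) * Real.cos θ ^ 2 - 2 * k * θ₁ ^ 2,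
       u₂ * Real.cos (2 * θ) - 2 * θ₁ ^ 2 * Real.sin (2 * θ) / lam],
     ![0, g * t ^ 2 / 2 + z, g * t + z₁, -x, -x₁, -1, 0, 0, 0],
     ![0,
       x - k * Real.sin θ,
       x₁ - k * θ₁ * Real.cos θ,
       g * t ^ 2 / 2 + k * Real.cos θ + z,
       g * t + z₁ - k * θ₁ * Real.sin θ,
       0,
       0,
       u₁ - k * θ₁ ^ 2,
       0],
     ![0, t, 1, 0, 0, 0, 0, 0, 0],
     ![0, 1, 0, 0, 0, 0, 0, 0, 0],
     ![0, 0, 0, t, 1, 0, 0, 0, 0],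
     ![0, 0, 0, 1, 0, 0, 0, 0, 0] ]

/-- The eight vector fields `X₁, …, X₈` (indexed from `0`). -/
def pvtolField (h g lam : ℝ) (i : Fin 8) (p : PVTOLSpace) : PVTOLSpace :=
  pvtolFieldsAt (h / lam) g lam (p 0) (p 1) (p 2) (p 3) (p 4) (p 5) (p 6) (p 7) (p 8) i

/-- The nine vector fields `X₁, …, X₈, ∂_t`. -/
def pvtolFieldExt (h g lam : ℝ) : Fin 9 → PVTOLSpace → PVTOLSpace :=
  Fin.snoc (pvtolField h g lam) fun _ => pvtolDt

/-- The points with `θ₁ ≠ 0` and `u₁ ≠ (h / lam) θ₁²`. -/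
def pvtolGeneric (h lam : ℝ) : Set PVTOLSpace :=
  {p | p 6 ≠ 0 ∧ p 7 ≠ h / lam * p 6 ^ 2}

/-! ### The abstract Lie algebras -/

/-- The real Lie algebra with basis `e₁, …, e₅` and nonzero brackets `[e₅, eᵢ] = eᵢ`,
`1 ≤ i ≤ 4`. -/
def LieS59 : Type := Fin 5 → ℝ

namespace LieS59

instance : AddCommGroup LieS59 := inferInstanceAs (AddCommGroup (Fin 5 → ℝ))
instance : Module ℝ LieS59 := inferInstanceAs (Module ℝ (Fin 5 → ℝ))

/-- The bracket with `[e₅, eᵢ] = eᵢ` for `1 ≤ i ≤ 4`. -/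
def br (v w : Fin 5 → ℝ) : Fin 5 → ℝ :=
  ![v 4 * w 0 - w 4 * v 0,
    v 4 * w 1 - w 4 * v 1,
    v 4 * w 2 - w 4 * v 2,
    v 4 * w 3 - w 4 * v 3,
    0]

instance : Bracket LieS59 LieS59 := ⟨br⟩

instance : LieRing LieS59 where
  add_lie u v w := by
    change br (fun i => u i + v i) w = fun i => br u w i + br v w i
    funext i; fin_cases i <;> simp [br] <;> ring
  lie_add u v w := by
    change br u (fun i => v i + w i) = fun i => br u v i + br u w i
    funext i; fin_cases i <;> simp [br] <;> ring
  lie_self u := by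
    change br u u = fun _ => 0
    funext i; fin_cases i <;> simp [br]
  leibniz_lie u v w := by
    change br u (br v w) = fun i => br (br u v) w i + br v (br u w) i
    funext i; fin_cases i <;> simp [br] <;> ring

instance : LieAlgebra ℝ LieS59 where
  lie_smul c u v := by
    change br u (fun i => c * v i) = fun i => c * br u v i
    funext i; fin_cases i <;> simp [br] <;> ring

end LieS59

/-- The real Lie algebra with basis `e₁, …, e₅` and nonzero brackets `[e₃, e₅] = e₁`,
`[e₄, e₅] = e₂`. -/
def LieN51 : Type := Fin 5 → ℝ

namespace LieN51

instance : AddCommGroup LieN51 := inferInstanceAs (AddCommGroup (Fin 5 → ℝ))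
instance : Module ℝ LieN51 := inferInstanceAs (Module ℝ (Fin 5 → ℝ))

/-- The bracket with `[e₃, e₅] = e₁` and `[e₄, e₅] = e₂`. -/
def br (v w : Fin 5 → ℝ) : Fin 5 → ℝ :=
  ![v 2 * w 4 - v 4 * w 2,
    v 3 * w 4 - v 4 * w 3,
    0, 0, 0]

instance : Bracket LieN51 LieN51 := ⟨br⟩

instance : LieRing LieN51 where
  add_lie u v w := by
    change br (fun i => u i + v i) w = fun i => br u w i + br v w i
    funext i; fin_cases i <;> simp [br] <;> ring
  lie_add u v w := by
    change br u (fun i => v i + w i) = fun i => br u v i + br u w i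
    funext i; fin_cases i <;> simp [br] <;> ring
  lie_self u := by
    change br u u = fun _ => 0
    funext i; fin_cases i <;> simp [br] <;> ring
  leibniz_lie u v w := by
    change br u (br v w) = fun i => br (br u v) w i + br v (br u w) i
    funext i; fin_cases i <;> simp [br]

instance : LieAlgebra ℝ LieN51 where
  lie_smul c u v := by
    change br u (fun i => c * v i) = fun i => c * br u v i
    funext i; fin_cases i <;> simp [br] <;> ring

end LieN51

/-- The real Lie algebra with basis `e₁, …, e₆` and nonzero brackets `[e₃, e₅] = e₁`,
`[e₄, e₅] = e₂` and `[e₆, eᵢ] = eᵢ`, `1 ≤ i ≤ 4`. -/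
def LieS6140 : Type := Fin 6 → ℝ

namespace LieS6140

instance : AddCommGroup LieS6140 := inferInstanceAs (AddCommGroup (Fin 6 → ℝ))
instance : Module ℝ LieS6140 := inferInstanceAs (Module ℝ (Fin 6 → ℝ))

/-- The bracket with `[e₃, e₅] = e₁`, `[e₄, e₅] = e₂` and `[e₆, eᵢ] = eᵢ` for `1 ≤ i ≤ 4`. -/
def br (v w : Fin 6 → ℝ) : Fin 6 → ℝ :=
  ![v 5 * w 0 - w 5 * v 0 + (v 2 * w 4 - v 4 * w 2),
    v 5 * w 1 - w 5 * v 1 + (v 3 * w 4 - v 4 * w 3),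
    v 5 * w 2 - w 5 * v 2,
    v 5 * w 3 - w 5 * v 3,
    0, 0]

instance : Bracket LieS6140 LieS6140 := ⟨br⟩

instance : LieRing LieS6140 where
  add_lie u v w := by
    change br (fun i => u i + v i) w = fun i => br u w i + br v w i
    funext i; fin_cases i <;> simp [br] <;> ring
  lie_add u v w := by
    change br u (fun i => v i + w i) = fun i => br u v i + br u w i
    funext i; fin_cases i <;> simp [br] <;> ring
  lie_self u := by
    change br u u = fun _ => 0
    funext i; fin_cases i <;> simp [br] <;> ring
  leibniz_lie u v w := by
    change br u (br v w) = fun i => br (br u v) w i + br v (br u w) i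
    funext i; fin_cases i <;> simp [br] <;> ring

instance : LieAlgebra ℝ LieS6140 where
  lie_smul c u v := by
    change br u (fun i => c * v i) = fun i => c * br u v i
    funext i; fin_cases i <;> simp [br] <;> ring

end LieS6140

/-- The action of a `2 × 2` matrix on `LieS59`: the standard one on `span(e₁, e₂)` and on
`span(e₃, e₄)`, and zero on `e₅`. -/
def actS59 (A : Matrix (Fin 2) (Fin 2) ℝ) (v : LieS59) : LieS59 :=
  ![A 0 0 * v 0 + A 0 1 * v 1, A 1 0 * v 0 + A 1 1 * v 1,
    A 0 0 * v 2 + A 0 1 * v 3, A 1 0 * v 2 + A 1 1 * v 3, 0]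

/-- The action of a `2 × 2` matrix on `LieS6140`: the standard one on `span(e₁, e₂)` and on
`span(e₃, e₄)`, and zero on `e₅` and `e₆`. -/
def actS6140 (A : Matrix (Fin 2) (Fin 2) ℝ) (v : LieS6140) : LieS6140 :=
  ![A 0 0 * v 0 + A 0 1 * v 1, A 1 0 * v 0 + A 1 1 * v 1,
    A 0 0 * v 2 + A 0 1 * v 3, A 1 0 * v 2 + A 1 1 * v 3, 0, 0]

/-- The Lie algebra `L` has a Levi decomposition `𝔰𝔩(2, ℝ) ⋉ R`: the radical of `L` is isomorphic
to `R` and has as linear complement a semisimple subalgebra isomorphic to `𝔰𝔩(2, ℝ)`; under these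
isomorphisms the latter acts on the former by `act`. -/
def HasLeviDecompositionSl2 (L : Type*) [LieRing L] [LieAlgebra ℝ L]
    (R : Type*) [LieRing R] [LieAlgebra ℝ R]
    (act : Matrix (Fin 2) (Fin 2) ℝ → R → R) : Prop :=
  ∃ 𝔥 : LieSubalgebra ℝ L,
    LieAlgebra.IsSemisimple ℝ 𝔥 ∧
    IsCompl 𝔥.toSubmodule (LieAlgebra.radical ℝ L).toSubmodule ∧
    ∃ (Φ : LieAlgebra.SpecialLinear.sl (Fin 2) ℝ ≃ₗ⁅ℝ⁆ 𝔥)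
      (Ψ : R ≃ₗ⁅ℝ⁆ LieAlgebra.radical ℝ L),
      ∀ A v, ⁅(Φ A : L), (Ψ v : L)⁆ = (Ψ (act A.1 v) : L)

/-- `N` is the nilradical of `L`: the largest ideal that is nilpotent as a Lie algebra. -/
def IsNilradical {L : Type*} [LieRing L] [LieAlgebra ℝ L] (N : LieIdeal ℝ L) : Prop :=
  IsGreatest {I : LieIdeal ℝ L | LieRing.IsNilpotent I} N

/-! ### Open sets that are locally Lie groups -/

instance : ENat.LEInfty (minSmoothness ℝ 3) :=
  ⟨by rw [minSmoothness_of_isRCLikeNormedField]; exact ENat.LEInfty.out⟩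

/-- Near every point of `S`, the open set `Ω` is a Lie group with Lie algebra `L`, and the
distribution `V` is an invariant distribution on it. Precisely: there are a Lie group `G` and an
isomorphism `Ψ` from the Lie algebra `L` of vector fields on `Ω` onto the Lie algebra of `G` such
that every point of `S` has an open neighbourhood in `Ω` with a diffeomorphism `φ` onto an open
subset of `G` that maps each `X` in `L` to the left-invariant vector field with value `Ψ X` at `1`,
and maps `V` to the right-invariant distribution with some value `D` at `1`. -/
def IsLocallyLieGroup {E : Type*} [NormedAddCommGroup E] [NormedSpace ℝ E]
    {Ω : TopologicalSpace.Opens E} (L : LieSubalgebra ℝ (SmoothVF Ω))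
    (V : E → Submodule ℝ E) (S : Set E) : Prop :=
  ∃ (H : Type) (_ : NormedAddCommGroup H) (_ : NormedSpace ℝ H) (_ : CompleteSpace H)
    (G : Type) (_ : TopologicalSpace G) (_ : ChartedSpace H G) (_ : Group G)
    (_ : LieGroup 𝓘(ℝ, H) ∞ G)
    (Ψ : L ≃ₗ⁅ℝ⁆ GroupLieAlgebra 𝓘(ℝ, H) G),
    ∀ p ∈ S, ∃ φ : OpenPartialHomeomorph E G,
      p ∈ φ.source ∧ φ.source ⊆ Ω ∧
      ContMDiffOn 𝓘(ℝ, E) 𝓘(ℝ, H) ∞ φ φ.source ∧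
      ContMDiffOn 𝓘(ℝ, H) 𝓘(ℝ, E) ∞ φ.symm φ.target ∧
      (∀ (X : L), ∀ q ∈ φ.source,
        mfderiv 𝓘(ℝ, E) 𝓘(ℝ, H) φ q (X.1.1 q) = mulInvariantVectorField (Ψ X) (φ q)) ∧
      ∃ D : Submodule ℝ (GroupLieAlgebra 𝓘(ℝ, H) G), ∀ q ∈ φ.source, ∀ v : E,
        v ∈ V q ↔ ∃ d ∈ D, mfderiv 𝓘(ℝ, E) 𝓘(ℝ, H) φ q v =
          mfderiv 𝓘(ℝ, H) 𝓘(ℝ, H) (fun a : G => a * φ q) 1 d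

end

noncomputable section

/-! ### Levi decompositions with Levi factor `𝔰𝔩(2, ℝ)` -/

section Levi

open LieAlgebra

/-! The substitution `X = x - k sin θ`, `Z = z + k cos θ + g t² / 2`, `v = u₁ - k θ₁²`, `w = lam u₂`
removes `h` and gravity: the system becomes `X'' = -v sin θ`, `Z'' = v cos θ`, `θ'' = w`. Affine
motions `P ↦ M P + c t + b` of `P = (X, Z)` act linearly on accelerations, so they prolong to
symmetries, and so do time translations. The main point is that there are no other symmetries with
`X(t)` constant.

Let `a` be the flat components of such a symmetry, `ω = θ₁` and `T` the total derivative. Brackets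
with `∂_v`, `∂_w` and `T` give the determining equations `ThrustFrame.IsSymm`. Eliminating the
thrust component from the two acceleration equations gives `IsSymm.angle_eq`. Differentiating it and
`T a₁ = a₂`, `T a₃ = a₄` in `v`, `w`, `ω` and commuting these derivatives past `T` shows that the
position components depend on `(t, X, Z)` only. Their acceleration along free motions then vanishes,
so they are affine (`IsSymm.d_d_pos`); connectedness turns locally constant coefficients into
constants. Time and position components determine the symmetry (`IsSymm.eq_zero`). Nothing is ever
divided by `v`, so points of zero thrust need no separate treatment.

Hence the two symmetry algebras are `ℝ⁸` and `ℝ⁹` with the opposite commutator `affineBracket` of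
block matrices acting on `(P, t, 1)`. The trace-free part of `M` is the Levi factor; scalar
matrices, boosts and translations (with time translation in dimension nine) form the radical.

At points with `ω ≠ 0` and `v ≠ 0` a moving frame identifies the space with an open set of the
affine group. It records time, position, velocity, and a matrix with columns `A` and `B`, where `A`
is the acceleration and `B` its derivative along a direction in the distribution with `v' = -v w /
(2 ω)`. This direction is the one that keeps `det (A, A') = v² ω` stationary, a condition that
affine motions preserve. So symmetries become the fields `ξ y` (`frameDeriv_affineFieldAt`), while
along the distribution the derivative of the frame `y` is `y η` with `η` in a fixed
three-dimensional space (`frameDeriv_distribution`). With multiplication opposite to matrix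
multiplication these are left-invariant fields and a right-invariant distribution. -/

theorem LieAlgebra.isSolvable_of_lie_mem_of_lie_eq_zero {L : Type*} [LieRing L] [LieAlgebra ℝ L]
    (J : LieIdeal ℝ L) (h : ∀ a b : L, ⁅a, b⁆ ∈ J) (h' : ∀ a ∈ J, ∀ b ∈ J, ⁅a, b⁆ = 0) :
    IsSolvable L := by
  have h1 : derivedSeries ℝ L 1 ≤ J := by
    rw [derivedSeries_def, derivedSeriesOfIdeal_succ, derivedSeriesOfIdeal_zero,
      LieSubmodule.lie_le_iff]
    exact fun a _ b _ => h a b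
  refine IsSolvable.mk (R := ℝ) (k := 2) ?_
  rw [derivedSeries_def, derivedSeriesOfIdeal_succ, eq_bot_iff, LieSubmodule.lie_le_iff]
  intro a ha b hb
  rw [LieSubmodule.mem_bot]
  exact h' a (h1 ha) b (h1 hb)

/-- An element `x` of an abelian ideal satisfies `(ad x)² = 0`, because `⁅x, y⁆` lies in the ideal
again. Tested on the two nilpotent matrix units, this forces a trace-free matrix to vanish. -/
theorem hasTrivialRadical_of_equiv_sl2 {L : Type*} [LieRing L] [LieAlgebra ℝ L]
    (e : L ≃ₗ⁅ℝ⁆ SpecialLinear.sl (Fin 2) ℝ) : HasTrivialRadical ℝ L := by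
  rw [hasTrivialRadical_iff_no_abelian_ideals]
  intro I hI
  rw [eq_bot_iff]
  intro x hx
  rw [LieSubmodule.mem_bot]
  have key : ∀ B : SpecialLinear.sl (Fin 2) ℝ, ⁅e x, ⁅e x, B⁆⁆ = 0 := by
    intro B
    have h1 : ⁅x, e.symm B⁆ ∈ I := lie_mem_left ℝ L I x _ hx
    have h2 : ⁅(⟨x, hx⟩ : I), (⟨⁅x, e.symm B⁆, h1⟩ : I)⁆ = 0 := trivial_lie_zero _ _ _ _
    have h3 : ⁅x, ⁅x, e.symm B⁆⁆ = 0 := congrArg Subtype.val h2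
    have h4 := congrArg e h3
    rwa [LieEquiv.map_lie, LieEquiv.map_lie, LieEquiv.apply_symm_apply, map_zero] at h4
  have hE := congrArg Subtype.val (key ⟨!![0, 1; 0, 0], by
    simp [SpecialLinear.sl]⟩)
  have hF := congrArg Subtype.val (key ⟨!![0, 0; 1, 0], by
    simp [SpecialLinear.sl]⟩)
  have htr : (e x).1.trace = 0 := (e x).2
  suffices h0 : (e x).1 = 0 by
    have h5 : e x = 0 := Subtype.ext h0
    simpa using h5
  simp only [LieSubalgebra.coe_bracket, Ring.lie_def, ZeroMemClass.coe_zero] at hE hF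
  generalize (e x).1 = A at hE hF htr ⊢
  rw [Matrix.trace_fin_two] at htr
  have e00 := congrFun (congrFun hE 0) 0
  have e01 := congrFun (congrFun hE 0) 1
  have e10 := congrFun (congrFun hE 1) 0
  have f10 := congrFun (congrFun hF 1) 0
  have f01 := congrFun (congrFun hF 0) 1
  simp [Matrix.mul_apply, Matrix.vecMul, dotProduct, Fin.sum_univ_two] at e00 e01 e10 f10 f01
  -- The lower left entry of `⁅A, ⁅A, E⁆⁆` is `-2 (A 1 0)²`, and the matrix unit `F` gives `A 0 1`
  -- likewise. What is left is a multiple of `(A 0 0)²`.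
  have hd : A 1 1 = -A 0 0 := by linarith
  have hc : A 1 0 = 0 := by nlinarith
  have hb : A 0 1 = 0 := by nlinarith
  have ha : A 0 0 = 0 := by
    rw [hc, hb, hd] at e01
    nlinarith
  ext i j
  fin_cases i <;> fin_cases j <;> simp [ha, hb, hc, hd]

theorem isSemisimple_of_equiv_sl2 {L : Type*} [LieRing L] [LieAlgebra ℝ L]
    (e : L ≃ₗ⁅ℝ⁆ SpecialLinear.sl (Fin 2) ℝ) : IsSemisimple ℝ L := by
  have := hasTrivialRadical_of_equiv_sl2 e
  have : Module.Finite ℝ L := Module.Finite.equiv e.symm.toLinearEquiv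
  infer_instance

/-- The three bracket rules make the projection `π` to `sl(2)` a homomorphism with kernel the copy
of `R`. That kernel is solvable; conversely `π` maps the radical onto a solvable ideal of `sl(2)`,
which is zero. So the kernel is the radical. -/
theorem hasLeviDecompositionSl2_of_linearEquiv {L : Type*} [LieRing L] [LieAlgebra ℝ L]
    {R : Type*} [LieRing R] [LieAlgebra ℝ R] [IsSolvable R] [Module.Finite ℝ R]
    {act : Matrix (Fin 2) (Fin 2) ℝ → R → R}
    (e : (SpecialLinear.sl (Fin 2) ℝ × R) ≃ₗ[ℝ] L)
    (hs : ∀ A B, ⁅e (A, 0), e (B, 0)⁆ = e (⁅A, B⁆, 0))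
    (hr : ∀ v w, ⁅e (0, v), e (0, w)⁆ = e (0, ⁅v, w⁆))
    (ha : ∀ A v, ⁅e (A, 0), e (0, v)⁆ = e (0, act A.1 v)) :
    HasLeviDecompositionSl2 L R act := by
  have : Module.Finite ℝ L := Module.Finite.equiv e
  have hdec : ∀ A v, e (A, v) = e (A, 0) + e (0, v) := fun A v => by
    rw [← map_add, Prod.mk_add_mk, add_zero, zero_add]
  have hbr : ∀ A v B w, ⁅e (A, v), e (B, w)⁆ =
      e (⁅A, B⁆, act A.1 w - act B.1 v + ⁅v, w⁆) := by
    intro A v B w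
    rw [hdec A v, hdec B w, add_lie, lie_add, lie_add, hs, ha, hr, ← lie_skew (e (0, v)), ha,
      ← map_neg, ← map_add, ← map_add, ← map_add]
    congr 1
    ext : 1
    · simp
    · simp; abel
  let σ : SpecialLinear.sl (Fin 2) ℝ →ₗ⁅ℝ⁆ L :=
    { e.toLinearMap ∘ₗ LinearMap.inl ℝ _ _ with map_lie' := fun {A B} => (hs A B).symm }
  let ρ : R →ₗ⁅ℝ⁆ L :=
    { e.toLinearMap ∘ₗ LinearMap.inr ℝ _ _ with map_lie' := fun {v w} => (hr v w).symm }
  let π : L →ₗ⁅ℝ⁆ SpecialLinear.sl (Fin 2) ℝ :=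
    { LinearMap.fst ℝ _ _ ∘ₗ e.symm.toLinearMap with
      map_lie' := fun {x y} => by
        obtain ⟨⟨A, v⟩, rfl⟩ := e.surjective x
        obtain ⟨⟨B, w⟩, rfl⟩ := e.surjective y
        simp [hbr] }
  have hσ : ∀ A, σ A = e (A, 0) := fun _ => rfl
  have hρ : ∀ v, ρ v = e (0, v) := fun _ => rfl
  have hπ : ∀ A v, π (e (A, v)) = A := fun A v => by
    change (e.symm (e (A, v))).1 = A
    simp
  have σinj : Function.Injective σ := fun A B h => by
    have := e.injective h
    simpa using this
  have ρinj : Function.Injective ρ := fun A B h => by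
    have := e.injective h
    simpa using this
  have πsurj : Function.Surjective π := fun A => ⟨e (A, 0), hπ _ _⟩
  have hker : ∀ x, x ∈ π.ker ↔ x ∈ ρ.range := by
    intro x
    obtain ⟨⟨A, v⟩, rfl⟩ := e.surjective x
    rw [LieHom.mem_ker, hπ, LieHom.mem_range]
    constructor
    · rintro rfl
      exact ⟨v, rfl⟩
    · rintro ⟨w, hw⟩
      have := e.injective hw
      simp at this
      exact this.1.symm
  have hrad : radical ℝ L = π.ker := by
    apply le_antisymm
    · intro x hx
      have htriv := hasTrivialRadical_of_equiv_sl2 (LieEquiv.refl (R := ℝ)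
        (L₁ := SpecialLinear.sl (Fin 2) ℝ))
      have hsol : IsSolvable (LieIdeal.map π (radical ℝ L)) := by
        let f : radical ℝ L →ₗ⁅ℝ⁆ LieIdeal.map π (radical ℝ L) :=
          { toFun := fun y => ⟨π y, LieIdeal.mem_map y.2⟩
            map_add' := fun y z => Subtype.ext (map_add π _ _)
            map_smul' := fun c y => Subtype.ext (map_smul π _ _)
            map_lie' := fun {y z} => Subtype.ext (LieHom.map_lie π _ _) }
        have hf : Function.Surjective f := by
          rintro ⟨y, hy⟩
          obtain ⟨z, hz⟩ := (LieIdeal.mem_map_of_surjective πsurj hy)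
          exact ⟨z, Subtype.ext hz⟩
        exact hf.lieAlgebra_isSolvable
      have hbot : LieIdeal.map π (radical ℝ L) = ⊥ :=
        HasTrivialRadical.eq_bot_of_isSolvable _
      have := LieIdeal.mem_map (f := π) hx
      rw [hbot, LieSubmodule.mem_bot] at this
      exact this
    · rw [← LieIdeal.solvable_iff_le_radical]
      let f : R →ₗ⁅ℝ⁆ π.ker :=
        { toFun := fun v => ⟨ρ v, (hker _).2 ⟨v, rfl⟩⟩
          map_add' := fun y z => Subtype.ext (map_add ρ _ _)
          map_smul' := fun c y => Subtype.ext (map_smul ρ _ _)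
          map_lie' := fun {y z} => Subtype.ext (LieHom.map_lie ρ _ _) }
      have hf : Function.Surjective f := by
        rintro ⟨y, hy⟩
        obtain ⟨v, hv⟩ := (hker _).1 hy
        exact ⟨v, Subtype.ext hv⟩
      exact hf.lieAlgebra_isSolvable
  let Φ := LieEquiv.ofInjective σ σinj
  have hmem : ∀ v, ρ v ∈ radical ℝ L := fun v => by
    rw [hrad]
    exact (hker _).2 ⟨v, rfl⟩
  let Ψ₀ : R →ₗ⁅ℝ⁆ radical ℝ L :=
    { toFun := fun v => ⟨ρ v, hmem v⟩
      map_add' := fun y z => Subtype.ext (map_add ρ _ _)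
      map_smul' := fun c y => Subtype.ext (map_smul ρ _ _)
      map_lie' := fun {y z} => Subtype.ext (LieHom.map_lie ρ _ _) }
  have hΨ : Function.Bijective Ψ₀ := by
    constructor
    · intro v w h
      exact ρinj (congrArg Subtype.val h)
    · rintro ⟨y, hy⟩
      rw [hrad] at hy
      obtain ⟨v, hv⟩ := (hker _).1 hy
      exact ⟨v, Subtype.ext hv⟩
  refine ⟨σ.range, isSemisimple_of_equiv_sl2 Φ.symm, ?_, Φ,
    { Ψ₀ with
      invFun := (Equiv.ofBijective Ψ₀ hΨ).symm
      left_inv := (Equiv.ofBijective Ψ₀ hΨ).left_inv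
      right_inv := (Equiv.ofBijective Ψ₀ hΨ).right_inv }, fun A v => ha A v⟩
  rw [hrad]
  constructor
  · rw [Submodule.disjoint_def]
    rintro x ⟨A, rfl⟩ hx
    have h1 : π (e (A, 0)) = 0 := hx
    rw [hπ] at h1
    subst h1
    exact map_zero σ
  · rw [codisjoint_iff, eq_top_iff]
    rintro x -
    obtain ⟨⟨A, v⟩, rfl⟩ := e.surjective x
    rw [hdec]
    exact Submodule.add_mem_sup ⟨A, rfl⟩ (hπ 0 v)

end Levi

/-! ### The abstract Lie algebras -/

namespace LieS59

theorem lie_def (v w : LieS59) : ⁅v, w⁆ = br v w := rfl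

instance : Module.Finite ℝ LieS59 := inferInstanceAs (Module.Finite ℝ (Fin 5 → ℝ))

instance : LieAlgebra.IsSolvable LieS59 := by
  refine LieAlgebra.isSolvable_of_lie_mem_of_lie_eq_zero
    { carrier := {v : LieS59 | v 4 = 0}
      add_mem' := fun {v w} hv hw => show v 4 + w 4 = 0 by
        rw [show v 4 = 0 from hv, show w 4 = 0 from hw, add_zero]
      zero_mem' := rfl
      smul_mem' := fun c v hv => show c * v 4 = 0 by rw [show v 4 = 0 from hv, mul_zero]
      lie_mem := fun {v w} _ => rfl } (fun _ _ => rfl) ?_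
  intro v hv w hw
  change v 4 = 0 at hv
  change w 4 = 0 at hw
  change br v w = fun _ => 0
  funext i
  fin_cases i <;> simp [br, hv, hw]

end LieS59

namespace LieS6140

theorem lie_def (v w : LieS6140) : ⁅v, w⁆ = br v w := rfl

instance : Module.Finite ℝ LieS6140 := inferInstanceAs (Module.Finite ℝ (Fin 6 → ℝ))

instance : LieAlgebra.IsSolvable LieS6140 := by
  refine LieAlgebra.isSolvable_of_lie_mem_of_lie_eq_zero
    { carrier := {v : LieS6140 | v 4 = 0 ∧ v 5 = 0}
      add_mem' := fun {v w} hv hw => show v 4 + w 4 = 0 ∧ v 5 + w 5 = 0 by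
        obtain ⟨h1, h2⟩ := hv
        obtain ⟨h3, h4⟩ := hw
        rw [h1, h2, h3, h4]
        simp
      zero_mem' := ⟨rfl, rfl⟩
      smul_mem' := fun c v hv => show c * v 4 = 0 ∧ c * v 5 = 0 by
        obtain ⟨h1, h2⟩ := hv
        rw [h1, h2]
        simp
      lie_mem := fun {v w} _ => ⟨rfl, rfl⟩ } (fun _ _ => ⟨rfl, rfl⟩) ?_
  rintro v ⟨h1, h2⟩ w ⟨h3, h4⟩
  change br v w = fun _ => 0
  funext i
  fin_cases i <;> simp [br, h1, h2, h3, h4]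

/-- The ideal spanned by `e₁, …, e₅`. -/
def nilradical : LieIdeal ℝ LieS6140 where
  carrier := {v : LieS6140 | v 5 = 0}
  add_mem' := fun {v w} hv hw => show v 5 + w 5 = 0 by
    rw [show v 5 = 0 from hv, show w 5 = 0 from hw, add_zero]
  zero_mem' := rfl
  smul_mem' := fun c v hv => show c * v 5 = 0 by rw [show v 5 = 0 from hv, mul_zero]
  lie_mem := fun {v w} _ => rfl

theorem mem_nilradical {v : LieS6140} : v ∈ nilradical ↔ v 5 = 0 := Iff.rfl

/-- The isomorphism of the ideal spanned by `e₁, …, e₅` with `LieN51`. -/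
def nilradicalEquiv : nilradical ≃ₗ⁅ℝ⁆ LieN51 where
  toFun := fun v i => v.1 (Fin.castSucc i)
  map_add' := fun _ _ => rfl
  map_smul' := fun _ _ => rfl
  map_lie' := fun {v w} => by
    have hv : v.1 5 = 0 := v.2
    have hw : w.1 5 = 0 := w.2
    change (fun i => br v.1 w.1 (Fin.castSucc i)) = LieN51.br _ _
    funext i
    fin_cases i <;> simp [br, LieN51.br, hv, hw]
  invFun := fun v => ⟨![v 0, v 1, v 2, v 3, v 4, 0], rfl⟩
  left_inv := fun v => by
    apply Subtype.ext
    funext i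
    have hv : v.1 5 = 0 := v.2
    fin_cases i <;> first | rfl | exact hv.symm
  right_inv := fun v => by
    funext i
    fin_cases i <;> rfl

/-- By Engel's theorem nilpotency means that every `ad x` is nilpotent. If `x 5 ≠ 0`, then `e₁` is
an eigenvector of `ad x` with eigenvalue `x 5`, so no nilpotent ideal contains `x`. -/
theorem isNilradical_nilradical : IsNilradical nilradical := by
  constructor
  · change LieRing.IsNilpotent nilradical
    rw [LieAlgebra.isNilpotent_iff_forall (R := ℝ)]
    intro x
    refine ⟨3, ?_⟩
    ext y
    have hx : x.1 5 = 0 := x.2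
    have hy : y.1 5 = 0 := y.2
    simp only [pow_succ, pow_zero, one_mul, Module.End.mul_apply, LieAlgebra.ad_apply]
    change br x.1 (br x.1 (br x.1 y.1)) = fun _ => 0
    funext i
    fin_cases i <;> simp [br, hx, hy]
  · intro I hI x hx
    change LieRing.IsNilpotent I at hI
    rw [LieAlgebra.isNilpotent_iff_forall (R := ℝ)] at hI
    rw [mem_nilradical]
    by_contra h5
    let e : LieS6140 := ![1, 0, 0, 0, 0, 0]
    have hbr : ⁅x, e⁆ = x 5 • e := by
      change br x e = fun i => x 5 * e i
      funext i
      fin_cases i <;> simp [br, e]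
    -- The eigenvector itself lies in the ideal, so the obstruction is visible inside `I`.
    have he : e ∈ I := by
      have h1 : ⁅x, e⁆ ∈ I := lie_mem_left ℝ _ I x e hx
      rw [hbr] at h1
      have := I.smul_mem (x 5)⁻¹ h1
      rwa [smul_smul, inv_mul_cancel₀ h5, one_smul] at this
    obtain ⟨n, hn⟩ := hI ⟨x, hx⟩
    have hpow : ∀ n, ((LieAlgebra.ad ℝ I ⟨x, hx⟩) ^ n) ⟨e, he⟩ = (x 5) ^ n • (⟨e, he⟩ : I) := by
      intro n
      induction n with
      | zero => simp
      | succ n ih =>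
        rw [pow_succ', Module.End.mul_apply, ih, map_smul, LieAlgebra.ad_apply]
        have : ⁅(⟨x, hx⟩ : I), (⟨e, he⟩ : I)⁆ = x 5 • (⟨e, he⟩ : I) := Subtype.ext hbr
        rw [this, smul_smul, pow_succ]
    have h1 := hpow n
    rw [hn] at h1
    have h2 : (0 : ℝ) = x 5 ^ n * e 0 := congrArg (fun v : I => v.1 0) h1
    simp [e] at h2
    exact pow_ne_zero n h5 h2.symm

end LieS6140

end

noncomputable section

/-! ### Smooth functions on an open set and vector fields as derivations -/

section SmoothFunctions

variable {E : Type*} [NormedAddCommGroup E] [NormedSpace ℝ E]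

/-- The smooth functions on the open set `Ω`: those whose extension by zero is smooth on `Ω`. -/
def SmoothFun (Ω : TopologicalSpace.Opens E) : Subalgebra ℝ (Ω → ℝ) where
  carrier := {f | ContDiffOn ℝ ∞ (Function.extend Subtype.val f 0) Ω}
  mul_mem' := fun {f f'} hf hf' => (hf.mul hf').congr fun p hp => by
    have h := fun u : Ω → ℝ => Subtype.val_injective.extend_apply u 0 ⟨p, hp⟩
    simp only at h
    rw [h, h, h, Pi.mul_apply]
  add_mem' := fun {f f'} hf hf' => (hf.add hf').congr fun p hp => by
    have h := fun u : Ω → ℝ => Subtype.val_injective.extend_apply u 0 ⟨p, hp⟩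
    simp only at h
    rw [h, h, h, Pi.add_apply]
  algebraMap_mem' := fun c => (contDiffOn_const (c := c)).congr fun p hp => by
    have h := fun u : Ω → ℝ => Subtype.val_injective.extend_apply u 0 ⟨p, hp⟩
    simp only at h
    rw [h, Pi.algebraMap_apply, Algebra.algebraMap_self, RingHom.id_apply]

namespace SmoothFun

variable {Ω : TopologicalSpace.Opens E}

/-- The extension of a smooth function by zero. -/
def ext (f : SmoothFun Ω) : E → ℝ := Function.extend Subtype.val f.1 0

theorem ext_apply (f : SmoothFun Ω) (p : Ω) : ext f p = f.1 p :=
  Subtype.val_injective.extend_apply f.1 0 p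

theorem contDiffAt (f : SmoothFun Ω) (p : Ω) : ContDiffAt ℝ ∞ (ext f) p :=
  ContDiffOn.contDiffAt (s := (Ω : Set E)) f.2 (Ω.isOpen.mem_nhds p.2)

theorem differentiableAt (f : SmoothFun Ω) (p : Ω) : DifferentiableAt ℝ (ext f) p :=
  (contDiffAt f p).differentiableAt (by simp)

theorem ext_eventuallyEq {f : SmoothFun Ω} {F : E → ℝ} (hF : ∀ p : Ω, f.1 p = F p) (p : Ω) :
    ext f =ᶠ[nhds p.1] F :=
  Filter.eventually_of_mem (Ω.isOpen.mem_nhds p.2) fun q hq =>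
    (ext_apply f ⟨q, hq⟩).trans (hF ⟨q, hq⟩)

@[ext]
theorem funext {f f' : SmoothFun Ω} (h : ∀ p, f.1 p = f'.1 p) : f = f' :=
  Subtype.ext (_root_.funext h)

/-- The restriction of a function that is smooth on `Ω`. -/
def restrict (F : E → ℝ) (hF : ContDiffOn ℝ ∞ F Ω) : SmoothFun Ω :=
  ⟨fun p => F p, hF.congr fun p hp =>
    Subtype.val_injective.extend_apply (fun q : Ω => F q) 0 ⟨p, hp⟩⟩

@[simp] theorem restrict_apply (F : E → ℝ) (hF : ContDiffOn ℝ ∞ F Ω) (p : Ω) :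
    (restrict F hF).1 p = F p := rfl

@[simp] theorem add_apply (f f' : SmoothFun Ω) (p : Ω) : (f + f').1 p = f.1 p + f'.1 p := rfl
@[simp] theorem sub_apply (f f' : SmoothFun Ω) (p : Ω) : (f - f').1 p = f.1 p - f'.1 p := rfl
@[simp] theorem neg_apply (f : SmoothFun Ω) (p : Ω) : (-f).1 p = -f.1 p := rfl
@[simp] theorem mul_apply (f f' : SmoothFun Ω) (p : Ω) : (f * f').1 p = f.1 p * f'.1 p := rfl
@[simp] theorem smul_apply (c : ℝ) (f : SmoothFun Ω) (p : Ω) : (c • f).1 p = c * f.1 p := rfl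
@[simp] theorem zero_apply (p : Ω) : (0 : SmoothFun Ω).1 p = 0 := rfl
@[simp] theorem one_apply (p : Ω) : (1 : SmoothFun Ω).1 p = 1 := rfl
@[simp] theorem algebraMap_apply (c : ℝ) (p : Ω) : (algebraMap ℝ (SmoothFun Ω) c).1 p = c := rfl

theorem algebraMap_injective [Nonempty Ω] :
    Function.Injective (algebraMap ℝ (SmoothFun Ω)) := fun _ _ h =>
  congrArg (fun f : SmoothFun Ω => f.1 (Classical.arbitrary Ω)) h

end SmoothFun

namespace SmoothVF

variable {Ω : TopologicalSpace.Opens E}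

/-- The restriction to `Ω` of a field that is smooth on `Ω`. -/
def restrict (F : E → E) (hF : ContDiffOn ℝ ∞ F Ω) : SmoothVF Ω :=
  ⟨(Ω : Set E).indicator F, hF.congr fun _ hp => Set.indicator_of_mem (s := (Ω : Set E)) hp _,
    fun _ hp => Set.indicator_of_notMem (s := (Ω : Set E)) hp _⟩

theorem restrict_apply (F : E → E) (hF : ContDiffOn ℝ ∞ F Ω) {p : E} (hp : p ∈ Ω) :
    (restrict F hF).1 p = F p := Set.indicator_of_mem (s := (Ω : Set E)) hp _

/-- The derivative of a function along a vector field. -/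
def lieDeriv (X : SmoothVF Ω) (f : SmoothFun Ω) : SmoothFun Ω :=
  SmoothFun.restrict (fun p => fderiv ℝ (SmoothFun.ext f) p (X.1 p)) fun p hp =>
    (((SmoothFun.contDiffAt f ⟨p, hp⟩).fderiv_right (m := ∞) (by simp)).clm_apply
      (SmoothVF.contDiffAt X hp)).contDiffWithinAt

theorem lieDeriv_apply (X : SmoothVF Ω) (f : SmoothFun Ω) (p : Ω) :
    (lieDeriv X f).1 p = fderiv ℝ (SmoothFun.ext f) p (X.1 p) := rfl

theorem lieDeriv_apply_of_hasFDerivAt (X : SmoothVF Ω) {f : SmoothFun Ω} {F : E → ℝ}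
    (hf : ∀ p : Ω, f.1 p = F p) (p : Ω) {F' : E →L[ℝ] ℝ} (hF : HasFDerivAt F F' p) :
    (lieDeriv X f).1 p = F' (X.1 p) := by
  rw [lieDeriv_apply, (SmoothFun.ext_eventuallyEq hf p).fderiv_eq, hF.fderiv]

/-- A vector field as a derivation of the algebra of smooth functions. -/
def toDerivation (X : SmoothVF Ω) : Derivation ℝ (SmoothFun Ω) (SmoothFun Ω) :=
  Derivation.mk'
    { toFun := lieDeriv X
      map_add' := fun f f' => SmoothFun.funext fun p =>
        lieDeriv_apply_of_hasFDerivAt X (f := f + f')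
          (F := fun q => SmoothFun.ext f q + SmoothFun.ext f' q)
          (fun q => by rw [SmoothFun.ext_apply, SmoothFun.ext_apply]; rfl) p
          ((SmoothFun.differentiableAt f p).hasFDerivAt.add
            (SmoothFun.differentiableAt f' p).hasFDerivAt)
      map_smul' := fun c f => SmoothFun.funext fun p =>
        lieDeriv_apply_of_hasFDerivAt X (f := c • f)
          (F := fun q => c • SmoothFun.ext f q)
          (fun q => by rw [SmoothFun.ext_apply]; rfl) p
          ((SmoothFun.differentiableAt f p).hasFDerivAt.const_smul c) }
    fun f f' => SmoothFun.funext fun p => by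
      change (lieDeriv X (f * f')).1 p = f.1 p * (lieDeriv X f').1 p + f'.1 p * (lieDeriv X f).1 p
      rw [lieDeriv_apply_of_hasFDerivAt X (f := f * f')
          (F := fun q => SmoothFun.ext f q * SmoothFun.ext f' q)
          (fun q => by rw [SmoothFun.ext_apply, SmoothFun.ext_apply]; rfl) p
          ((SmoothFun.differentiableAt f p).hasFDerivAt.mul
            (SmoothFun.differentiableAt f' p).hasFDerivAt),
        lieDeriv_apply, lieDeriv_apply, SmoothFun.ext_apply, SmoothFun.ext_apply]
      rfl

theorem toDerivation_apply (X : SmoothVF Ω) (f : SmoothFun Ω) (p : Ω) :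
    (toDerivation X f).1 p = fderiv ℝ (SmoothFun.ext f) p (X.1 p) := rfl

theorem toDerivation_apply_of_hasFDerivAt (X : SmoothVF Ω) {f : SmoothFun Ω} {F : E → ℝ}
    (hf : ∀ p : Ω, f.1 p = F p) (p : Ω) {F' : E →L[ℝ] ℝ} (hF : HasFDerivAt F F' p) :
    (toDerivation X f).1 p = F' (X.1 p) :=
  lieDeriv_apply_of_hasFDerivAt X hf p hF

theorem toDerivation_add (X Y : SmoothVF Ω) (f : SmoothFun Ω) :
    toDerivation (X + Y) f = toDerivation X f + toDerivation Y f :=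
  SmoothFun.funext fun p => map_add (fderiv ℝ (SmoothFun.ext f) p) (X.1 p) (Y.1 p)

theorem toDerivation_smul (c : ℝ) (X : SmoothVF Ω) (f : SmoothFun Ω) :
    toDerivation (c • X) f = c • toDerivation X f :=
  SmoothFun.funext fun p => map_smul (fderiv ℝ (SmoothFun.ext f) p) c (X.1 p)

/-- The second-order terms cancel by symmetry of the second derivative of `f`. -/
theorem toDerivation_lie (X Y : SmoothVF Ω) (f : SmoothFun Ω) :
    toDerivation ⁅X, Y⁆ f =
      toDerivation X (toDerivation Y f) - toDerivation Y (toDerivation X f) := by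
  ext p
  have hp := p.2
  have hd : HasFDerivAt (fderiv ℝ (SmoothFun.ext f))
      (fderiv ℝ (fderiv ℝ (SmoothFun.ext f)) p) p :=
    (((SmoothFun.contDiffAt f p).fderiv_right (m := ∞) (by simp)).differentiableAt
      (by simp)).hasFDerivAt
  have h2 : ∀ Z : SmoothVF Ω, HasFDerivAt (fun q => fderiv ℝ (SmoothFun.ext f) q (Z.1 q)) _ p :=
    fun Z => hd.clm_apply (SmoothVF.differentiableAt Z hp).hasFDerivAt
  have hsymm : IsSymmSndFDerivAt ℝ (SmoothFun.ext f) p :=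
    (SmoothFun.contDiffAt f p).isSymmSndFDerivAt (by
      rw [minSmoothness_of_isRCLikeNormedField]; exact ENat.LEInfty.out)
  rw [SmoothFun.sub_apply,
    toDerivation_apply_of_hasFDerivAt X (f := toDerivation Y f) (fun _ => rfl) p (h2 Y),
    toDerivation_apply_of_hasFDerivAt Y (f := toDerivation X f) (fun _ => rfl) p (h2 X),
    toDerivation_apply, SmoothVF.lie_apply _ _ hp, VectorField.lieBracket]
  simp only [_root_.add_apply, ContinuousLinearMap.comp_apply,
    ContinuousLinearMap.flip_apply, map_sub]
  rw [hsymm.eq (X.1 p) (Y.1 p)]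
  ring

end SmoothVF

end SmoothFunctions

/-! ### Coordinate functions and constants on a connected open set -/

section Coordinates

variable {n : ℕ} {Ω : TopologicalSpace.Opens (Fin n → ℝ)}

/-- The coordinate functions. -/
def SmoothFun.coord (Ω : TopologicalSpace.Opens (Fin n → ℝ)) (i : Fin n) : SmoothFun Ω :=
  SmoothFun.restrict (fun p => p i) (contDiff_apply ℝ ℝ i).contDiffOn

theorem SmoothVF.toDerivation_coord (X : SmoothVF Ω) (i : Fin n) (p : Ω) :
    (SmoothVF.toDerivation X (SmoothFun.coord Ω i)).1 p = X.1 p i :=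
  SmoothVF.toDerivation_apply_of_hasFDerivAt X (fun _ => rfl) p (hasFDerivAt_apply i p.1)

theorem SmoothVF.ext_of_toDerivation_eq {X Y : SmoothVF Ω}
    (h : ∀ f, SmoothVF.toDerivation X f = SmoothVF.toDerivation Y f) : X = Y :=
  SmoothVF.ext_on fun p hp => by
    funext i
    rw [← SmoothVF.toDerivation_coord X i ⟨p, hp⟩, ← SmoothVF.toDerivation_coord Y i ⟨p, hp⟩, h]

theorem SmoothFun.eq_algebraMap_of_toDerivation_eq_zero (hΩ : IsConnected (Ω : Set (Fin n → ℝ)))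
    {f : SmoothFun Ω} (hf : ∀ X : SmoothVF Ω, SmoothVF.toDerivation X f = 0) :
    ∃ c, f = algebraMap ℝ (SmoothFun Ω) c := by
  obtain ⟨c, hc⟩ := Ω.isOpen.exists_is_const_of_fderiv_eq_zero (𝕜 := ℝ) hΩ.isPreconnected
    (f := SmoothFun.ext f)
    (fun p hp => (SmoothFun.differentiableAt f ⟨p, hp⟩).differentiableWithinAt) (by
      intro p hp
      ext v
      have h := congrArg (fun f : SmoothFun Ω => f.1 ⟨p, hp⟩)
        -- Constant fields already detect the whole derivative.
        (hf (SmoothVF.restrict (fun _ => v) contDiffOn_const))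
      simp only [SmoothVF.toDerivation_apply, SmoothVF.restrict_apply _ _ hp] at h
      exact h)
  exact ⟨c, SmoothFun.funext fun p => by rw [← SmoothFun.ext_apply, hc p.1 p.2]; rfl⟩

end Coordinates

end

noncomputable section

/-! ### Symmetries of a planar body with directed thrust

In the coordinates `(t, X, X₁, Z, Z₁, θ, ω, v, w)` the control system is
`X'' = -v sin θ`, `Z'' = v cos θ`, `θ'' = w`. Its infinitesimal symmetries are determined here over
any commutative algebra with commuting partial derivatives. -/

/-- An algebra with coordinates `(t, X, X₁, Z, Z₁, θ, ω, v, w)`, their partial derivatives, and the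
functions `sin θ` and `cos θ`. -/
structure ThrustFrame (S : Type*) [CommRing S] [Algebra ℝ S] where
  /-- the partial derivatives -/
  d : Fin 9 → Derivation ℝ S S
  /-- the coordinates -/
  y : Fin 9 → S
  /-- the sine of `θ` -/
  s : S
  /-- the cosine of `θ` -/
  c : S
  d_comm : ∀ i j f, d i (d j f) = d j (d i f)
  d_y : ∀ i j, d i (y j) = if i = j then 1 else 0
  d_s : ∀ i, d i s = if i = 5 then c else 0
  d_c : ∀ i, d i c = if i = 5 then -s else 0
  sq_add_sq : s * s + c * c = 1

namespace ThrustFrame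

variable {S : Type*} [CommRing S] [Algebra ℝ S] (F : ThrustFrame S)

/-- The total derivative. -/
def T (f : S) : S :=
  F.d 0 f + F.y 2 * F.d 1 f + F.y 4 * F.d 3 f - F.y 7 * F.s * F.d 2 f + F.y 7 * F.c * F.d 4 f
    + F.y 6 * F.d 5 f + F.y 8 * F.d 6 f

/-- The equations for the components `a` of a section of the distribution spanned by the total
derivative, `∂_v` and `∂_w`. -/
def IsSection (a : Fin 9 → S) : Prop :=
  a 1 = a 0 * F.y 2 ∧ a 2 = -(a 0 * (F.y 7 * F.s)) ∧ a 3 = a 0 * F.y 4 ∧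
    a 4 = a 0 * (F.y 7 * F.c) ∧ a 5 = a 0 * F.y 6 ∧ a 6 = a 0 * F.y 8

/-- The equations for the components `a` of an infinitesimal symmetry that leaves `dt` invariant. -/
structure IsSymm (a : Fin 9 → S) : Prop where
  d_seven : ∀ i, 1 ≤ i → i ≤ 6 → F.d 7 (a i) = 0
  d_eight : ∀ i, 1 ≤ i → i ≤ 6 → F.d 8 (a i) = 0
  T_one : F.T (a 1) = a 2
  T_two : F.T (a 2) = -(a 7 * F.s) - F.y 7 * F.c * a 5
  T_three : F.T (a 3) = a 4
  T_four : F.T (a 4) = a 7 * F.c - F.y 7 * F.s * a 5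
  T_five : F.T (a 5) = a 6
  T_six : F.T (a 6) = a 8

theorem T_zero : F.T 0 = 0 := by simp [T]

/-- This and the next lemmas are the commutators of `T` with the partial derivatives: `∂_w` gives
`∂_ω`, `∂_ω` gives `∂_θ`, `∂_v` gives the derivative in the thrust direction of velocity space, and
velocity derivatives give position derivatives. -/
theorem d_eight_T (f : S) : F.d 8 (F.T f) = F.T (F.d 8 f) + F.d 6 f := by
  simp [T, F.d_y, F.d_s, F.d_c, F.d_comm 8 0, F.d_comm 8 1, F.d_comm 8 2, F.d_comm 8 3,
    F.d_comm 8 4, F.d_comm 8 5, F.d_comm 8 6]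
  ring

theorem d_seven_T (f : S) :
    F.d 7 (F.T f) = F.T (F.d 7 f) - F.s * F.d 2 f + F.c * F.d 4 f := by
  simp [T, F.d_y, F.d_s, F.d_c, F.d_comm 7 0, F.d_comm 7 1, F.d_comm 7 2, F.d_comm 7 3,
    F.d_comm 7 4, F.d_comm 7 5, F.d_comm 7 6]
  ring

theorem d_six_T (f : S) : F.d 6 (F.T f) = F.T (F.d 6 f) + F.d 5 f := by
  simp [T, F.d_y, F.d_s, F.d_c, F.d_comm 6 0, F.d_comm 6 1, F.d_comm 6 2, F.d_comm 6 3,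
    F.d_comm 6 4, F.d_comm 6 5]
  ring

theorem d_two_T (f : S) : F.d 2 (F.T f) = F.T (F.d 2 f) + F.d 1 f := by
  simp [T, F.d_y, F.d_s, F.d_c, F.d_comm 2 0, F.d_comm 2 1, F.d_comm 2 3,
    F.d_comm 2 4, F.d_comm 2 5, F.d_comm 2 6]
  ring

theorem d_four_T (f : S) : F.d 4 (F.T f) = F.T (F.d 4 f) + F.d 3 f := by
  simp [T, F.d_y, F.d_s, F.d_c, F.d_comm 4 0, F.d_comm 4 1, F.d_comm 4 2, F.d_comm 4 3,
    F.d_comm 4 5, F.d_comm 4 6]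
  ring

theorem T_sub (f f' : S) : F.T (f - f') = F.T f - F.T f' := by simp [T]; ring
theorem T_mul (f f' : S) : F.T (f * f') = f * F.T f' + f' * F.T f := by simp [T]; ring
theorem T_s : F.T F.s = F.y 6 * F.c := by simp [T, F.d_s]
theorem T_c : F.T F.c = -(F.y 6 * F.s) := by simp [T, F.d_c]

/-- A pair of functions that do not depend on `θ` and whose vector is a multiple of
`(-sin θ, cos θ)` for all `θ` vanishes. -/
theorem eq_zero_of_combination {f f' : S} (h : F.c * f + F.s * f' = 0) (hf : F.d 5 f = 0)
    (hf' : F.d 5 f' = 0) : f = 0 ∧ f' = 0 := by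
  have h1 := congrArg (F.d 5) h
  simp [F.d_s, F.d_c, hf, hf'] at h1
  have hsq := F.sq_add_sq
  constructor
  · linear_combination F.c * h - F.s * h1 - f * hsq
  · linear_combination F.s * h + F.c * h1 - f' * hsq

variable {F} {a : Fin 9 → S}

/-! ### Solving the determining equations -/

namespace IsSymm

/-- Projecting the two acceleration equations to the direction orthogonal to the thrust eliminates
`a 7`. -/
theorem angle_eq (h : F.IsSymm a) :
    F.y 7 * a 5 = -(F.c * F.T (a 2)) - F.s * F.T (a 4) := by
  rw [h.T_two, h.T_four]
  linear_combination -(F.y 7 * a 5) * F.sq_add_sq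

/-- The derivative of `angle_eq` in `v`: it isolates `a 5` without a division by the thrust. -/
theorem angle_eq' (h : F.IsSymm a) :
    a 5 = -(F.c * (F.c * F.d 4 (a 2) - F.s * F.d 2 (a 2)))
      - F.s * (F.c * F.d 4 (a 4) - F.s * F.d 2 (a 4)) := by
  have h1 := congrArg (F.d 7) h.angle_eq
  have e2 := h.d_seven 2 (by decide) (by decide)
  have e4 := h.d_seven 4 (by decide) (by decide)
  have e5 := h.d_seven 5 (by decide) (by decide)
  simp [F.d_y, F.d_s, F.d_c, d_seven_T, e2, e4, e5, T_zero] at h1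
  linear_combination h1

theorem d_six_pos (h : F.IsSymm a) : F.d 6 (a 1) = 0 ∧ F.d 6 (a 3) = 0 ∧ F.d 6 (a 5) = 0 := by
  have e := fun i h1 h2 => h.d_eight i h1 h2
  have h1 := congrArg (F.d 8) h.T_one
  have h3 := congrArg (F.d 8) h.T_three
  have h5 := congrArg (F.d 8) h.T_five
  rw [d_eight_T, e 1 (by decide) (by decide), e 2 (by decide) (by decide), T_zero, zero_add] at h1
  rw [d_eight_T, e 3 (by decide) (by decide), e 4 (by decide) (by decide), T_zero, zero_add] at h3
  rw [d_eight_T, e 5 (by decide) (by decide), e 6 (by decide) (by decide), T_zero, zero_add] at h5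
  exact ⟨h1, h3, h5⟩

/-- Since `∂_ω` kills the position components, only the commutator term `∂_θ` survives in `∂_ω T`.
-/
theorem d_six_vel (h : F.IsSymm a) :
    F.d 6 (a 2) = F.d 5 (a 1) ∧ F.d 6 (a 4) = F.d 5 (a 3) := by
  rw [← h.T_one, ← h.T_three, d_six_T, d_six_T, h.d_six_pos.1, h.d_six_pos.2.1, T_zero, zero_add,
    zero_add]
  exact ⟨rfl, rfl⟩

/-- The `∂_w` derivative of `angle_eq`: the left side is independent of `w`, and on the right `∂_w
T` leaves `∂_ω` of the velocity components, that is `∂_θ` of the position components. -/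
theorem combination_d_five (h : F.IsSymm a) :
    F.c * F.d 5 (a 1) + F.s * F.d 5 (a 3) = 0 := by
  have h1 := congrArg (F.d 8) h.angle_eq
  have e2 := h.d_eight 2 (by decide) (by decide)
  have e4 := h.d_eight 4 (by decide) (by decide)
  have e5 := h.d_eight 5 (by decide) (by decide)
  simp [F.d_y, F.d_s, F.d_c, d_eight_T, e2, e4, e5, T_zero, h.d_six_vel.1, h.d_six_vel.2] at h1
  linear_combination h1

theorem thrust_deriv (h : F.IsSymm a) :
    F.c * F.d 4 (a 1) - F.s * F.d 2 (a 1) = 0 ∧ F.c * F.d 4 (a 3) - F.s * F.d 2 (a 3) = 0 := by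
  have e := fun i h1 h2 => h.d_seven i h1 h2
  have h1 := congrArg (F.d 7) h.T_one
  have h3 := congrArg (F.d 7) h.T_three
  rw [d_seven_T, e 1 (by decide) (by decide), e 2 (by decide) (by decide), T_zero] at h1
  rw [d_seven_T, e 3 (by decide) (by decide), e 4 (by decide) (by decide), T_zero] at h3
  constructor
  · linear_combination h1
  · linear_combination h3

/-- Applying `T` to `thrust_deriv` turns thrust derivatives of the velocity components into
derivatives of the position components, in which the dependence on `ω` is explicit. -/
theorem thrust_deriv_vel (h : F.IsSymm a) :
    F.c * F.d 4 (a 2) - F.s * F.d 2 (a 2) =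
      F.c * F.d 3 (a 1) - F.s * F.d 1 (a 1) + F.y 6 * (F.c * F.d 2 (a 1) + F.s * F.d 4 (a 1)) ∧
    F.c * F.d 4 (a 4) - F.s * F.d 2 (a 4) =
      F.c * F.d 3 (a 3) - F.s * F.d 1 (a 3) + F.y 6 * (F.c * F.d 2 (a 3) + F.s * F.d 4 (a 3)) := by
  have h1 := congrArg F.T h.thrust_deriv.1
  have h3 := congrArg F.T h.thrust_deriv.2
  simp only [T_sub, T_mul, T_s, T_c, T_zero] at h1 h3
  rw [← h.T_one, ← h.T_three]
  simp only [d_two_T, d_four_T]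
  constructor
  · linear_combination h1
  · linear_combination h3

/-- The formula for `a 5` becomes affine in `ω`, whereas `a 5` does not depend on `ω`; so the
coefficient of `ω` vanishes. Together with `thrust_deriv` this shows that each velocity derivative
of `(a₁, a₃)` is orthogonal to `(cos θ, sin θ)`. -/
theorem d_vel_pos (h : F.IsSymm a) :
    (F.d 2 (a 1) = 0 ∧ F.d 2 (a 3) = 0) ∧ F.d 4 (a 1) = 0 ∧ F.d 4 (a 3) = 0 := by
  have hsq := F.sq_add_sq
  have h5 := h.angle_eq'
  rw [h.thrust_deriv_vel.1, h.thrust_deriv_vel.2] at h5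
  have h6 := congrArg (F.d 6) h5
  obtain ⟨p1, p3, p5⟩ := h.d_six_pos
  simp [F.d_y, F.d_s, F.d_c, F.d_comm 6 1, F.d_comm 6 2, F.d_comm 6 3, F.d_comm 6 4, p1, p3,
    p5] at h6
  obtain ⟨n1, n3⟩ := h.thrust_deriv
  have i2 : F.c * F.d 2 (a 1) + F.s * F.d 2 (a 3) = 0 := by
    linear_combination F.c * h6 - F.c * F.s * n1 - F.s * F.s * n3
      - (F.c * F.d 2 (a 1) + F.s * F.d 2 (a 3)) * hsq
  have i4 : F.c * F.d 4 (a 1) + F.s * F.d 4 (a 3) = 0 := by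
    linear_combination F.s * h6 + F.c * F.c * n1 + F.s * F.c * n3
      - (F.c * F.d 4 (a 1) + F.s * F.d 4 (a 3)) * hsq
  -- The `θ` derivative of `i2`, compared with the velocity derivative of `combination_d_five`,
  -- gives the orthogonal combination too: the second-order terms agree. The rotation matrix is then
  -- inverted; `j4` and `k4` do the same for the other velocity.
  have j2 := congrArg (F.d 5) i2
  have j4 := congrArg (F.d 5) i4
  have k2 := congrArg (F.d 2) h.combination_d_five
  have k4 := congrArg (F.d 4) h.combination_d_five
  simp [F.d_s, F.d_c, F.d_comm 5 2, F.d_comm 5 4] at j2 j4 k2 k4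
  refine ⟨⟨?_, ?_⟩, ?_, ?_⟩
  · linear_combination F.c * i2 - F.s * (j2 - k2) - F.d 2 (a 1) * hsq
  · linear_combination F.s * i2 + F.c * (j2 - k2) - F.d 2 (a 3) * hsq
  · linear_combination F.c * i4 - F.s * (j4 - k4) - F.d 4 (a 1) * hsq
  · linear_combination F.s * i4 + F.c * (j4 - k4) - F.d 4 (a 3) * hsq

/-- Two `ω` derivatives of `angle_eq` give `2 (cos θ ∂_θ² a₁ + sin θ ∂_θ² a₃) = 0`. Subtracting this
from the `θ` derivative of `combination_d_five` leaves the complementary first-order combination. -/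
theorem d_five_pos (h : F.IsSymm a) : F.d 5 (a 1) = 0 ∧ F.d 5 (a 3) = 0 := by
  have hsq := F.sq_add_sq
  have hα := h.angle_eq
  obtain ⟨⟨d21, d23⟩, d41, d43⟩ := h.d_vel_pos
  obtain ⟨p1, p3, p5⟩ := h.d_six_pos
  obtain ⟨v1, v3⟩ := h.d_six_vel
  have h1 := congrArg (F.d 6) hα
  simp [F.d_y, F.d_s, F.d_c, d_six_T, p5, v1, v3] at h1
  have h2 := congrArg (F.d 6) h1
  simp [F.d_s, F.d_c, d_six_T, F.d_comm 6 5, p1, p3, v1, v3, T_zero] at h2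
  have h3 := congrArg (F.d 5) h.combination_d_five
  simp [F.d_s, F.d_c] at h3
  have h4 := h.combination_d_five
  have h5 : F.c * F.d 5 (a 3) - F.s * F.d 5 (a 1) = 0 := by
    have h6 : (2 : ℝ) • (F.c * F.d 5 (a 3) - F.s * F.d 5 (a 1)) = 0 := by
      rw [two_smul]
      linear_combination 2 * h3 - h2
    simpa using h6
  constructor
  · linear_combination F.c * h4 - F.s * h5 - F.d 5 (a 1) * hsq
  · linear_combination F.s * h4 + F.c * h5 - F.d 5 (a 3) * hsq

theorem d_pos_eq_zero (h : F.IsSymm a) (i : Fin 9) (h0 : i ≠ 0) (h1 : i ≠ 1) (h3 : i ≠ 3) :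
    F.d i (a 1) = 0 ∧ F.d i (a 3) = 0 := by
  obtain ⟨d2, d4⟩ := h.d_vel_pos
  obtain ⟨p1, p3, -⟩ := h.d_six_pos
  fin_cases i
  · exact absurd rfl h0
  · exact absurd rfl h1
  · exact d2
  · exact absurd rfl h3
  · exact d4
  · exact h.d_five_pos
  · exact ⟨p1, p3⟩
  · exact ⟨h.d_seven 1 (by decide) (by decide), h.d_seven 3 (by decide) (by decide)⟩
  · exact ⟨h.d_eight 1 (by decide) (by decide), h.d_eight 3 (by decide) (by decide)⟩

/-- With the remaining derivatives gone, `T` of a position component is its time derivative along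
`X' = X₁`, `Z' = Z₁`. -/
theorem vel_eq (h : F.IsSymm a) :
    a 2 = F.d 0 (a 1) + F.y 2 * F.d 1 (a 1) + F.y 4 * F.d 3 (a 1) ∧
    a 4 = F.d 0 (a 3) + F.y 2 * F.d 1 (a 3) + F.y 4 * F.d 3 (a 3) := by
  have e := fun i h0 h1 h3 => h.d_pos_eq_zero i h0 h1 h3
  obtain ⟨e21, e23⟩ := e 2 (by decide) (by decide) (by decide)
  obtain ⟨e41, e43⟩ := e 4 (by decide) (by decide) (by decide)
  obtain ⟨e51, e53⟩ := e 5 (by decide) (by decide) (by decide)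
  obtain ⟨e61, e63⟩ := e 6 (by decide) (by decide) (by decide)
  rw [← h.T_one, ← h.T_three]
  simp [T, e21, e23, e41, e43, e51, e53, e61, e63]

theorem d_d_pos_of_ne (h : F.IsSymm a) (i j : Fin 9) (h0 : i ≠ 0) (h1 : i ≠ 1) (h3 : i ≠ 3) :
    F.d i (F.d j (a 1)) = 0 ∧ F.d i (F.d j (a 3)) = 0 := by
  obtain ⟨e1, e3⟩ := h.d_pos_eq_zero i h0 h1 h3
  rw [F.d_comm i j, F.d_comm i j, e1, e3, map_zero]
  exact ⟨rfl, rfl⟩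

end IsSymm

variable (F) in
/-- The second time derivative of a function of `(t, X, Z)` along free motion. -/
def freeAcceleration (f : S) : S :=
  F.d 0 (F.d 0 f) + 2 * F.y 2 * F.d 0 (F.d 1 f) + 2 * F.y 4 * F.d 0 (F.d 3 f)
    + F.y 2 * F.y 2 * F.d 1 (F.d 1 f) + 2 * F.y 2 * F.y 4 * F.d 1 (F.d 3 f)
    + F.y 4 * F.y 4 * F.d 3 (F.d 3 f)

/-- A function of `(t, X, Z)` without acceleration along free motions is affine. -/
theorem d_d_eq_zero_of_freeAcceleration {f : S}
    (hf : ∀ i : Fin 9, i ≠ 0 → i ≠ 1 → i ≠ 3 → F.d i f = 0) (h : F.freeAcceleration f = 0)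
    (i j : Fin 9) : F.d i (F.d j f) = 0 := by
  have hij : ∀ i j : Fin 9, i ≠ 0 → i ≠ 1 → i ≠ 3 → F.d i (F.d j f) = 0 := fun i j h0 h1 h3 => by
    rw [F.d_comm, hf i h0 h1 h3, map_zero]
  have e2 := fun j => hij 2 j (by decide) (by decide) (by decide)
  have e4 := fun j => hij 4 j (by decide) (by decide) (by decide)
  have two : ∀ x : S, 2 * x = 0 → x = 0 := fun x hx => by
    have h6 : (2 : ℝ) • x = 0 := by
      rw [two_smul]
      linear_combination hx
    simpa using h6
  have e2' : ∀ i j, F.d 2 (F.d i (F.d j f)) = 0 := fun i j => by rw [F.d_comm, e2, map_zero]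
  have e4' : ∀ i j, F.d 4 (F.d i (F.d j f)) = 0 := fun i j => by rw [F.d_comm, e4, map_zero]
  have h2 := congrArg (F.d 2) h
  have h4 := congrArg (F.d 4) h
  have n2 : F.d 2 (2 : S) = 0 := by simpa using (F.d 2).map_natCast 2
  have n4 : F.d 4 (2 : S) = 0 := by simpa using (F.d 4).map_natCast 2
  simp [freeAcceleration, F.d_y, e2', e4', n2, n4] at h2 h4
  -- The free acceleration is a quadratic polynomial in the velocities with coefficients free of
  -- them; its coefficients are read off from the top degree down.
  have h22 := congrArg (F.d 2) h2
  have h24 := congrArg (F.d 4) h2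
  have h44 := congrArg (F.d 4) h4
  simp [F.d_y, e2', e4', n2, n4] at h22 h24 h44
  have f11 : F.d 1 (F.d 1 f) = 0 := two _ (by linear_combination h22)
  have f13 : F.d 1 (F.d 3 f) = 0 := two _ (by linear_combination h24)
  have f33 : F.d 3 (F.d 3 f) = 0 := two _ (by linear_combination h44)
  have f01 : F.d 0 (F.d 1 f) = 0 := two _ (by
    rw [f11, f13] at h2
    linear_combination h2)
  have f03 : F.d 0 (F.d 3 f) = 0 := two _ (by
    rw [f33, f13] at h4
    linear_combination h4)
  have f00 : F.d 0 (F.d 0 f) = 0 := by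
    rw [freeAcceleration, f01, f03, f11, f13, f33] at h
    linear_combination h
  by_cases hi : i ≠ 0 ∧ i ≠ 1 ∧ i ≠ 3
  · exact hij i j hi.1 hi.2.1 hi.2.2
  by_cases hj : j ≠ 0 ∧ j ≠ 1 ∧ j ≠ 3
  · rw [hf j hj.1 hj.2.1 hj.2.2, map_zero]
  have hi' : i = 0 ∨ i = 1 ∨ i = 3 := by tauto
  have hj' : j = 0 ∨ j = 1 ∨ j = 3 := by tauto
  rcases hi' with rfl | rfl | rfl <;> rcases hj' with rfl | rfl | rfl <;>
    first | assumption | (rw [F.d_comm]; assumption)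

namespace IsSymm

/-- Inserting `angle_eq'` into `angle_eq` cancels the terms proportional to `v` and leaves `cos θ ·
A₁ + sin θ · A₃ = 0`, where `A₁` and `A₃` are the free accelerations of the position components.
These do not depend on `θ`, so both vanish, and the position components are affine in `(t, X, Z)`.
-/
theorem d_d_pos (h : F.IsSymm a) (i j : Fin 9) :
    F.d i (F.d j (a 1)) = 0 ∧ F.d i (F.d j (a 3)) = 0 := by
  have e := fun i h0 h1 h3 => h.d_pos_eq_zero i h0 h1 h3
  have ee := fun i j h0 h1 h3 => h.d_d_pos_of_ne i j h0 h1 h3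
  have e5 := fun j => ee 5 j (by decide) (by decide) (by decide)
  have e5' : ∀ i j, F.d 5 (F.d i (F.d j (a 1))) = 0 ∧ F.d 5 (F.d i (F.d j (a 3))) = 0 :=
    fun i j => by
      rw [F.d_comm, (e5 j).1, map_zero, F.d_comm, (e5 j).2, map_zero]
      exact ⟨rfl, rfl⟩
  have n5 : F.d 5 (2 : S) = 0 := by simpa using (F.d 5).map_natCast 2
  -- Along the system, the acceleration of a function of `(t, X, Z)` is its free acceleration plus
  -- the contribution of the thrust to its gradient.
  have hT : ∀ b : S, (∀ i j : Fin 9, i ≠ 0 → i ≠ 1 → i ≠ 3 → F.d i (F.d j b) = 0) →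
      F.T (F.d 0 b + F.y 2 * F.d 1 b + F.y 4 * F.d 3 b) = F.freeAcceleration b
        + F.y 7 * (F.c * F.d 3 b - F.s * F.d 1 b) := by
    intro b hb
    have b2 := fun j => hb 2 j (by decide) (by decide) (by decide)
    have b4 := fun j => hb 4 j (by decide) (by decide) (by decide)
    have b5 := fun j => hb 5 j (by decide) (by decide) (by decide)
    have b6 := fun j => hb 6 j (by decide) (by decide) (by decide)
    simp [T, freeAcceleration, F.d_y, b2, b4, b5, b6, F.d_comm 3 0, F.d_comm 1 0, F.d_comm 3 1]
    ring
  have hα := h.angle_eq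
  have hα' := h.angle_eq'
  rw [h.vel_eq.1, h.vel_eq.2] at hα hα'
  rw [hT _ fun i j h0 h1 h3 => (ee i j h0 h1 h3).1, hT _ fun i j h0 h1 h3 => (ee i j h0 h1 h3).2]
    at hα
  have e2 := fun j => ee 2 j (by decide) (by decide) (by decide)
  have e4 := fun j => ee 4 j (by decide) (by decide) (by decide)
  simp [F.d_y, e2, e4] at hα'
  have hcomb : F.c * F.freeAcceleration (a 1) + F.s * F.freeAcceleration (a 3) = 0 := by
    rw [hα'] at hα
    linear_combination hα
  have h5 := F.eq_zero_of_combination hcomb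
    (by simp [freeAcceleration, F.d_y, e5', n5]) (by simp [freeAcceleration, F.d_y, e5', n5])
  exact ⟨d_d_eq_zero_of_freeAcceleration (fun i h0 h1 h3 => (e i h0 h1 h3).1) h5.1 i j,
    d_d_eq_zero_of_freeAcceleration (fun i h0 h1 h3 => (e i h0 h1 h3).2) h5.2 i j⟩

/-- The velocity components follow by `T`, the angle by `angle_eq'`, then `a 6` and `a 8` by `T`;
finally `a 7` is the projection of the acceleration equations to the thrust. Thus symmetries need
only be compared in components 0, 1 and 3. -/
theorem eq_zero (h : F.IsSymm a) (h0 : a 0 = 0) (h1 : a 1 = 0) (h3 : a 3 = 0) : a = 0 := by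
  have hsq := F.sq_add_sq
  have h2 : a 2 = 0 := by rw [← h.T_one, h1, T_zero]
  have h4 : a 4 = 0 := by rw [← h.T_three, h3, T_zero]
  have h5 : a 5 = 0 := by
    rw [h.angle_eq', h2, h4]
    simp
  have h6 : a 6 = 0 := by rw [← h.T_five, h5, T_zero]
  have h8 : a 8 = 0 := by rw [← h.T_six, h6, T_zero]
  have e2 := h.T_two
  have e4 := h.T_four
  rw [h2, h5, T_zero] at e2
  rw [h4, h5, T_zero] at e4
  have h7 : a 7 = 0 := by linear_combination F.s * e2 - F.c * e4 - a 7 * hsq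
  funext i
  fin_cases i <;> assumption

theorem sub {b : Fin 9 → S} (h : F.IsSymm a) (h' : F.IsSymm b) : F.IsSymm (a - b) where
  d_seven i h1 h6 := by rw [Pi.sub_apply, map_sub, h.d_seven i h1 h6, h'.d_seven i h1 h6, sub_zero]
  d_eight i h1 h6 := by rw [Pi.sub_apply, map_sub, h.d_eight i h1 h6, h'.d_eight i h1 h6, sub_zero]
  T_one := by simp only [Pi.sub_apply, T_sub, h.T_one, h'.T_one]
  T_two := by simp only [Pi.sub_apply, T_sub, h.T_two, h'.T_two]; ring
  T_three := by simp only [Pi.sub_apply, T_sub, h.T_three, h'.T_three]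
  T_four := by simp only [Pi.sub_apply, T_sub, h.T_four, h'.T_four]; ring
  T_five := by simp only [Pi.sub_apply, T_sub, h.T_five, h'.T_five]
  T_six := by simp only [Pi.sub_apply, T_sub, h.T_six, h'.T_six]

end IsSymm

/-! ### Affine symmetries and their brackets -/

variable (F) in
/-- The components of the infinitesimal symmetry that induces the affine motion
`t ↦ t + ε s`, `P ↦ P + ε (m P + c t + b)`, where `P = (X, Z)` and
`ξ = (m₁₁, m₁₂, m₂₁, m₂₂, c₁, c₂, b₁, b₂, s)`. -/
def affineSymm (ξ : Fin 9 → ℝ) : Fin 9 → S :=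
  let m := fun i => algebraMap ℝ S (ξ i)
  ![m 8,
    m 0 * F.y 1 + m 1 * F.y 3 + m 4 * F.y 0 + m 6,
    m 0 * F.y 2 + m 1 * F.y 4 + m 4,
    m 2 * F.y 1 + m 3 * F.y 3 + m 5 * F.y 0 + m 7,
    m 2 * F.y 2 + m 3 * F.y 4 + m 5,
    (m 0 - m 3) * F.s * F.c - m 1 * F.c ^ 2 + m 2 * F.s ^ 2,
    ((m 0 - m 3) * (F.c ^ 2 - F.s ^ 2) + 2 * (m 1 + m 2) * F.s * F.c) * F.y 6,
    (m 0 * F.s ^ 2 - (m 1 + m 2) * F.s * F.c + m 3 * F.c ^ 2) * F.y 7,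
    (2 * (m 1 + m 2) * (F.c ^ 2 - F.s ^ 2) - 4 * (m 0 - m 3) * F.s * F.c) * F.y 6 ^ 2
      + ((m 0 - m 3) * (F.c ^ 2 - F.s ^ 2) + 2 * (m 1 + m 2) * F.s * F.c) * F.y 8]

theorem d_natCast_two (i : Fin 9) : F.d i (2 : S) = 0 := by simpa using (F.d i).map_natCast 2

theorem isSymm_affineSymm (ξ : Fin 9 → ℝ) : F.IsSymm (F.affineSymm ξ) where
  d_seven i h1 h6 := by
    fin_cases i <;> simp at h1 h6 <;>
      simp [affineSymm, F.d_y, F.d_s, F.d_c, d_natCast_two]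
  d_eight i h1 h6 := by
    fin_cases i <;> simp at h1 h6 <;>
      simp [affineSymm, F.d_y, F.d_s, F.d_c, d_natCast_two]
  T_one := by
    simp [affineSymm, T, F.d_y]
    ring
  T_two := by
    simp [affineSymm, T, F.d_y]
    linear_combination (F.y 7 * (algebraMap ℝ S (ξ 0) * F.s
      - algebraMap ℝ S (ξ 1) * F.c)) * F.sq_add_sq
  T_three := by
    simp [affineSymm, T, F.d_y]
    ring
  T_four := by
    simp [affineSymm, T, F.d_y]
    linear_combination (F.y 7 * (algebraMap ℝ S (ξ 2) * F.s
      - algebraMap ℝ S (ξ 3) * F.c)) * F.sq_add_sq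
  T_five := by
    simp [affineSymm, T, F.d_s, F.d_c]
    ring
  T_six := by
    simp [affineSymm, T, F.d_y, F.d_s, F.d_c, d_natCast_two]
    ring

theorem affineSymm_add (ξ η : Fin 9 → ℝ) :
    F.affineSymm (ξ + η) = F.affineSymm ξ + F.affineSymm η := by
  funext j
  fin_cases j <;> simp [affineSymm] <;> ring

theorem affineSymm_smul (r : ℝ) (ξ : Fin 9 → ℝ) :
    F.affineSymm (r • ξ) = r • F.affineSymm ξ := by
  funext j
  fin_cases j <;> simp [affineSymm, Algebra.smul_def] <;> ring

/-- A section whose time component vanishes is a combination of `∂_v` and `∂_w`. -/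
theorem d_eq_zero_of_isSection {i : Fin 9} (h : F.IsSection fun j => -F.d i (a j))
    (h0 : F.d i (a 0) = 0) (j : Fin 9) (hj : 1 ≤ j) (hj' : j ≤ 6) : F.d i (a j) = 0 := by
  obtain ⟨e1, e2, e3, e4, e5, e6⟩ := h
  beta_reduce at e1 e2 e3 e4 e5 e6
  rw [h0, neg_zero, zero_mul, neg_eq_zero] at e1 e3 e4 e5 e6
  rw [h0, neg_zero, zero_mul, neg_zero, neg_eq_zero] at e2
  fin_cases j
  · exact h0
  · exact e1
  · exact e2
  · exact e3
  · exact e4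
  · exact e5
  · exact e6
  · simp at hj'
  · simp at hj'

/-- The three hypotheses say that the brackets with `∂_v`, `∂_w` and `T` are sections. The time
components vanish, so components 1 to 6 vanish as well; for `T` these are the prolongation
equations. -/
theorem isSymm_of_isSection {D : Derivation ℝ S S} (hy : ∀ j, D (F.y j) = a j)
    (hs : D F.s = a 5 * F.c) (hc : D F.c = -(a 5 * F.s)) (h0 : ∀ i, F.d i (a 0) = 0)
    (h7 : F.IsSection fun j => -F.d 7 (a j)) (h8 : F.IsSection fun j => -F.d 8 (a j))
    (hT : F.IsSection fun j => D (F.T (F.y j)) - F.T (a j)) : F.IsSymm a := by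
  have hT0 : F.T (a 0) = 0 := by simp [h0, T]
  have hTy : ∀ j, F.T (F.y j) = (![1, F.y 2, -(F.y 7 * F.s), F.y 4, F.y 7 * F.c, F.y 6, F.y 8,
      0, 0] : Fin 9 → S) j := by
    intro j
    fin_cases j <;> simp [T, F.d_y]
  have hD0 : D (F.T (F.y 0)) - F.T (a 0) = 0 := by rw [hT0, hTy]; simp
  obtain ⟨e1, e2, e3, e4, e5, e6⟩ := hT
  beta_reduce at e1 e2 e3 e4 e5 e6
  rw [hD0, zero_mul] at e1 e3 e4 e5 e6
  rw [hD0, zero_mul, neg_zero] at e2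
  rw [hTy] at e1 e2 e3 e4 e5 e6
  simp [hy, hs, hc] at e1 e2 e3 e4 e5 e6
  exact
    { d_seven := d_eq_zero_of_isSection h7 (h0 7)
      d_eight := d_eq_zero_of_isSection h8 (h0 8)
      T_one := by linear_combination -e1
      T_two := by linear_combination -e2
      T_three := by linear_combination -e3
      T_four := by linear_combination -e4
      T_five := by linear_combination -e5
      T_six := by linear_combination -e6 }

/-- Conversely, for a section `b` the determining equations express the bracket entirely through
derivatives of the coefficients of `b`, which preserve the shape of a section. -/
theorem IsSymm.isSection_lie (h : F.IsSymm a) {b : Fin 9 → S} (hb : F.IsSection b)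
    {D D' : Derivation ℝ S S} (hy : ∀ j, D (F.y j) = a j)
    (hs : D F.s = a 5 * F.c) (hc : D F.c = -(a 5 * F.s)) (h0 : D' (a 0) = 0)
    (hD' : ∀ f, D' f = b 0 * F.T f + b 7 * F.d 7 f + b 8 * F.d 8 f) :
    F.IsSection fun j => D (b j) - D' (a j) := by
  have hD : ∀ j : Fin 9, 1 ≤ j → j ≤ 6 → D' (a j) = b 0 * F.T (a j) := fun j h1 h6 => by
    rw [hD', h.d_seven j h1 h6, h.d_eight j h1 h6]
    ring
  obtain ⟨h1, h2, h3, h4, h5, h6⟩ := hb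
  refine ⟨?_, ?_, ?_, ?_, ?_, ?_⟩
  · beta_reduce
    rw [h0, hD 1 (by decide) (by decide), h.T_one, h1]
    simp [hy]
    ring
  · beta_reduce
    rw [h0, hD 2 (by decide) (by decide), h.T_two, h2]
    simp [hy, hs]
    ring
  · beta_reduce
    rw [h0, hD 3 (by decide) (by decide), h.T_three, h3]
    simp [hy]
    ring
  · beta_reduce
    rw [h0, hD 4 (by decide) (by decide), h.T_four, h4]
    simp [hy, hc]
    ring
  · beta_reduce
    rw [h0, hD 5 (by decide) (by decide), h.T_five, h5]
    simp [hy]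
    ring
  · beta_reduce
    rw [h0, hD 6 (by decide) (by decide), h.T_six, h6]
    simp [hy]
    ring

theorem affineSymm_eq_zero {ξ : Fin 9 → ℝ} (hinj : Function.Injective (algebraMap ℝ S))
    (h : F.affineSymm ξ = 0) : ξ = 0 := by
  have h0 := fun j => congrFun h j
  have hz : ∀ c : ℝ, algebraMap ℝ S c = 0 → c = 0 := fun c hc => hinj (by rw [hc, map_zero])
  have d1 : ∀ i, F.d i (F.affineSymm ξ 1) = 0 := fun i => by rw [h0, Pi.zero_apply, map_zero]
  have d3 : ∀ i, F.d i (F.affineSymm ξ 3) = 0 := fun i => by rw [h0, Pi.zero_apply, map_zero]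
  have e0 : ξ 0 = 0 := hz _ (by simpa [affineSymm, F.d_y] using d1 1)
  have e1 : ξ 1 = 0 := hz _ (by simpa [affineSymm, F.d_y] using d1 3)
  have e4 : ξ 4 = 0 := hz _ (by simpa [affineSymm, F.d_y] using d1 0)
  have e2 : ξ 2 = 0 := hz _ (by simpa [affineSymm, F.d_y] using d3 1)
  have e3 : ξ 3 = 0 := hz _ (by simpa [affineSymm, F.d_y] using d3 3)
  have e5 : ξ 5 = 0 := hz _ (by simpa [affineSymm, F.d_y] using d3 0)
  have e8 : ξ 8 = 0 := hz _ (h0 0)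
  have e6 : ξ 6 = 0 := hz _ (by simpa [affineSymm, e0, e1, e4] using h0 1)
  have e7 : ξ 7 = 0 := hz _ (by simpa [affineSymm, e2, e3, e5] using h0 3)
  funext i
  fin_cases i <;> assumption

/-- If only constants have vanishing partial derivatives, then every symmetry that leaves `dt`
invariant is affine. -/
theorem IsSymm.exists_eq_affineSymm (h : F.IsSymm a)
    (const : ∀ f : S, (∀ i, F.d i f = 0) → ∃ c, f = algebraMap ℝ S c) {σ : ℝ}
    (h0 : a 0 = algebraMap ℝ S σ) : ∃ ξ, a = F.affineSymm ξ := by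
  have affine : ∀ f : S, (∀ i j, F.d i (F.d j f) = 0) →
      (∀ i : Fin 9, i ≠ 0 → i ≠ 1 → i ≠ 3 → F.d i f = 0) →
      ∃ c0 c1 c3 c : ℝ, f = algebraMap ℝ S c1 * F.y 1 + algebraMap ℝ S c3 * F.y 3
        + algebraMap ℝ S c0 * F.y 0 + algebraMap ℝ S c := by
    intro f h2 h1
    obtain ⟨c0, e0⟩ := const _ fun i => h2 i 0
    obtain ⟨c1, e1⟩ := const _ fun i => h2 i 1
    obtain ⟨c3, e3⟩ := const _ fun i => h2 i 3
    obtain ⟨c, hc⟩ := const (f - (algebraMap ℝ S c1 * F.y 1 + algebraMap ℝ S c3 * F.y 3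
        + algebraMap ℝ S c0 * F.y 0)) (by
      intro i
      simp only [map_sub, map_add, Derivation.leibniz, Derivation.map_algebraMap, F.d_y,
        smul_eq_mul]
      by_cases i0 : i = 0
      · subst i0
        simp [e0]
      by_cases i1 : i = 1
      · subst i1
        simp [e1]
      by_cases i3 : i = 3
      · subst i3
        simp [e3]
      simp [i0, i1, i3, h1 i i0 i1 i3])
    exact ⟨c0, c1, c3, c, by rw [← hc]; ring⟩
  obtain ⟨p0, p1, p3, p, hp⟩ := affine (a 1) (fun i j => (h.d_d_pos i j).1)
    fun i i0 i1 i3 => (h.d_pos_eq_zero i i0 i1 i3).1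
  obtain ⟨q0, q1, q3, q, hq⟩ := affine (a 3) (fun i j => (h.d_d_pos i j).2)
    fun i i0 i1 i3 => (h.d_pos_eq_zero i i0 i1 i3).2
  -- The affine symmetry with the same time and position components differs from `a` by a symmetry
  -- to which `IsSymm.eq_zero` applies.
  exact ⟨![p1, p3, q1, q3, p0, q0, p, q, σ],
    sub_eq_zero.1 ((h.sub (F.isSymm_affineSymm ![p1, p3, q1, q3, p0, q0, p, q, σ])).eq_zero
      (sub_eq_zero.2 h0) (sub_eq_zero.2 hp) (sub_eq_zero.2 hq))⟩

/-- The matrix commutator `η ξ - ξ η`, where `ξ` stands for the matrix with blocks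
`(m, c, b), (0, 0, s), (0, 0, 0)`. -/
def affineBracket (ξ η : Fin 9 → ℝ) : Fin 9 → ℝ :=
  ![η 0 * ξ 0 + η 1 * ξ 2 - (ξ 0 * η 0 + ξ 1 * η 2),
    η 0 * ξ 1 + η 1 * ξ 3 - (ξ 0 * η 1 + ξ 1 * η 3),
    η 2 * ξ 0 + η 3 * ξ 2 - (ξ 2 * η 0 + ξ 3 * η 2),
    η 2 * ξ 1 + η 3 * ξ 3 - (ξ 2 * η 1 + ξ 3 * η 3),
    η 0 * ξ 4 + η 1 * ξ 5 - (ξ 0 * η 4 + ξ 1 * η 5),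
    η 2 * ξ 4 + η 3 * ξ 5 - (ξ 2 * η 4 + ξ 3 * η 5),
    η 0 * ξ 6 + η 1 * ξ 7 + η 4 * ξ 8 - (ξ 0 * η 6 + ξ 1 * η 7 + ξ 4 * η 8),
    η 2 * ξ 6 + η 3 * ξ 7 + η 5 * ξ 8 - (ξ 2 * η 6 + ξ 3 * η 7 + ξ 5 * η 8),
    0]

/-- The commutator of two affine symmetries. -/
theorem affineSymm_lie {ξ η : Fin 9 → ℝ} {D D' : Derivation ℝ S S}
    (hD : ∀ j, D (F.y j) = F.affineSymm ξ j) (hD' : ∀ j, D' (F.y j) = F.affineSymm η j)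
    (j : Fin 9) (hj : j = 0 ∨ j = 1 ∨ j = 3) :
    D (F.affineSymm η j) - D' (F.affineSymm ξ j) = F.affineSymm (affineBracket ξ η) j := by
  rcases hj with rfl | rfl | rfl <;> simp [affineSymm, affineBracket, hD, hD'] <;> ring

end ThrustFrame

end

noncomputable section

/-! ### Flat coordinates of the PVTOL system -/

section FlatCoordinates

open Real

/-- The flat coordinates: the flat outputs `x - k sin θ` and `z + k cos θ + g t² / 2`, their time
derivatives, the corresponding thrust `u₁ - k θ₁²`, and `lam u₂`. -/
def flatCoord (k g lam : ℝ) (p : PVTOLSpace) : PVTOLSpace :=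
  ![p 0, p 1 - k * sin (p 5), p 2 - k * p 6 * cos (p 5),
    p 3 + k * cos (p 5) + g / 2 * p 0 ^ 2, p 4 - k * p 6 * sin (p 5) + g * p 0,
    p 5, p 6, p 7 - k * p 6 ^ 2, lam * p 8]

/-- The derivative of the flat coordinates. -/
def toFlat (k g lam : ℝ) (p : PVTOLSpace) : PVTOLSpace →L[ℝ] PVTOLSpace :=
  let d := fun i => ContinuousLinearMap.proj (R := ℝ) (φ := fun _ : Fin 9 => ℝ) i
  ContinuousLinearMap.pi
    ![d 0, d 1 - (k * cos (p 5)) • d 5, d 2 - (k * cos (p 5)) • d 6 + (k * p 6 * sin (p 5)) • d 5,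
      d 3 - (k * sin (p 5)) • d 5 + (g * p 0) • d 0,
      d 4 - (k * sin (p 5)) • d 6 - (k * p 6 * cos (p 5)) • d 5 + g • d 0,
      d 5, d 6, d 7 - (2 * k * p 6) • d 6, lam • d 8]

/-- The inverse of the derivative of the flat coordinates. -/
def ofFlat (k g lam : ℝ) (p : PVTOLSpace) : PVTOLSpace →L[ℝ] PVTOLSpace :=
  let d := fun i => ContinuousLinearMap.proj (R := ℝ) (φ := fun _ : Fin 9 => ℝ) i
  ContinuousLinearMap.pi
    ![d 0, d 1 + (k * cos (p 5)) • d 5, d 2 + (k * cos (p 5)) • d 6 - (k * p 6 * sin (p 5)) • d 5,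
      d 3 + (k * sin (p 5)) • d 5 - (g * p 0) • d 0,
      d 4 + (k * sin (p 5)) • d 6 + (k * p 6 * cos (p 5)) • d 5 - g • d 0,
      d 5, d 6, d 7 + (2 * k * p 6) • d 6, lam⁻¹ • d 8]

variable (k g lam : ℝ)

theorem toFlat_apply (p v : PVTOLSpace) : toFlat k g lam p v =
    ![v 0, v 1 - k * cos (p 5) * v 5, v 2 - k * cos (p 5) * v 6 + k * p 6 * sin (p 5) * v 5,
      v 3 - k * sin (p 5) * v 5 + g * p 0 * v 0,
      v 4 - k * sin (p 5) * v 6 - k * p 6 * cos (p 5) * v 5 + g * v 0,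
      v 5, v 6, v 7 - 2 * k * p 6 * v 6, lam * v 8] := by
  funext j
  fin_cases j <;> simp [toFlat]

theorem ofFlat_apply (p v : PVTOLSpace) : ofFlat k g lam p v =
    ![v 0, v 1 + k * cos (p 5) * v 5, v 2 + k * cos (p 5) * v 6 - k * p 6 * sin (p 5) * v 5,
      v 3 + k * sin (p 5) * v 5 - g * p 0 * v 0,
      v 4 + k * sin (p 5) * v 6 + k * p 6 * cos (p 5) * v 5 - g * v 0,
      v 5, v 6, v 7 + 2 * k * p 6 * v 6, lam⁻¹ * v 8] := by
  funext j
  fin_cases j <;> simp [ofFlat]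

variable {lam}

theorem toFlat_ofFlat (hlam : lam ≠ 0) (p v : PVTOLSpace) :
    toFlat k g lam p (ofFlat k g lam p v) = v := by
  rw [toFlat_apply, ofFlat_apply]
  funext j
  fin_cases j <;> simp [hlam] <;> ring

theorem ofFlat_toFlat (hlam : lam ≠ 0) (p v : PVTOLSpace) :
    ofFlat k g lam p (toFlat k g lam p v) = v := by
  rw [ofFlat_apply, toFlat_apply]
  funext j
  fin_cases j <;> simp [hlam] <;> ring

variable (lam)

theorem contDiff_flatCoord : ContDiff ℝ ∞ (flatCoord k g lam) := by
  rw [contDiff_pi]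
  intro j
  fin_cases j <;> simp [flatCoord] <;> fun_prop

theorem contDiff_ofFlat {a : PVTOLSpace → PVTOLSpace} (ha : ContDiff ℝ ∞ a) :
    ContDiff ℝ ∞ fun p => ofFlat k g lam p (a p) := by
  simp only [ofFlat_apply]
  rw [contDiff_pi]
  rw [contDiff_pi] at ha
  have h := fun i => ha i
  intro j
  fin_cases j <;> simp <;> fun_prop

theorem hasFDerivAt_flatCoord (p : PVTOLSpace) :
    HasFDerivAt (flatCoord k g lam) (toFlat k g lam p) p := by
  rw [hasFDerivAt_pi']
  have h := fun i => hasFDerivAt_apply (𝕜 := ℝ) (F' := fun _ : Fin 9 => ℝ) i p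
  intro j
  fin_cases j
  · exact (h 0).congr_fderiv (by ext v; simp [toFlat])
  · exact ((h 1).sub ((h 5).sin.const_mul k)).congr_fderiv (by
      ext v; simp [toFlat]; ring)
  · exact ((h 2).sub (((h 6).const_mul k).mul (h 5).cos)).congr_fderiv (by
      ext v; simp [toFlat]; ring)
  · exact (((h 3).add ((h 5).cos.const_mul k)).add (((h 0).pow 2).const_mul (g / 2))).congr_fderiv
      (by ext v; simp [toFlat]; ring)
  · exact (((h 4).sub (((h 6).const_mul k).mul (h 5).sin)).add ((h 0).const_mul g)).congr_fderiv
      (by ext v; simp [toFlat]; ring)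
  · exact (h 5).congr_fderiv (by ext v; simp [toFlat])
  · exact (h 6).congr_fderiv (by ext v; simp [toFlat])
  · exact ((h 7).sub (((h 6).pow 2).const_mul k)).congr_fderiv (by
      ext v; simp [toFlat]; ring)
  · exact ((h 8).const_mul lam).congr_fderiv (by ext v; simp [toFlat])

/-- The distribution in flat coordinates. -/
theorem mem_pvtolDistribution_iff {h : ℝ} {lam : ℝ} (hlam : lam ≠ 0) (p v : PVTOLSpace) :
    v ∈ pvtolDistribution h g lam p ↔
      ∃ a b c : ℝ, toFlat (h / lam) g lam p v = 
        let y := flatCoord (h / lam) g lam p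
        ![a, a * y 2, -(a * (y 7 * sin (y 5))), a * y 4, a * (y 7 * cos (y 5)), a * y 6, a * y 8,
          b, c] := by
  have hk : h / lam * lam = h := div_mul_cancel₀ h hlam
  rw [pvtolDistribution, Submodule.mem_span_triple]
  constructor
  · rintro ⟨a, b, c, rfl⟩
    -- The flat thrust is `u₁ - k θ₁²`, so the drift changes it at the rate `-2 k θ₁ θ''`; likewise
    -- `w = lam u₂` rescales the last coefficient.
    refine ⟨a, b - 2 * (h / lam) * p 6 * (a * (lam * p 8)), lam * c, ?_⟩
    rw [toFlat_apply]
    funext j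
    fin_cases j <;> simp [pvtolDrift, flatCoord]
    · ring
    · linear_combination -(a * p 8 * cos (p 5)) * hk
    · ring
    · linear_combination -(a * p 8 * sin (p 5)) * hk
  · rintro ⟨a, b, c, hv⟩
    refine ⟨a, v 7, v 8, ?_⟩
    rw [← ofFlat_toFlat (h / lam) g hlam p v, hv, ofFlat_apply]
    funext j
    fin_cases j <;> simp [pvtolDrift, flatCoord]
    · ring
    · linear_combination -(a * p 8 * cos (p 5)) * hk
    · ring
    · linear_combination -(a * p 8 * sin (p 5)) * hk

/-- The flat components, at the point with flat coordinates `y`, of the infinitesimal symmetry with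
parameters `ξ`. -/
def affineFieldAt (ξ : Fin 9 → ℝ) (y : PVTOLSpace) : PVTOLSpace :=
  ![ξ 8,
    ξ 0 * y 1 + ξ 1 * y 3 + ξ 4 * y 0 + ξ 6,
    ξ 0 * y 2 + ξ 1 * y 4 + ξ 4,
    ξ 2 * y 1 + ξ 3 * y 3 + ξ 5 * y 0 + ξ 7,
    ξ 2 * y 2 + ξ 3 * y 4 + ξ 5,
    (ξ 0 - ξ 3) * sin (y 5) * cos (y 5) - ξ 1 * cos (y 5) ^ 2 + ξ 2 * sin (y 5) ^ 2,
    ((ξ 0 - ξ 3) * (cos (y 5) ^ 2 - sin (y 5) ^ 2)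
      + 2 * (ξ 1 + ξ 2) * sin (y 5) * cos (y 5)) * y 6,
    (ξ 0 * sin (y 5) ^ 2 - (ξ 1 + ξ 2) * sin (y 5) * cos (y 5) + ξ 3 * cos (y 5) ^ 2) * y 7,
    (2 * (ξ 1 + ξ 2) * (cos (y 5) ^ 2 - sin (y 5) ^ 2)
      - 4 * (ξ 0 - ξ 3) * sin (y 5) * cos (y 5)) * y 6 ^ 2
      + ((ξ 0 - ξ 3) * (cos (y 5) ^ 2 - sin (y 5) ^ 2)
      + 2 * (ξ 1 + ξ 2) * sin (y 5) * cos (y 5)) * y 8]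

theorem contDiff_affineFieldAt (ξ : Fin 9 → ℝ) :
    ContDiff ℝ ∞ (affineFieldAt ξ) := by
  rw [contDiff_pi]
  intro j
  fin_cases j <;> simp [affineFieldAt] <;> fun_prop

/-- The parameters of the symmetry `∑ uᵢ Xᵢ + u₉ ∂_t`. -/
def affineParam : (Fin 9 → ℝ) ≃ₗ[ℝ] (Fin 9 → ℝ) where
  -- The term `g * u 8` arises because `∂_t` moves the flat output `Z`, which contains `g t² / 2`,
  -- at the rate `g t`.
  toFun u := ![u 3, u 2, u 0 - u 2, u 3 - u 1, u 4, u 6 + g * u 8, u 5, u 7, u 8]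
  map_add' u v := by
    funext j
    fin_cases j <;> simp <;> ring
  map_smul' c u := by
    funext j
    fin_cases j <;> simp <;> ring
  invFun ξ := ![ξ 2 + ξ 1, ξ 0 - ξ 3, ξ 1, ξ 0, ξ 4, ξ 6, ξ 5 - g * ξ 8, ξ 7, ξ 8]
  left_inv u := by
    funext j
    fin_cases j <;> simp
  right_inv u := by
    funext j
    fin_cases j <;> simp

theorem sum_pvtolFieldExt {h : ℝ} {lam : ℝ} (hlam : lam ≠ 0) (u : Fin 9 → ℝ) (p : PVTOLSpace) :
    ∑ i, u i • pvtolFieldExt h g lam i p = ofFlat (h / lam) g lam p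
      (affineFieldAt (affineParam g u) (flatCoord (h / lam) g lam p)) := by
  have hsq := sin_sq_add_cos_sq (p 5)
  have hsin := sin_two_mul (p 5)
  have hcos : cos (2 * p 5) = cos (p 5) ^ 2 - sin (p 5) ^ 2 := by
    rw [cos_two_mul]
    linear_combination hsq
  rw [ofFlat_apply, Fin.sum_univ_castSucc]
  simp only [pvtolFieldExt, Fin.snoc_castSucc, Fin.snoc_last, pvtolField]
  generalize h / lam = k
  rw [pvtolFieldsAt, pvtolDt, hsin, hcos, affineFieldAt, flatCoord]
  simp only [Matrix.cons_val]
  generalize sin (p 5) = s at hsq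
  generalize cos (p 5) = c at hsq
  funext j
  fin_cases j <;> simp [Fin.sum_univ_succ, affineParam]
  · linear_combination (u 2 * k * c) * hsq
  · linear_combination (u 0 * k * p 6 * s + 2 * u 1 * k * p 6 * c - u 2 * k * p 6 * s) * hsq
  · linear_combination (u 2 * k * s - u 0 * k * s - u 1 * k * c) * hsq
  · linear_combination (u 1 * k * p 6 * s - 3 * u 0 * k * p 6 * c + u 2 * k * p 6 * c) * hsq
  · linear_combination u 2 * hsq
  · ring
  · linear_combination (2 * u 1 * k * p 6 ^ 2 - u 3 * (p 7 - k * p 6 ^ 2)) * hsq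
  · field_simp
    ring

theorem pvtolFieldExt_eq {h : ℝ} {lam : ℝ} (hlam : lam ≠ 0) (i : Fin 9) (p : PVTOLSpace) :
    pvtolFieldExt h g lam i p = ofFlat (h / lam) g lam p
      (affineFieldAt (affineParam g (Pi.single i 1)) (flatCoord (h / lam) g lam p)) := by
  rw [← sum_pvtolFieldExt g hlam, Finset.sum_eq_single i]
  · simp
  · intro j _ hj
    simp [hj]
  · simp

end FlatCoordinates

end

noncomputable section

/-! ### Symmetries of the PVTOL distribution -/

section Symmetries

open Real SmoothVF

variable {h k g lam : ℝ} {Ω : TopologicalSpace.Opens PVTOLSpace}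

/-- The vector field on `Ω` with flat components `a`. -/
def flatVF (Ω : TopologicalSpace.Opens PVTOLSpace) (k g lam : ℝ) (a : PVTOLSpace → PVTOLSpace)
    (ha : ContDiff ℝ ∞ a) : SmoothVF Ω :=
  SmoothVF.restrict (fun p => ofFlat k g lam p (a p)) (contDiff_ofFlat k g lam ha).contDiffOn

theorem flatVF_apply {a : PVTOLSpace → PVTOLSpace} (ha : ContDiff ℝ ∞ a) {p : PVTOLSpace}
    (hp : p ∈ Ω) : (flatVF Ω k g lam a ha).1 p = ofFlat k g lam p (a p) :=
  SmoothVF.restrict_apply _ _ hp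

/-- The flat coordinates as smooth functions on `Ω`. -/
def flatFun (Ω : TopologicalSpace.Opens PVTOLSpace) (k g lam : ℝ) (j : Fin 9) : SmoothFun Ω :=
  SmoothFun.restrict (fun p => flatCoord k g lam p j)
    (contDiff_pi.1 (contDiff_flatCoord k g lam) j).contDiffOn

theorem toDerivation_flatFun (X : SmoothVF Ω) (j : Fin 9) (p : Ω) :
    (toDerivation X (flatFun Ω k g lam j)).1 p = toFlat k g lam p (X.1 p) j :=
  toDerivation_apply_of_hasFDerivAt X (fun _ => rfl) p
    (hasFDerivAt_pi'.1 (hasFDerivAt_flatCoord k g lam p.1) j)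

/-- The flat components of a vector field. -/
def flatComp (k g lam : ℝ) (X : SmoothVF Ω) (j : Fin 9) : SmoothFun Ω :=
  toDerivation X (flatFun Ω k g lam j)

theorem flatComp_apply (X : SmoothVF Ω) (j : Fin 9) (p : Ω) :
    (flatComp k g lam X j).1 p = toFlat k g lam p (X.1 p) j := toDerivation_flatFun X j p

theorem flatComp_flatVF (hlam : lam ≠ 0) {a : PVTOLSpace → PVTOLSpace} (ha : ContDiff ℝ ∞ a)
    (j : Fin 9) (p : Ω) : (flatComp k g lam (flatVF Ω k g lam a ha) j).1 p = a p j := by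
  rw [flatComp_apply, flatVF_apply ha p.2, toFlat_ofFlat k g hlam]

/-- The coordinate fields of the flat coordinates. -/
def flatPartial (Ω : TopologicalSpace.Opens PVTOLSpace) (k g lam : ℝ) (i : Fin 9) : SmoothVF Ω :=
  flatVF Ω k g lam (fun _ => Pi.single i 1) contDiff_const

theorem toDerivation_eq_sum (hlam : lam ≠ 0) (X : SmoothVF Ω) (f : SmoothFun Ω) :
    toDerivation X f = ∑ i, flatComp k g lam X i * toDerivation (flatPartial Ω k g lam i) f := by
  ext p
  have hsum : (∑ i, flatComp k g lam X i * toDerivation (flatPartial Ω k g lam i) f).1 p =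
      ∑ i, (flatComp k g lam X i).1 p * (toDerivation (flatPartial Ω k g lam i) f).1 p := by
    rw [AddSubmonoidClass.coe_finsetSum, Finset.sum_apply]
    rfl
  rw [hsum, toDerivation_apply, ← ofFlat_toFlat k g hlam p (X.1 p)]
  have hlin := ((fderiv ℝ (SmoothFun.ext f) p).comp (ofFlat k g lam p)).toLinearMap.pi_apply_eq_sum_univ
    (toFlat k g lam p (X.1 p))
  refine hlin.trans (Finset.sum_congr rfl fun i _ => ?_)
  rw [flatComp_apply, toDerivation_apply, flatPartial, flatVF_apply _ p.2, smul_eq_mul]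
  have he : (Pi.single i 1 : PVTOLSpace) = fun j => if i = j then 1 else 0 := by
    funext j
    simp only [Pi.single_apply, eq_comm]
  rw [he]
  rfl

theorem ext_of_flatComp_eq (hlam : lam ≠ 0) {X Y : SmoothVF Ω}
    (hXY : ∀ i, flatComp k g lam X i = flatComp k g lam Y i) : X = Y :=
  ext_of_toDerivation_eq fun f => by
    rw [toDerivation_eq_sum hlam X f, toDerivation_eq_sum hlam Y f]
    exact Finset.sum_congr rfl fun i _ => by rw [hXY]

theorem flatComp_flatPartial (hlam : lam ≠ 0) (i j : Fin 9) :
    flatComp k g lam (flatPartial Ω k g lam i) j = if i = j then 1 else 0 := by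
  ext p
  rw [flatPartial, flatComp_flatVF hlam, Pi.single_apply]
  by_cases hij : i = j
  · simp [hij]
  · simp [hij, Ne.symm hij]

/-- The algebra of smooth functions on `Ω` with its flat coordinates. -/
def flatFrame (Ω : TopologicalSpace.Opens PVTOLSpace) (k g : ℝ) {lam : ℝ} (hlam : lam ≠ 0) :
    ThrustFrame (SmoothFun Ω) where
  d i := toDerivation (flatPartial Ω k g lam i)
  y := flatFun Ω k g lam
  s := SmoothFun.restrict (fun p => sin (p 5)) (by fun_prop)
  c := SmoothFun.restrict (fun p => cos (p 5)) (by fun_prop)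
  d_comm i j f := by
    rw [← sub_eq_zero, ← toDerivation_lie, toDerivation_eq_sum (k := k) (g := g) hlam]
    refine Finset.sum_eq_zero fun l _ => ?_
    have hl : flatComp k g lam ⁅flatPartial Ω k g lam i, flatPartial Ω k g lam j⁆ l = 0 := by
      rw [flatComp, toDerivation_lie]
      have h1 := flatComp_flatPartial (Ω := Ω) (k := k) (g := g) hlam i l
      have h2 := flatComp_flatPartial (Ω := Ω) (k := k) (g := g) hlam j l
      rw [flatComp] at h1 h2
      rw [h1, h2]
      split_ifs <;> simp
    rw [hl, zero_mul]
  d_y i j := flatComp_flatPartial hlam i j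
  d_s i := by
    ext p
    rw [toDerivation_apply_of_hasFDerivAt _ (fun _ => rfl) p
      (hasFDerivAt_apply (𝕜 := ℝ) (5 : Fin 9) p.1).sin, flatPartial, flatVF_apply _ p.2,
      ofFlat_apply]
    by_cases hi : i = 5
    · simp [hi]
    · simp [hi, Ne.symm hi]
  d_c i := by
    ext p
    rw [toDerivation_apply_of_hasFDerivAt _ (fun _ => rfl) p
      (hasFDerivAt_apply (𝕜 := ℝ) (5 : Fin 9) p.1).cos, flatPartial, flatVF_apply _ p.2,
      ofFlat_apply]
    by_cases hi : i = 5
    · simp [hi]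
    · simp [hi, Ne.symm hi]
  sq_add_sq := by
    ext p
    have := sin_sq_add_cos_sq (p.1 5)
    simp only [SmoothFun.add_apply, SmoothFun.mul_apply, SmoothFun.restrict_apply,
      SmoothFun.one_apply]
    linear_combination this

theorem flatFrame_d (hlam : lam ≠ 0) (i : Fin 9) :
    (flatFrame Ω k g hlam).d i = toDerivation (flatPartial Ω k g lam i) := rfl

theorem flatFrame_s_apply (hlam : lam ≠ 0) (p : Ω) :
    (flatFrame Ω k g hlam).s.1 p = sin (p.1 5) := rfl

theorem flatFrame_c_apply (hlam : lam ≠ 0) (p : Ω) :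
    (flatFrame Ω k g hlam).c.1 p = cos (p.1 5) := rfl

theorem flatFrame_y_apply (hlam : lam ≠ 0) (j : Fin 9) (p : Ω) :
    ((flatFrame Ω k g hlam).y j).1 p = flatCoord k g lam p j := rfl

/-- The sections of the distribution in flat coordinates. -/
theorem isSectionOf_pvtolDistribution_iff (hlam : lam ≠ 0) (Y : SmoothVF Ω) :
    IsSectionOf (pvtolDistribution h g lam) Y ↔
      (flatFrame Ω (h / lam) g hlam).IsSection (flatComp (h / lam) g lam Y) := by
  set F := flatFrame Ω (h / lam) g hlam with hF
  set a := flatComp (h / lam) g lam Y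
  have hy5 : ∀ p, flatCoord (h / lam) g lam p 5 = p 5 := fun _ => rfl
  have ha : ∀ j (p : Ω), (a j).1 p = toFlat (h / lam) g lam p (Y.1 p) j := fun j p =>
    flatComp_apply Y j p
  constructor
  · intro hY
    have key := fun p : Ω => (mem_pvtolDistribution_iff g hlam p.1 (Y.1 p)).1 (hY p.1 p.2)
    refine ⟨?_, ?_, ?_, ?_, ?_, ?_⟩ <;>
    · ext p
      obtain ⟨b, c, d, hv⟩ := key p
      simp [ha, hF, flatFrame_s_apply, flatFrame_c_apply, flatFrame_y_apply, hv, hy5]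
  · rintro ⟨h1, h2, h3, h4, h5, h6⟩ p hp
    rw [mem_pvtolDistribution_iff g hlam]
    have e1 := congrArg (fun f : SmoothFun Ω => f.1 ⟨p, hp⟩) h1
    have e2 := congrArg (fun f : SmoothFun Ω => f.1 ⟨p, hp⟩) h2
    have e3 := congrArg (fun f : SmoothFun Ω => f.1 ⟨p, hp⟩) h3
    have e4 := congrArg (fun f : SmoothFun Ω => f.1 ⟨p, hp⟩) h4
    have e5 := congrArg (fun f : SmoothFun Ω => f.1 ⟨p, hp⟩) h5
    have e6 := congrArg (fun f : SmoothFun Ω => f.1 ⟨p, hp⟩) h6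
    simp only [SmoothFun.mul_apply, SmoothFun.neg_apply, ha, hF, flatFrame_s_apply,
      flatFrame_c_apply, flatFrame_y_apply] at e1 e2 e3 e4 e5 e6
    refine ⟨toFlat (h / lam) g lam p (Y.1 p) 0, toFlat (h / lam) g lam p (Y.1 p) 7,
      toFlat (h / lam) g lam p (Y.1 p) 8, ?_⟩
    funext j
    fin_cases j
    · rfl
    · exact e1
    · exact e2
    · exact e3
    · exact e4
    · exact e5
    · exact e6
    · rfl
    · rfl

/-- The drift field in flat coordinates. -/
def flatDrift (Ω : TopologicalSpace.Opens PVTOLSpace) (k g lam : ℝ) : SmoothVF Ω :=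
  flatVF Ω k g lam (fun p =>
    let y := flatCoord k g lam p
    ![1, y 2, -(y 7 * sin (p 5)), y 4, y 7 * cos (p 5), y 6, y 8, 0, 0]) (by
    have hy := fun j => contDiff_pi.1 (contDiff_flatCoord k g lam) j
    rw [contDiff_pi]
    intro j
    fin_cases j <;> simp <;> fun_prop)

theorem toDerivation_flatDrift (hlam : lam ≠ 0) (f : SmoothFun Ω) :
    toDerivation (flatDrift Ω k g lam) f = (flatFrame Ω k g hlam).T f := by
  have e : ∀ j, flatComp k g lam (flatDrift Ω k g lam) j =
      let F := flatFrame Ω k g hlam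
      (![1, F.y 2, -(F.y 7 * F.s), F.y 4, F.y 7 * F.c, F.y 6, F.y 8, 0, 0] :
        Fin 9 → SmoothFun Ω) j := by
    intro j
    ext p
    rw [flatDrift, flatComp_flatVF hlam]
    fin_cases j <;> rfl
  rw [toDerivation_eq_sum (k := k) (g := g) hlam]
  simp only [e, Fin.sum_univ_succ]
  simp [ThrustFrame.T, flatFrame_d]
  ring

theorem isSectionOf_flatDrift (hlam : lam ≠ 0) :
    IsSectionOf (pvtolDistribution h g lam) (flatDrift Ω (h / lam) g lam) := by
  rw [isSectionOf_pvtolDistribution_iff hlam]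
  refine ⟨?_, ?_, ?_, ?_, ?_, ?_⟩ <;>
  · ext p
    simp only [SmoothFun.mul_apply, SmoothFun.neg_apply, flatDrift, flatComp_flatVF hlam,
      flatFrame_y_apply, flatFrame_s_apply, flatFrame_c_apply]
    simp

theorem isSectionOf_flatPartial (hlam : lam ≠ 0) {i : Fin 9} (hi : 7 ≤ i) :
    IsSectionOf (pvtolDistribution h g lam) (flatPartial Ω (h / lam) g lam i) := by
  rw [isSectionOf_pvtolDistribution_iff hlam]
  simp only [ThrustFrame.IsSection, flatComp_flatPartial hlam]
  fin_cases i <;> simp at hi <;> simp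

end Symmetries

end

noncomputable section

/-! ### Determining equations and classification on an open set -/

section SymmetryAlgebra

open Real SmoothVF

variable {h k g lam : ℝ} {Ω : TopologicalSpace.Opens PVTOLSpace}

theorem flatComp_lie (X Y : SmoothVF Ω) (j : Fin 9) : flatComp k g lam ⁅X, Y⁆ j =
    toDerivation X (flatComp k g lam Y j) - toDerivation Y (flatComp k g lam X j) :=
  toDerivation_lie X Y _

theorem flatComp_add (X Y : SmoothVF Ω) (j : Fin 9) :
    flatComp k g lam (X + Y) j = flatComp k g lam X j + flatComp k g lam Y j :=
  toDerivation_add X Y _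

theorem flatComp_smul (c : ℝ) (X : SmoothVF Ω) (j : Fin 9) :
    flatComp k g lam (c • X) j = c • flatComp k g lam X j :=
  toDerivation_smul c X _

theorem toDerivation_s (hlam : lam ≠ 0) (X : SmoothVF Ω) :
    toDerivation X (flatFrame Ω k g hlam).s =
      flatComp k g lam X 5 * (flatFrame Ω k g hlam).c := by
  rw [toDerivation_eq_sum (k := k) (g := g) hlam]
  simp only [← flatFrame_d hlam, ThrustFrame.d_s]
  simp

theorem toDerivation_c (hlam : lam ≠ 0) (X : SmoothVF Ω) :
    toDerivation X (flatFrame Ω k g hlam).c =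
      -(flatComp k g lam X 5 * (flatFrame Ω k g hlam).s) := by
  rw [toDerivation_eq_sum (k := k) (g := g) hlam]
  simp only [← flatFrame_d hlam, ThrustFrame.d_c]
  simp
  ring

theorem toDerivation_y (hlam : lam ≠ 0) (X : SmoothVF Ω) (j : Fin 9) :
    toDerivation X ((flatFrame Ω k g hlam).y j) = flatComp k g lam X j := rfl

/-- A section of the distribution as a combination of the drift, `∂_v` and `∂_w`. -/
theorem toDerivation_of_isSection (hlam : lam ≠ 0) {Y : SmoothVF Ω}
    (hY : (flatFrame Ω k g hlam).IsSection (flatComp k g lam Y)) (f : SmoothFun Ω) :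
    toDerivation Y f = flatComp k g lam Y 0 * (flatFrame Ω k g hlam).T f
      + flatComp k g lam Y 7 * (flatFrame Ω k g hlam).d 7 f
      + flatComp k g lam Y 8 * (flatFrame Ω k g hlam).d 8 f := by
  obtain ⟨h1, h2, h3, h4, h5, h6⟩ := hY
  rw [toDerivation_eq_sum (k := k) (g := g) hlam]
  simp [Fin.sum_univ_succ, ThrustFrame.T, ← flatFrame_d hlam, h1, h2, h3, h4, h5, h6]
  ring

/-- Infinitesimal symmetries that leave `dt` invariant, in flat coordinates. -/
theorem mem_infinitesimalSymmetries_iff (hlam : lam ≠ 0) {X : SmoothVF Ω} {σ : ℝ}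
    (hX : flatComp (h / lam) g lam X 0 = algebraMap ℝ _ σ) :
    X ∈ infinitesimalSymmetries Ω (pvtolDistribution h g lam) ↔
      (flatFrame Ω (h / lam) g hlam).IsSymm (flatComp (h / lam) g lam X) := by
  have hd0 : ∀ (Y : SmoothVF Ω), toDerivation Y (flatComp (h / lam) g lam X 0) = 0 := fun Y => by
    rw [hX, Derivation.map_algebraMap]
  constructor
  · intro hsymm
    -- The test fields are `∂_v`, `∂_w` and the drift. The flat components of `∂_v` and `∂_w` are
    -- constant, so their brackets with `X` only involve derivatives of the components of `X`.
    have hp : ∀ i : Fin 9, 7 ≤ i → (flatFrame Ω (h / lam) g hlam).IsSection fun j =>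
        -(flatFrame Ω (h / lam) g hlam).d i (flatComp (h / lam) g lam X j) := by
      intro i hi
      convert (isSectionOf_pvtolDistribution_iff hlam _).1
        (hsymm _ (isSectionOf_flatPartial hlam hi)) using 1
      funext l
      rw [flatComp_lie, flatComp_flatPartial hlam, flatFrame_d]
      split_ifs <;> simp
    refine ThrustFrame.isSymm_of_isSection (toDerivation_y hlam X) (toDerivation_s hlam X)
      (toDerivation_c hlam X) (fun i => hd0 _) (hp 7 (by decide)) (hp 8 (by decide)) ?_
    convert (isSectionOf_pvtolDistribution_iff hlam _).1
      (hsymm _ (isSectionOf_flatDrift hlam)) using 1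
    funext l
    rw [flatComp_lie, toDerivation_flatDrift hlam, ← toDerivation_flatDrift hlam]
    rfl
  · intro hsymm Y hY
    rw [isSectionOf_pvtolDistribution_iff hlam] at hY ⊢
    convert hsymm.isSection_lie hY (toDerivation_y hlam X) (toDerivation_s hlam X)
      (toDerivation_c hlam X) (hd0 Y) (toDerivation_of_isSection hlam hY) using 1
    funext l
    rw [flatComp_lie]

/-- The infinitesimal symmetry with parameters `ξ`. -/
def affineVF (Ω : TopologicalSpace.Opens PVTOLSpace) (k g lam : ℝ) (ξ : Fin 9 → ℝ) : SmoothVF Ω :=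
  flatVF Ω k g lam (fun p => affineFieldAt ξ (flatCoord k g lam p))
    ((contDiff_affineFieldAt ξ).comp (contDiff_flatCoord k g lam))

theorem affineVF_apply (ξ : Fin 9 → ℝ) {p : PVTOLSpace} (hp : p ∈ Ω) :
    (affineVF Ω k g lam ξ).1 p =
      ofFlat k g lam p (affineFieldAt ξ (flatCoord k g lam p)) :=
  flatVF_apply _ hp

theorem flatComp_affineVF (hlam : lam ≠ 0) (ξ : Fin 9 → ℝ) :
    flatComp k g lam (affineVF Ω k g lam ξ) = (flatFrame Ω k g hlam).affineSymm ξ := by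
  funext j
  ext p
  rw [affineVF, flatComp_flatVF hlam]
  fin_cases j <;> rfl

/-- The affine symmetries as a linear map. -/
def affineMap (Ω : TopologicalSpace.Opens PVTOLSpace) (k g : ℝ) {lam : ℝ} (hlam : lam ≠ 0) :
    (Fin 9 → ℝ) →ₗ[ℝ] SmoothVF Ω where
  toFun := affineVF Ω k g lam
  map_add' ξ η := ext_of_flatComp_eq (k := k) (g := g) hlam fun j => by
    rw [flatComp_add, flatComp_affineVF hlam, flatComp_affineVF hlam, flatComp_affineVF hlam,
      ThrustFrame.affineSymm_add, Pi.add_apply]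
  map_smul' c ξ := ext_of_flatComp_eq (k := k) (g := g) hlam fun j => by
    rw [RingHom.id_apply, flatComp_smul, flatComp_affineVF hlam, flatComp_affineVF hlam,
      ThrustFrame.affineSymm_smul, Pi.smul_apply]

theorem affineMap_apply (hlam : lam ≠ 0) (ξ : Fin 9 → ℝ) :
    affineMap Ω k g hlam ξ = affineVF Ω k g lam ξ := rfl

theorem affineMap_injective (hlam : lam ≠ 0) [Nonempty Ω] :
    Function.Injective (affineMap Ω k g hlam) := by
  rw [injective_iff_map_eq_zero]
  intro ξ hξ
  refine ThrustFrame.affineSymm_eq_zero (F := flatFrame Ω k g hlam)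
    SmoothFun.algebraMap_injective (funext fun j => ?_)
  rw [← flatComp_affineVF hlam, ← affineMap_apply hlam, hξ]
  ext p
  rw [flatComp_apply]
  exact congrFun (map_zero (toFlat k g lam p)) j

/-- On a connected open set, every symmetry that leaves `dt` invariant is affine. -/
theorem exists_affineVF_eq (hlam : lam ≠ 0) (hΩ : IsConnected (Ω : Set PVTOLSpace))
    {X : SmoothVF Ω} {σ : ℝ} (hσ : flatComp k g lam X 0 = algebraMap ℝ _ σ)
    (hX : (flatFrame Ω k g hlam).IsSymm (flatComp k g lam X)) :
    ∃ ξ, X = affineVF Ω k g lam ξ := by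
  obtain ⟨ξ, hξ⟩ := hX.exists_eq_affineSymm (fun f hf =>
    SmoothFun.eq_algebraMap_of_toDerivation_eq_zero hΩ fun Y => by
      rw [toDerivation_eq_sum (k := k) (g := g) hlam]
      exact Finset.sum_eq_zero fun i _ => by rw [← flatFrame_d hlam, hf, mul_zero]) hσ
  exact ⟨ξ, ext_of_flatComp_eq hlam fun j => by rw [flatComp_affineVF hlam, hξ]⟩

end SymmetryAlgebra

end

noncomputable section

/-! ### The symmetry algebras in affine parameters -/

section LieAlgebras

open Real SmoothVF LieAlgebra.SpecialLinear ThrustFrame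

variable {h k g lam : ℝ} {Ω : TopologicalSpace.Opens PVTOLSpace}

/-- The Lie algebra of the infinitesimal symmetries `X` of the PVTOL distribution with `X(t)`
constant. -/
def extendedSymmetries (Ω : TopologicalSpace.Opens PVTOLSpace) (h g lam : ℝ) :
    LieSubalgebra ℝ (SmoothVF Ω) where
  carrier := {X | X ∈ infinitesimalSymmetries Ω (pvtolDistribution h g lam) ∧
    ∃ σ : ℝ, flatComp (h / lam) g lam X 0 = algebraMap ℝ _ σ}
  add_mem' := by
    rintro X Y ⟨hX, σ, hσ⟩ ⟨hY, τ, hτ⟩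
    exact ⟨add_mem hX hY, σ + τ, by rw [flatComp_add, hσ, hτ, map_add]⟩
  zero_mem' := ⟨zero_mem _, 0, by
    ext p
    rw [flatComp_apply]
    exact congrFun (map_zero (toFlat (h / lam) g lam p.1)) 0⟩
  smul_mem' := by
    rintro c X ⟨hX, σ, hσ⟩
    exact ⟨(infinitesimalSymmetries Ω _).smul_mem c hX, c * σ, by
      rw [flatComp_smul, hσ, map_mul, Algebra.smul_def]⟩
  lie_mem' := by
    rintro X Y ⟨hX, σ, hσ⟩ ⟨hY, τ, hτ⟩
    exact ⟨LieSubalgebra.lie_mem _ hX hY, 0, by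
      rw [flatComp_lie, hσ, hτ, Derivation.map_algebraMap, Derivation.map_algebraMap, sub_zero,
        map_zero]⟩

theorem flatComp_affineVF_zero (hlam : lam ≠ 0) (ξ : Fin 9 → ℝ) :
    flatComp k g lam (affineVF Ω k g lam ξ) 0 = algebraMap ℝ _ (ξ 8) := by
  rw [flatComp_affineVF hlam]
  rfl

theorem affineVF_mem_extendedSymmetries (hlam : lam ≠ 0) (ξ : Fin 9 → ℝ) :
    affineVF Ω (h / lam) g lam ξ ∈ extendedSymmetries Ω h g lam := by
  refine ⟨(mem_infinitesimalSymmetries_iff hlam (flatComp_affineVF_zero hlam ξ)).2 ?_, ξ 8,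
    flatComp_affineVF_zero hlam ξ⟩
  rw [flatComp_affineVF hlam]
  exact isSymm_affineSymm ξ

theorem exists_affineVF_of_mem (hlam : lam ≠ 0) (hΩ : IsConnected (Ω : Set PVTOLSpace))
    {X : SmoothVF Ω} (hX : X ∈ extendedSymmetries Ω h g lam) :
    ∃ ξ, X = affineVF Ω (h / lam) g lam ξ := by
  obtain ⟨hX, σ, hσ⟩ := hX
  exact exists_affineVF_eq hlam hΩ hσ ((mem_infinitesimalSymmetries_iff hlam hσ).1 hX)

/-- The bracket is a symmetry, hence affine by the classification, which is where connectedness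
enters. By `IsSymm.eq_zero` it suffices to compare time and position components, where
`affineSymm_lie` computes it. -/
theorem affineVF_lie (hlam : lam ≠ 0) (hΩ : IsConnected (Ω : Set PVTOLSpace)) (ξ η : Fin 9 → ℝ) :
    ⁅affineVF Ω k g lam ξ, affineVF Ω k g lam η⁆ =
      affineVF Ω k g lam (affineBracket ξ η) := by
  -- Every `k` has the form `h / lam`, as the classification requires.
  have hk : k * lam / lam = k := mul_div_cancel_right₀ k hlam
  have hmem := fun ζ => affineVF_mem_extendedSymmetries (h := k * lam) (g := g) (Ω := Ω) hlam ζ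
  obtain ⟨ζ, hζ⟩ := exists_affineVF_of_mem hlam hΩ
    (LieSubalgebra.lie_mem _ (hmem ξ) (hmem η))
  rw [hk] at hζ
  have hF : ∀ j : Fin 9, j = 0 ∨ j = 1 ∨ j = 3 →
      (flatFrame Ω k g hlam).affineSymm ζ j =
        (flatFrame Ω k g hlam).affineSymm (affineBracket ξ η) j := by
    intro j hj
    rw [← flatComp_affineVF hlam, ← hζ, flatComp_lie, flatComp_affineVF hlam,
      flatComp_affineVF hlam]
    refine affineSymm_lie (fun j => ?_) (fun j => ?_) j hj
    · rw [toDerivation_y, flatComp_affineVF hlam]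
    · rw [toDerivation_y, flatComp_affineVF hlam]
  have h0 := (((flatFrame Ω k g hlam).isSymm_affineSymm ζ).sub
    ((flatFrame Ω k g hlam).isSymm_affineSymm (affineBracket ξ η))).eq_zero
    (sub_eq_zero.2 (hF 0 (by decide))) (sub_eq_zero.2 (hF 1 (by decide)))
    (sub_eq_zero.2 (hF 3 (by decide)))
  rw [hζ]
  refine ext_of_flatComp_eq (k := k) (g := g) hlam fun j => ?_
  rw [flatComp_affineVF hlam, flatComp_affineVF hlam]
  exact sub_eq_zero.1 (congrFun h0 j)

/-- The parameters of the extended symmetries. -/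
def extendedEquiv (hlam : lam ≠ 0) (hΩ : IsConnected (Ω : Set PVTOLSpace)) (h g : ℝ) :
    (Fin 9 → ℝ) ≃ₗ[ℝ] extendedSymmetries Ω h g lam :=
  LinearEquiv.ofBijective
    ((affineMap Ω (h / lam) g hlam).codRestrict (extendedSymmetries Ω h g lam).toSubmodule
      fun ξ => affineVF_mem_extendedSymmetries hlam ξ) (by
    have : Nonempty Ω := hΩ.nonempty.to_subtype
    constructor
    · intro ξ η hξη
      exact affineMap_injective hlam (congrArg Subtype.val hξη)
    · rintro ⟨X, hX⟩
      obtain ⟨ξ, rfl⟩ := exists_affineVF_of_mem hlam hΩ hX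
      exact ⟨ξ, rfl⟩)

theorem coe_extendedEquiv (hlam : lam ≠ 0) (hΩ : IsConnected (Ω : Set PVTOLSpace))
    (ξ : Fin 9 → ℝ) :
    (extendedEquiv hlam hΩ h g ξ : SmoothVF Ω) = affineVF Ω (h / lam) g lam ξ := rfl

theorem extendedEquiv_lie (hlam : lam ≠ 0) (hΩ : IsConnected (Ω : Set PVTOLSpace))
    (ξ η : Fin 9 → ℝ) : ⁅extendedEquiv hlam hΩ h g ξ, extendedEquiv hlam hΩ h g η⁆ =
      extendedEquiv hlam hΩ h g (affineBracket ξ η) :=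
  Subtype.ext (affineVF_lie hlam hΩ ξ η)

theorem mem_controlSymmetries_iff {X : SmoothVF Ω} :
    X ∈ controlSymmetries Ω (pvtolDistribution h g lam) pvtolTime ↔
      X ∈ infinitesimalSymmetries Ω (pvtolDistribution h g lam) ∧
        flatComp (h / lam) g lam X 0 = 0 := by
  refine and_congr Iff.rfl ⟨fun hX => ?_, fun hX p hp => ?_⟩
  · ext p
    rw [flatComp_apply, toFlat_apply]
    exact hX p.1 p.2
  · have h1 := congrArg (fun f : SmoothFun Ω => f.1 ⟨p, hp⟩) hX
    simp only [flatComp_apply, toFlat_apply] at h1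
    exact h1

/-- Parameters of symmetries without time translation. -/
def controlParam : (Fin 8 → ℝ) →ₗ[ℝ] (Fin 9 → ℝ) where
  toFun u := ![u 0, u 1, u 2, u 3, u 4, u 5, u 6, u 7, 0]
  map_add' u v := by
    funext j
    fin_cases j <;> simp
  map_smul' c u := by
    funext j
    fin_cases j <;> simp

theorem controlParam_castSucc (u : Fin 8 → ℝ) (i : Fin 8) :
    controlParam u (Fin.castSucc i) = u i := by
  fin_cases i <;> rfl

theorem controlParam_last (u : Fin 8 → ℝ) : controlParam u (Fin.last 8) = 0 := rfl

theorem affineVF_controlParam_mem (hlam : lam ≠ 0) (u : Fin 8 → ℝ) :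
    affineVF Ω (h / lam) g lam (controlParam u) ∈
      controlSymmetries Ω (pvtolDistribution h g lam) pvtolTime :=
  mem_controlSymmetries_iff.2 ⟨(affineVF_mem_extendedSymmetries hlam _).1, by
    rw [flatComp_affineVF_zero hlam]
    exact map_zero _⟩

/-- The parameters of the control symmetries. -/
def controlEquiv (hlam : lam ≠ 0) (hΩ : IsConnected (Ω : Set PVTOLSpace)) (h g : ℝ) :
    (Fin 8 → ℝ) ≃ₗ[ℝ] controlSymmetries Ω (pvtolDistribution h g lam) pvtolTime :=
  LinearEquiv.ofBijective
    ((affineMap Ω (h / lam) g hlam ∘ₗ controlParam).codRestrict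
      (controlSymmetries Ω (pvtolDistribution h g lam) pvtolTime).toSubmodule
      fun u => affineVF_controlParam_mem hlam u) (by
    have : Nonempty Ω := hΩ.nonempty.to_subtype
    constructor
    · intro u v huv
      have h1 := affineMap_injective hlam (congrArg Subtype.val huv)
      funext i
      have h2 := congrFun h1 (Fin.castSucc i)
      fin_cases i <;> exact h2
    · rintro ⟨X, hX⟩
      obtain ⟨hX1, hX2⟩ := mem_controlSymmetries_iff.1 hX
      obtain ⟨ξ, rfl⟩ := exists_affineVF_of_mem hlam hΩ ⟨hX1, 0, by rw [hX2, map_zero]⟩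
      rw [flatComp_affineVF_zero hlam] at hX2
      have h8 : ξ 8 = 0 := SmoothFun.algebraMap_injective (hX2.trans (map_zero _).symm)
      refine ⟨fun i => ξ (Fin.castSucc i), Subtype.ext (congrArg (affineVF Ω (h / lam) g lam) ?_)⟩
      funext j
      fin_cases j <;> first | rfl | exact h8.symm)

theorem coe_controlEquiv (hlam : lam ≠ 0) (hΩ : IsConnected (Ω : Set PVTOLSpace))
    (u : Fin 8 → ℝ) :
    (controlEquiv hlam hΩ h g u : SmoothVF Ω) = affineVF Ω (h / lam) g lam (controlParam u) := rfl

theorem controlEquiv_lie (hlam : lam ≠ 0) (hΩ : IsConnected (Ω : Set PVTOLSpace))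
    (u v w : Fin 8 → ℝ) (huv : affineBracket (controlParam u) (controlParam v) = controlParam w) :
    ⁅controlEquiv hlam hΩ h g u, controlEquiv hlam hΩ h g v⁆ = controlEquiv hlam hΩ h g w :=
  Subtype.ext (by
    change ⁅affineVF Ω (h / lam) g lam _, affineVF Ω (h / lam) g lam _⁆ = _
    rw [affineVF_lie hlam hΩ, huv]
    rfl)

/-- The basis `X₁, …, X₈, ∂_t`. -/
theorem exists_extended_basis (hlam : lam ≠ 0) (hΩ : IsConnected (Ω : Set PVTOLSpace)) :
    ∃ b : Module.Basis (Fin 9) ℝ (extendedSymmetries Ω h g lam),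
      ∀ i, ∀ p ∈ Ω, (b i).1.1 p = pvtolFieldExt h g lam i p := by
  refine ⟨Module.Basis.ofEquivFun ((affineParam g).trans (extendedEquiv hlam hΩ h g)).symm,
    fun i p hp => ?_⟩
  rw [Module.Basis.coe_ofEquivFun, LinearEquiv.symm_symm]
  beta_reduce
  rw [LinearEquiv.trans_apply, coe_extendedEquiv, affineVF_apply _ hp, pvtolFieldExt_eq g hlam]

/-- The basis `X₁, …, X₈`. -/
theorem exists_control_basis (hlam : lam ≠ 0) (hΩ : IsConnected (Ω : Set PVTOLSpace)) :
    ∃ b : Module.Basis (Fin 8) ℝ (controlSymmetries Ω (pvtolDistribution h g lam) pvtolTime),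
      ∀ i, ∀ p ∈ Ω, (b i).1.1 p = pvtolField h g lam i p := by
  let e : (Fin 8 → ℝ) ≃ₗ[ℝ] (Fin 8 → ℝ) :=
    { toFun := fun u => ![u 3, u 2, u 0 - u 2, u 3 - u 1, u 4, u 6, u 5, u 7]
      map_add' := fun u v => by
        funext j
        fin_cases j <;> simp <;> ring
      map_smul' := fun c u => by
        funext j
        fin_cases j <;> simp <;> ring
      invFun := fun ξ => ![ξ 2 + ξ 1, ξ 0 - ξ 3, ξ 1, ξ 0, ξ 4, ξ 6, ξ 5, ξ 7]
      left_inv := fun u => by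
        funext j
        fin_cases j <;> simp
      right_inv := fun u => by
        funext j
        fin_cases j <;> simp }
  have he : ∀ u, controlParam (e u) = affineParam g (controlParam u) := by
    intro u
    funext j
    fin_cases j <;> simp [controlParam, affineParam, e]
  have hs : ∀ i : Fin 8, controlParam (Pi.single i 1) = Pi.single (Fin.castSucc i) 1 := by
    intro i
    funext j
    refine Fin.lastCases ?_ (fun j => ?_) j
    · rw [controlParam_last, Pi.single_eq_of_ne (Fin.castSucc_lt_last i).ne']
    · rw [controlParam_castSucc]
      simp [Pi.single_apply]
  refine ⟨Module.Basis.ofEquivFun (e.trans (controlEquiv hlam hΩ h g)).symm,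
    fun i p hp => ?_⟩
  rw [Module.Basis.coe_ofEquivFun, LinearEquiv.symm_symm]
  beta_reduce
  rw [LinearEquiv.trans_apply, coe_controlEquiv, affineVF_apply _ hp, he, hs, ← pvtolFieldExt_eq g hlam, pvtolFieldExt,
    Fin.snoc_castSucc]

theorem sl_two_trace (A : sl (Fin 2) ℝ) : A.1 0 0 + A.1 1 1 = 0 := by
  have h := A.2
  have h' : A.1.trace = 0 := h
  rwa [Matrix.trace_fin_two] at h'

/-- The splitting of the parameters into `𝔰𝔩(2)` and `𝔰_{6,140}`. -/
def leviExtended : (sl (Fin 2) ℝ × LieS6140) ≃ₗ[ℝ] (Fin 9 → ℝ) where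
  -- The sign compensates for `affineBracket` being the opposite commutator. Up to it, `e₁, e₂` are
  -- translations, `e₃, e₄` boosts, `e₅` the time translation of the flat system and `e₆` the
  -- dilation.
  toFun x := ![-(x.1.1 0 0 + x.2 5), -x.1.1 0 1, -x.1.1 1 0, -(x.1.1 1 1 + x.2 5),
    -x.2 2, -x.2 3, -x.2 0, -x.2 1, -x.2 4]
  map_add' x y := by
    have hv : ∀ i, (x.2 + y.2) i = x.2 i + y.2 i := fun _ => rfl
    funext j
    fin_cases j <;> simp [hv] <;> ring
  map_smul' c x := by
    have hv : ∀ i, (c • x.2) i = c * x.2 i := fun _ => rfl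
    funext j
    fin_cases j <;> simp [hv] <;> ring
  invFun ξ := (⟨!![(ξ 3 - ξ 0) / 2, -ξ 1; -ξ 2, (ξ 0 - ξ 3) / 2], by
      change Matrix.trace (!![(ξ 3 - ξ 0) / 2, -ξ 1; -ξ 2, (ξ 0 - ξ 3) / 2] : Matrix (Fin 2) (Fin 2) ℝ) = 0
      rw [Matrix.trace_fin_two]
      simp
      ring⟩, ![-ξ 6, -ξ 7, -ξ 4, -ξ 5, -ξ 8, -(ξ 0 + ξ 3) / 2])
  left_inv x := by
    obtain ⟨A, v⟩ := x
    have hA := sl_two_trace A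
    refine Prod.ext (Subtype.ext ?_) ?_
    · ext i j
      fin_cases i <;> fin_cases j <;> simp <;> linarith
    · funext j
      fin_cases j <;> simp
      linarith
  right_inv ξ := by
    funext j
    fin_cases j <;> simp <;> ring

/-- The splitting of the parameters into `𝔰𝔩(2)` and `𝔰_{5,9}`. -/
def leviControl : (sl (Fin 2) ℝ × LieS59) ≃ₗ[ℝ] (Fin 8 → ℝ) where
  toFun x := ![-(x.1.1 0 0 + x.2 4), -x.1.1 0 1, -x.1.1 1 0, -(x.1.1 1 1 + x.2 4),
    -x.2 2, -x.2 3, -x.2 0, -x.2 1]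
  map_add' x y := by
    have hv : ∀ i, (x.2 + y.2) i = x.2 i + y.2 i := fun _ => rfl
    funext j
    fin_cases j <;> simp [hv] <;> ring
  map_smul' c x := by
    have hv : ∀ i, (c • x.2) i = c * x.2 i := fun _ => rfl
    funext j
    fin_cases j <;> simp [hv] <;> ring
  invFun ξ := (⟨!![(ξ 3 - ξ 0) / 2, -ξ 1; -ξ 2, (ξ 0 - ξ 3) / 2], by
      change Matrix.trace (!![(ξ 3 - ξ 0) / 2, -ξ 1; -ξ 2, (ξ 0 - ξ 3) / 2] : Matrix (Fin 2) (Fin 2) ℝ) = 0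
      rw [Matrix.trace_fin_two]
      simp
      ring⟩, ![-ξ 6, -ξ 7, -ξ 4, -ξ 5, -(ξ 0 + ξ 3) / 2])
  left_inv x := by
    obtain ⟨A, v⟩ := x
    have hA := sl_two_trace A
    refine Prod.ext (Subtype.ext ?_) ?_
    · ext i j
      fin_cases i <;> fin_cases j <;> simp <;> linarith
    · funext j
      fin_cases j <;> simp
      linarith
  right_inv ξ := by
    funext j
    fin_cases j <;> simp <;> ring

theorem leviExtended_apply (A : sl (Fin 2) ℝ) (v : LieS6140) : leviExtended (A, v) =
    ![-(A.1 0 0 + v 5), -A.1 0 1, -A.1 1 0, -(A.1 1 1 + v 5),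
      -v 2, -v 3, -v 0, -v 1, -v 4] := rfl

theorem leviControl_apply (A : sl (Fin 2) ℝ) (v : LieS59) : leviControl (A, v) =
    ![-(A.1 0 0 + v 4), -A.1 0 1, -A.1 1 0, -(A.1 1 1 + v 4), -v 2, -v 3, -v 0, -v 1] := rfl

theorem sl_two_lie_apply (A B : sl (Fin 2) ℝ) (i j : Fin 2) :
    ⁅A, B⁆.1 i j = A.1 i 0 * B.1 0 j + A.1 i 1 * B.1 1 j
      - (B.1 i 0 * A.1 0 j + B.1 i 1 * A.1 1 j) := by
  rw [sl_bracket, Matrix.sub_apply, Matrix.mul_apply, Matrix.mul_apply, Fin.sum_univ_two,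
    Fin.sum_univ_two]

theorem sl_two_zero_apply (i j : Fin 2) : (0 : sl (Fin 2) ℝ).1 i j = 0 := rfl

end LieAlgebras

end

noncomputable section

/-! ### Brackets of the Levi splitting -/

section LeviDecompositions

open LieAlgebra.SpecialLinear ThrustFrame

variable {h g lam : ℝ} {Ω : TopologicalSpace.Opens PVTOLSpace}

theorem affineBracket_leviExtended_sl (A B : sl (Fin 2) ℝ) :
    affineBracket (leviExtended (A, 0)) (leviExtended (B, 0)) = leviExtended (⁅A, B⁆, 0) := by
  have h0 : ∀ i, (0 : LieS6140) i = 0 := fun _ => rfl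
  rw [leviExtended_apply, leviExtended_apply, leviExtended_apply]
  simp only [sl_two_lie_apply, h0]
  funext j
  fin_cases j <;> simp [affineBracket]

theorem affineBracket_leviExtended_radical (v w : LieS6140) :
    affineBracket (leviExtended (0, v)) (leviExtended (0, w)) = leviExtended (0, ⁅v, w⁆) := by
  rw [leviExtended_apply, leviExtended_apply, leviExtended_apply, LieS6140.lie_def]
  simp only [LieS6140.br, sl_two_zero_apply]
  funext j
  fin_cases j <;> simp [affineBracket] <;> ring

theorem affineBracket_leviExtended_act (A : sl (Fin 2) ℝ) (v : LieS6140) :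
    affineBracket (leviExtended (A, 0)) (leviExtended (0, v)) =
      leviExtended (0, actS6140 A.1 v) := by
  have h0 : ∀ i, (0 : LieS6140) i = 0 := fun _ => rfl
  rw [leviExtended_apply, leviExtended_apply, leviExtended_apply]
  simp only [actS6140, sl_two_zero_apply, h0]
  funext j
  fin_cases j <;> simp [affineBracket] <;> ring

theorem hasLeviDecomposition_extended (hlam : lam ≠ 0) (hΩ : IsConnected (Ω : Set PVTOLSpace)) :
    HasLeviDecompositionSl2 (extendedSymmetries Ω h g lam) LieS6140 actS6140 :=
  hasLeviDecompositionSl2_of_linearEquiv (leviExtended.trans (extendedEquiv hlam hΩ h g))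
    (fun A B => (extendedEquiv_lie hlam hΩ _ _).trans
      (congrArg _ (affineBracket_leviExtended_sl A B)))
    (fun v w => (extendedEquiv_lie hlam hΩ _ _).trans
      (congrArg _ (affineBracket_leviExtended_radical v w)))
    (fun A v => (extendedEquiv_lie hlam hΩ _ _).trans
      (congrArg _ (affineBracket_leviExtended_act A v)))

theorem controlParam_apply (u : Fin 8 → ℝ) :
    controlParam u = ![u 0, u 1, u 2, u 3, u 4, u 5, u 6, u 7, 0] := rfl

theorem affineBracket_leviControl_sl (A B : sl (Fin 2) ℝ) :
    affineBracket (controlParam (leviControl (A, 0))) (controlParam (leviControl (B, 0))) =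
      controlParam (leviControl (⁅A, B⁆, 0)) := by
  have h0 : ∀ i, (0 : LieS59) i = 0 := fun _ => rfl
  rw [leviControl_apply, leviControl_apply, leviControl_apply]
  simp only [sl_two_lie_apply, h0, controlParam_apply]
  funext j
  fin_cases j <;> simp [affineBracket]

theorem affineBracket_leviControl_radical (v w : LieS59) :
    affineBracket (controlParam (leviControl (0, v))) (controlParam (leviControl (0, w))) =
      controlParam (leviControl (0, ⁅v, w⁆)) := by
  rw [leviControl_apply, leviControl_apply, leviControl_apply, LieS59.lie_def]
  simp only [LieS59.br, sl_two_zero_apply, controlParam_apply]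
  funext j
  fin_cases j <;> simp [affineBracket] <;> ring

theorem affineBracket_leviControl_act (A : sl (Fin 2) ℝ) (v : LieS59) :
    affineBracket (controlParam (leviControl (A, 0))) (controlParam (leviControl (0, v))) =
      controlParam (leviControl (0, actS59 A.1 v)) := by
  have h0 : ∀ i, (0 : LieS59) i = 0 := fun _ => rfl
  rw [leviControl_apply, leviControl_apply, leviControl_apply]
  simp only [actS59, sl_two_zero_apply, h0, controlParam_apply]
  funext j
  fin_cases j <;> simp [affineBracket] <;> ring

theorem hasLeviDecomposition_control (hlam : lam ≠ 0) (hΩ : IsConnected (Ω : Set PVTOLSpace)) :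
    HasLeviDecompositionSl2 (controlSymmetries Ω (pvtolDistribution h g lam) pvtolTime)
      LieS59 actS59 :=
  hasLeviDecompositionSl2_of_linearEquiv (leviControl.trans (controlEquiv hlam hΩ h g))
    (fun A B => controlEquiv_lie hlam hΩ _ _ _ (affineBracket_leviControl_sl A B))
    (fun v w => controlEquiv_lie hlam hΩ _ _ _ (affineBracket_leviControl_radical v w))
    (fun A v => controlEquiv_lie hlam hΩ _ _ _ (affineBracket_leviControl_act A v))

end LeviDecompositions

end

noncomputable section

/-! ### The Lie group of frames -/

open VectorField

/-- The group of affine maps `(z, t, 1) ↦ (M z + t c + b, t + s, 1)` with `M` an invertible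
`2 × 2` matrix; its coordinates are the entries of `M`, `c`, `b` and `s`. -/
def FrameGroup : Type := {a : Fin 9 → ℝ // a 0 * a 3 - a 1 * a 2 ≠ 0}

namespace FrameGroup

instance : TopologicalSpace FrameGroup :=
  inferInstanceAs (TopologicalSpace {a : Fin 9 → ℝ // a 0 * a 3 - a 1 * a 2 ≠ 0})

/-- The coordinates of a group element. -/
def coord (x : FrameGroup) : Fin 9 → ℝ := x.1

theorem coord_injective : Function.Injective coord := Subtype.val_injective

/-- The composition of `b` with `a`. -/
def mulCoord (a b : Fin 9 → ℝ) : Fin 9 → ℝ :=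
  ![b 0 * a 0 + b 1 * a 2, b 0 * a 1 + b 1 * a 3, b 2 * a 0 + b 3 * a 2, b 2 * a 1 + b 3 * a 3,
    b 0 * a 4 + b 1 * a 5 + b 4, b 2 * a 4 + b 3 * a 5 + b 5,
    b 0 * a 6 + b 1 * a 7 + b 4 * a 8 + b 6, b 2 * a 6 + b 3 * a 7 + b 5 * a 8 + b 7,
    a 8 + b 8]

/-- The coordinates of the identity. -/
def oneCoord : Fin 9 → ℝ := ![1, 0, 0, 1, 0, 0, 0, 0, 0]

/-- The coordinates of the inverse of `a`. -/
def invCoord (a : Fin 9 → ℝ) : Fin 9 → ℝ :=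
  let δ := a 0 * a 3 - a 1 * a 2
  ![a 3 / δ, -a 1 / δ, -a 2 / δ, a 0 / δ,
    (a 1 * a 5 - a 3 * a 4) / δ, (a 2 * a 4 - a 0 * a 5) / δ,
    (a 3 * (a 4 * a 8 - a 6) - a 1 * (a 5 * a 8 - a 7)) / δ,
    (a 0 * (a 5 * a 8 - a 7) - a 2 * (a 4 * a 8 - a 6)) / δ, -a 8]

/-- The product is opposite to matrix multiplication: the matrix of `x * y` is that of `y` times
that of `x`. Thus left-invariant fields are `ξ y` in matrices, the way symmetries act on frames, and
their bracket has the sign of `affineBracket`. -/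
instance : Mul FrameGroup := ⟨fun x y => ⟨mulCoord x.1 y.1, by
  have h := mul_ne_zero x.2 y.2
  simp only [mulCoord, Matrix.cons_val]
  convert h using 1
  ring⟩⟩

instance : One FrameGroup := ⟨⟨oneCoord, by simp [oneCoord]⟩⟩

instance : Inv FrameGroup := ⟨fun x => ⟨invCoord x.1, by
  have h := x.2
  simp only [invCoord, Matrix.cons_val]
  generalize x.1 = a at h
  have h1 : a 3 / (a 0 * a 3 - a 1 * a 2) * (a 0 / (a 0 * a 3 - a 1 * a 2)) -
      -a 1 / (a 0 * a 3 - a 1 * a 2) * (-a 2 / (a 0 * a 3 - a 1 * a 2)) =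
      (a 0 * a 3 - a 1 * a 2)⁻¹ := by
    field_simp
  rw [h1]
  exact inv_ne_zero h⟩⟩

theorem coord_mul (x y : FrameGroup) : coord (x * y) = mulCoord (coord x) (coord y) := rfl

theorem coord_one : coord 1 = oneCoord := rfl

theorem coord_inv (x : FrameGroup) : coord x⁻¹ = invCoord (coord x) := rfl

theorem det_coord_ne_zero (x : FrameGroup) :
    coord x 0 * coord x 3 - coord x 1 * coord x 2 ≠ 0 := x.2

instance : Group FrameGroup where
  mul_assoc x y z := coord_injective (by
    simp only [coord_mul]
    funext j
    fin_cases j <;> simp [mulCoord] <;> ring)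
  one_mul x := coord_injective (by
    simp only [coord_mul, coord_one]
    funext j
    fin_cases j <;> simp [mulCoord, oneCoord])
  mul_one x := coord_injective (by
    simp only [coord_mul, coord_one]
    funext j
    fin_cases j <;> simp [mulCoord, oneCoord])
  inv_mul_cancel x := coord_injective (by
    have h := det_coord_ne_zero x
    simp only [coord_mul, coord_one, coord_inv]
    generalize coord x = a at h
    have hd := mul_inv_cancel₀ h
    simp only [invCoord, div_eq_mul_inv]
    generalize (a 0 * a 3 - a 1 * a 2)⁻¹ = d at hd
    funext j
    fin_cases j <;> simp [mulCoord, oneCoord]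
    · linear_combination hd
    · ring
    · ring
    · linear_combination hd
    · linear_combination -a 4 * hd
    · linear_combination -a 5 * hd
    · linear_combination (a 4 * a 8 - a 6) * hd
    · linear_combination (a 5 * a 8 - a 7) * hd)

theorem isOpenEmbedding_coord : Topology.IsOpenEmbedding coord :=
  IsOpen.isOpenEmbedding_subtypeVal (isOpen_ne_fun (by fun_prop) (by fun_prop))

instance : ChartedSpace (Fin 9 → ℝ) FrameGroup := isOpenEmbedding_coord.singletonChartedSpace

instance : IsManifold 𝓘(ℝ, Fin 9 → ℝ) ∞ FrameGroup := isOpenEmbedding_coord.isManifold_singleton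

theorem contMDiff_coord : ContMDiff 𝓘(ℝ, Fin 9 → ℝ) 𝓘(ℝ, Fin 9 → ℝ) ∞ coord :=
  contMDiff_isOpenEmbedding isOpenEmbedding_coord

theorem contDiff_mulCoord :
    ContDiff ℝ ∞ fun q : (Fin 9 → ℝ) × (Fin 9 → ℝ) => mulCoord q.1 q.2 := by
  rw [contDiff_pi]
  intro j
  fin_cases j <;> simp [mulCoord] <;> fun_prop

theorem contDiffAt_invCoord {a : Fin 9 → ℝ} (ha : a 0 * a 3 - a 1 * a 2 ≠ 0) :
    ContDiffAt ℝ ∞ invCoord a := by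
  rw [contDiffAt_pi]
  intro j
  fin_cases j <;> simp [invCoord] <;> fun_prop (disch := assumption)

instance : LieGroup 𝓘(ℝ, Fin 9 → ℝ) ∞ FrameGroup where
  contMDiff_mul := by
    refine ContMDiff.of_comp_isOpenEmbedding isOpenEmbedding_coord ?_
    exact contDiff_mulCoord.contMDiff.comp
      ((contMDiff_coord.comp contMDiff_fst).prodMk_space (contMDiff_coord.comp contMDiff_snd))
  contMDiff_inv := by
    refine ContMDiff.of_comp_isOpenEmbedding isOpenEmbedding_coord fun x => ?_
    exact (contDiffAt_invCoord (det_coord_ne_zero x)).contMDiffAt.comp x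
      contMDiff_coord.contMDiffAt

/-- `coord` is the only chart, so it is the identity when written in charts. -/
theorem hasMFDerivAt_coord (x : FrameGroup) :
    HasMFDerivAt 𝓘(ℝ, Fin 9 → ℝ) 𝓘(ℝ, Fin 9 → ℝ) coord x
      (ContinuousLinearMap.id ℝ (Fin 9 → ℝ)) := by
  refine ⟨isOpenEmbedding_coord.continuous.continuousAt, ?_⟩
  have h : ∀ y ∈ Set.range coord,
      writtenInExtChartAt 𝓘(ℝ, Fin 9 → ℝ) 𝓘(ℝ, Fin 9 → ℝ) x coord y = y := by
    intro y hy
    exact isOpenEmbedding_coord.toOpenPartialHomeomorph_right_inv coord hy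
  refine ((hasFDerivAt_id _).congr_of_eventuallyEq ?_).hasFDerivWithinAt
  exact Filter.eventually_of_mem (isOpenEmbedding_coord.isOpen_range.mem_nhds ⟨x, rfl⟩) h

theorem mfderiv_coord (x : FrameGroup) (v : Fin 9 → ℝ) :
    mfderiv 𝓘(ℝ, Fin 9 → ℝ) 𝓘(ℝ, Fin 9 → ℝ) coord x v = v := by
  rw [(hasMFDerivAt_coord x).mfderiv]
  rfl

/-- A map into the group is differentiated in coordinates. -/
theorem mfderiv_apply_of_coord_comp {E : Type*} [NormedAddCommGroup E] [NormedSpace ℝ E]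
    {f : E → FrameGroup} {F : E → Fin 9 → ℝ} {F' : E →L[ℝ] Fin 9 → ℝ} {p : E}
    (hf : MDifferentiableAt 𝓘(ℝ, E) 𝓘(ℝ, Fin 9 → ℝ) f p)
    (hF : HasFDerivAt F F' p) (hfF : coord ∘ f =ᶠ[nhds p] F) (v : E) :
    mfderiv 𝓘(ℝ, E) 𝓘(ℝ, Fin 9 → ℝ) f p v = F' v := by
  have h1 : mfderiv 𝓘(ℝ, E) 𝓘(ℝ, Fin 9 → ℝ) (coord ∘ f) p = F' :=
    (hF.congr_of_eventuallyEq hfF).hasMFDerivAt.mfderiv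
  rw [mfderiv_comp p (hasMFDerivAt_coord (f p)).mdifferentiableAt hf] at h1
  rw [← h1]
  exact (mfderiv_coord (f p) _).symm

/-- A transformation of the group is differentiated in coordinates. -/
theorem mfderiv_apply_of_coord_comp_eq {f : FrameGroup → FrameGroup}
    {F : (Fin 9 → ℝ) → Fin 9 → ℝ} {F' : (Fin 9 → ℝ) →L[ℝ] Fin 9 → ℝ} {x : FrameGroup}
    (hf : MDifferentiableAt 𝓘(ℝ, Fin 9 → ℝ) 𝓘(ℝ, Fin 9 → ℝ) f x)
    (hF : HasFDerivAt F F' (coord x)) (hfF : ∀ y, coord (f y) = F (coord y)) (v : Fin 9 → ℝ) :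
    mfderiv 𝓘(ℝ, Fin 9 → ℝ) 𝓘(ℝ, Fin 9 → ℝ) f x v = F' v := by
  have h1 := mfderiv_comp x (hasMFDerivAt_coord (f x)).mdifferentiableAt hf
  have h2 := mfderiv_comp x hF.hasMFDerivAt.mdifferentiableAt
    (hasMFDerivAt_coord x).mdifferentiableAt
  have h3 : coord ∘ f = F ∘ coord := funext hfF
  rw [h3, h2, hF.hasMFDerivAt.mfderiv] at h1
  have h4 := congrArg (fun T : (Fin 9 → ℝ) →L[ℝ] (Fin 9 → ℝ) => T v) h1
  refine ((mfderiv_coord (f x) _).symm.trans h4.symm).trans ?_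
  exact congrArg F' (mfderiv_coord x v)

/-- The left-invariant vector fields in coordinates. -/
def leftAt (ξ y : Fin 9 → ℝ) : Fin 9 → ℝ :=
  ![ξ 0 * y 0 + ξ 1 * y 2, ξ 0 * y 1 + ξ 1 * y 3, ξ 2 * y 0 + ξ 3 * y 2, ξ 2 * y 1 + ξ 3 * y 3,
    ξ 0 * y 4 + ξ 1 * y 5 + ξ 4, ξ 2 * y 4 + ξ 3 * y 5 + ξ 5,
    ξ 0 * y 6 + ξ 1 * y 7 + ξ 4 * y 8 + ξ 6, ξ 2 * y 6 + ξ 3 * y 7 + ξ 5 * y 8 + ξ 7,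
    ξ 8]

/-- The right-invariant vector fields in coordinates. -/
def rightAt (y η : Fin 9 → ℝ) : Fin 9 → ℝ :=
  ![y 0 * η 0 + y 1 * η 2, y 0 * η 1 + y 1 * η 3, y 2 * η 0 + y 3 * η 2, y 2 * η 1 + y 3 * η 3,
    y 0 * η 4 + y 1 * η 5, y 2 * η 4 + y 3 * η 5,
    y 0 * η 6 + y 1 * η 7 + y 4 * η 8, y 2 * η 6 + y 3 * η 7 + y 5 * η 8,
    η 8]

/-- The dependence of the left-invariant vector fields on their values at the identity. -/
def leftMap (y : Fin 9 → ℝ) : (Fin 9 → ℝ) →ₗ[ℝ] (Fin 9 → ℝ) where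
  toFun ξ := leftAt ξ y
  map_add' ξ η := by
    funext j
    fin_cases j <;> simp [leftAt] <;> ring
  map_smul' c ξ := by
    funext j
    fin_cases j <;> simp [leftAt] <;> ring

theorem leftMap_apply (ξ y : Fin 9 → ℝ) : leftMap y ξ = leftAt ξ y := rfl

theorem hasFDerivAt_mulCoord_left (a b : Fin 9 → ℝ) :
    HasFDerivAt (mulCoord a) (LinearMap.toContinuousLinearMap (leftMap a)) b := by
  -- Composition is affine in the second factor; its only term free of that factor is the time shift
  -- of the first.
  refine ((ContinuousLinearMap.hasFDerivAt _).add_const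
    (![0, 0, 0, 0, 0, 0, 0, 0, a 8] : Fin 9 → ℝ)).congr_of_eventuallyEq
    (Filter.Eventually.of_forall fun y => ?_)
  funext j
  fin_cases j <;> simp [leftMap, leftAt, mulCoord]
  ring

theorem hasFDerivAt_mulCoord_right (a b : Fin 9 → ℝ) : HasFDerivAt (fun y => mulCoord y a)
    (LinearMap.toContinuousLinearMap (
      { toFun := fun v => rightAt a v
        map_add' := fun v w => by
          funext j
          fin_cases j <;> simp [rightAt] <;> ring
        map_smul' := fun c v => by
          funext j
          fin_cases j <;> simp [rightAt] <;> ring } : (Fin 9 → ℝ) →ₗ[ℝ] Fin 9 → ℝ)) b := by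
  refine ((ContinuousLinearMap.hasFDerivAt _).add_const
    (![0, 0, 0, 0, a 4, a 5, a 6, a 7, a 8] : Fin 9 → ℝ)).congr_of_eventuallyEq
    (Filter.Eventually.of_forall fun y => ?_)
  funext j
  fin_cases j <;> simp [rightAt, mulCoord]

theorem mulInvariantVectorField_apply (ξ : GroupLieAlgebra 𝓘(ℝ, Fin 9 → ℝ) FrameGroup)
    (x : FrameGroup) : mulInvariantVectorField ξ x = leftAt ξ (coord x) :=
  mfderiv_apply_of_coord_comp_eq
    ((contMDiff_mul_left (I := 𝓘(ℝ, Fin 9 → ℝ)) (n := ∞)).mdifferentiable (by simp) _)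
    (hasFDerivAt_mulCoord_left _ _) (fun y => coord_mul x y) ξ

theorem mfderiv_mul_right_apply (η : GroupLieAlgebra 𝓘(ℝ, Fin 9 → ℝ) FrameGroup)
    (x : FrameGroup) :
    mfderiv 𝓘(ℝ, Fin 9 → ℝ) 𝓘(ℝ, Fin 9 → ℝ) (fun a => a * x) 1 η = rightAt (coord x) η :=
  mfderiv_apply_of_coord_comp_eq
    ((contMDiff_mul_right (I := 𝓘(ℝ, Fin 9 → ℝ)) (n := ∞)).mdifferentiable (by simp) _)
    (hasFDerivAt_mulCoord_right _ _) (fun y => coord_mul y x) η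

/-- The derivative of a left-invariant vector field in coordinates. -/
def leftDeriv (ξ : Fin 9 → ℝ) : (Fin 9 → ℝ) →ₗ[ℝ] (Fin 9 → ℝ) where
  toFun v := ![ξ 0 * v 0 + ξ 1 * v 2, ξ 0 * v 1 + ξ 1 * v 3,
    ξ 2 * v 0 + ξ 3 * v 2, ξ 2 * v 1 + ξ 3 * v 3,
    ξ 0 * v 4 + ξ 1 * v 5, ξ 2 * v 4 + ξ 3 * v 5,
    ξ 0 * v 6 + ξ 1 * v 7 + ξ 4 * v 8, ξ 2 * v 6 + ξ 3 * v 7 + ξ 5 * v 8, 0]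
  map_add' v w := by
    funext j
    fin_cases j <;> simp <;> ring
  map_smul' c v := by
    funext j
    fin_cases j <;> simp <;> ring

theorem leftDeriv_apply (ξ v : Fin 9 → ℝ) : leftDeriv ξ v =
    ![ξ 0 * v 0 + ξ 1 * v 2, ξ 0 * v 1 + ξ 1 * v 3,
      ξ 2 * v 0 + ξ 3 * v 2, ξ 2 * v 1 + ξ 3 * v 3,
      ξ 0 * v 4 + ξ 1 * v 5, ξ 2 * v 4 + ξ 3 * v 5,
      ξ 0 * v 6 + ξ 1 * v 7 + ξ 4 * v 8, ξ 2 * v 6 + ξ 3 * v 7 + ξ 5 * v 8, 0] := rfl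

theorem hasFDerivAt_leftAt (ξ y : Fin 9 → ℝ) :
    HasFDerivAt (leftAt ξ) (LinearMap.toContinuousLinearMap (leftDeriv ξ)) y := by
  refine ((ContinuousLinearMap.hasFDerivAt _).add_const
    (![0, 0, 0, 0, ξ 4, ξ 5, ξ 6, ξ 7, ξ 8] : Fin 9 → ℝ)).congr_of_eventuallyEq
    (Filter.Eventually.of_forall fun z => ?_)
  funext j
  fin_cases j <;> simp [leftAt, leftDeriv_apply]

theorem leftAt_oneCoord (ξ : Fin 9 → ℝ) : leftAt ξ oneCoord = ξ := by
  funext j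
  fin_cases j <;> simp [leftAt, oneCoord]

theorem contDiff_leftAt (ξ : Fin 9 → ℝ) : ContDiff ℝ ∞ (leftAt ξ) := by
  rw [contDiff_pi]
  intro j
  fin_cases j <;> simp [leftAt] <;> fun_prop

theorem mpullback_coord_apply (V : (Fin 9 → ℝ) → Fin 9 → ℝ) (x : FrameGroup) :
    mpullback 𝓘(ℝ, Fin 9 → ℝ) 𝓘(ℝ, Fin 9 → ℝ) coord V x = V (coord x) := by
  change (mfderiv 𝓘(ℝ, Fin 9 → ℝ) 𝓘(ℝ, Fin 9 → ℝ) coord x).inverse (V (coord x)) = _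
  rw [(hasMFDerivAt_coord x).mfderiv]
  exact congrArg (fun T : (Fin 9 → ℝ) →L[ℝ] (Fin 9 → ℝ) => T (V (coord x)))
    ContinuousLinearMap.inverse_id

theorem mulInvariantVectorField_eq_mpullback_coord
    (ξ : GroupLieAlgebra 𝓘(ℝ, Fin 9 → ℝ) FrameGroup) :
    mulInvariantVectorField ξ =
      mpullback 𝓘(ℝ, Fin 9 → ℝ) 𝓘(ℝ, Fin 9 → ℝ) coord (leftAt ξ) :=
  funext fun x => (mulInvariantVectorField_apply ξ x).trans (mpullback_coord_apply _ x).symm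

theorem mlieBracket_eq_lieBracket {E : Type*} [NormedAddCommGroup E] [NormedSpace ℝ E]
    (V W : E → E) (x : E) : mlieBracket 𝓘(ℝ, E) V W x = lieBracket ℝ V W x := by
  have h := congrFun (mlieBracketWithin_eq_lieBracketWithin (𝕜 := ℝ) (V := V) (W := W)
    (s := Set.univ)) x
  rw [lieBracketWithin_univ] at h
  exact (congrFun mlieBracketWithin_univ.symm x).trans h

theorem lieBracket_leftAt (ξ η : Fin 9 → ℝ) :
    lieBracket ℝ (leftAt ξ) (leftAt η) oneCoord = ThrustFrame.affineBracket ξ η := by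
  rw [lieBracket, (hasFDerivAt_leftAt ξ _).fderiv, (hasFDerivAt_leftAt η _).fderiv,
    leftAt_oneCoord, leftAt_oneCoord, LinearMap.coe_toContinuousLinearMap',
    LinearMap.coe_toContinuousLinearMap', leftDeriv_apply, leftDeriv_apply]
  funext j
  fin_cases j <;> simp [ThrustFrame.affineBracket]

/-- Left-invariant fields are pullbacks of `leftAt` along `coord`, and brackets commute with
pullback; so the bracket is computed in `ℝ⁹` at the identity. -/
theorem lie_eq_affineBracket (ξ η : GroupLieAlgebra 𝓘(ℝ, Fin 9 → ℝ) FrameGroup) :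
    ⁅ξ, η⁆ = ThrustFrame.affineBracket ξ η := by
  have hd : ∀ ζ : Fin 9 → ℝ, MDifferentiableAt 𝓘(ℝ, Fin 9 → ℝ) (𝓘(ℝ, Fin 9 → ℝ).tangent)
      (fun y => (⟨y, leftAt ζ y⟩ : TangentBundle 𝓘(ℝ, Fin 9 → ℝ) (Fin 9 → ℝ))) (coord 1) :=
    fun ζ => (contMDiffAt_vectorSpace_iff_contDiffAt.2
      (contDiff_leftAt ζ).contDiffAt).mdifferentiableAt (by simp)
  have h1 := mpullback_mlieBracket (n := ∞) (V := leftAt ξ) (W := leftAt η) (x₀ := 1)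
    (hd ξ) (hd η) contMDiff_coord.contMDiffAt (by
      rw [minSmoothness_of_isRCLikeNormedField]; exact ENat.LEInfty.out)
  rw [GroupLieAlgebra.bracket_def, mulInvariantVectorField_eq_mpullback_coord,
    mulInvariantVectorField_eq_mpullback_coord]
  refine h1.symm.trans ((mpullback_coord_apply _ 1).trans ?_)
  refine (mlieBracket_eq_lieBracket _ _ _).trans ?_
  rw [coord_one]
  exact lieBracket_leftAt ξ η

theorem leftMap_injective {y : Fin 9 → ℝ} (hy : y 0 * y 3 - y 1 * y 2 ≠ 0) :
    Function.Injective (leftMap y) := by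
  rw [injective_iff_map_eq_zero]
  intro ξ hξ
  have h := congrFun hξ
  have h0 := h 0
  have h1 := h 1
  have h2 := h 2
  have h3 := h 3
  have h4 := h 4
  have h5 := h 5
  have h6 := h 6
  have h7 := h 7
  have h8 := h 8
  simp only [leftMap_apply, leftAt, Matrix.cons_val, Pi.zero_apply] at h0 h1 h2 h3 h4 h5 h6 h7 h8
  have e0 : ξ 0 = 0 := mul_right_cancel₀ hy (by linear_combination y 3 * h0 - y 2 * h1)
  have e1 : ξ 1 = 0 := mul_right_cancel₀ hy (by linear_combination y 0 * h1 - y 1 * h0)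
  have e2 : ξ 2 = 0 := mul_right_cancel₀ hy (by linear_combination y 3 * h2 - y 2 * h3)
  have e3 : ξ 3 = 0 := mul_right_cancel₀ hy (by linear_combination y 0 * h3 - y 1 * h2)
  simp only [e0, e1, e2, e3, zero_mul, zero_add] at h4 h5 h6 h7
  simp only [h4, h5, zero_mul, zero_add] at h6 h7
  funext j
  fin_cases j <;> assumption

end FrameGroup

end

noncomputable section

/-! ### The frame of the thrust -/

section ThrustFrames

open Real FrameGroup

/-- The point of the frame group at the point with flat coordinates `y`. Its linear part has the
thrust as first column; the second column is chosen such that the distribution becomes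
right-invariant. -/
def frameCoord (y : PVTOLSpace) : Fin 9 → ℝ :=
  ![-(y 7 * sin (y 5)), -(y 7 * y 6 * cos (y 5)) + y 7 * y 8 / (2 * y 6) * sin (y 5),
    y 7 * cos (y 5), -(y 7 * y 6 * sin (y 5)) - y 7 * y 8 / (2 * y 6) * cos (y 5),
    y 2, y 4, y 1, y 3, y 0]

/-- The derivative of the frame. -/
def frameDeriv (y : PVTOLSpace) : PVTOLSpace →L[ℝ] (Fin 9 → ℝ) :=
  let d := fun i => ContinuousLinearMap.proj (R := ℝ) (φ := fun _ : Fin 9 => ℝ) i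
  let ρ := (y 8 / (2 * y 6)) • d 7 + (y 7 / (2 * y 6)) • d 8 - (y 7 * y 8 / (2 * y 6 ^ 2)) • d 6
  ContinuousLinearMap.pi
    ![-(sin (y 5) • d 7) - (y 7 * cos (y 5)) • d 5,
      -((y 6 * cos (y 5)) • d 7) - (y 7 * cos (y 5)) • d 6 + (y 7 * y 6 * sin (y 5)) • d 5
        + sin (y 5) • ρ + (y 7 * y 8 / (2 * y 6) * cos (y 5)) • d 5,
      cos (y 5) • d 7 - (y 7 * sin (y 5)) • d 5,
      -((y 6 * sin (y 5)) • d 7) - (y 7 * sin (y 5)) • d 6 - (y 7 * y 6 * cos (y 5)) • d 5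
        - cos (y 5) • ρ + (y 7 * y 8 / (2 * y 6) * sin (y 5)) • d 5,
      d 2, d 4, d 1, d 3, d 0]

theorem frameDeriv_apply (y v : PVTOLSpace) : frameDeriv y v =
    let ρ := y 8 / (2 * y 6) * v 7 + y 7 / (2 * y 6) * v 8 - y 7 * y 8 / (2 * y 6 ^ 2) * v 6
    ![-(sin (y 5) * v 7) - y 7 * cos (y 5) * v 5,
      -(y 6 * cos (y 5) * v 7) - y 7 * cos (y 5) * v 6 + y 7 * y 6 * sin (y 5) * v 5
        + sin (y 5) * ρ + y 7 * y 8 / (2 * y 6) * cos (y 5) * v 5,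
      cos (y 5) * v 7 - y 7 * sin (y 5) * v 5,
      -(y 6 * sin (y 5) * v 7) - y 7 * sin (y 5) * v 6 - y 7 * y 6 * cos (y 5) * v 5
        - cos (y 5) * ρ + y 7 * y 8 / (2 * y 6) * sin (y 5) * v 5,
      v 2, v 4, v 1, v 3, v 0] := by
  funext j
  fin_cases j <;> simp [frameDeriv]

/-- The multiple of the first column contained in the second drops out, which leaves `v² ω`: the
frame is invertible at the generic points. -/
theorem det_frameCoord {y : PVTOLSpace} (h6 : y 6 ≠ 0) (h7 : y 7 ≠ 0) :
    frameCoord y 0 * frameCoord y 3 - frameCoord y 1 * frameCoord y 2 ≠ 0 := by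
  have h : frameCoord y 0 * frameCoord y 3 - frameCoord y 1 * frameCoord y 2 = y 7 ^ 2 * y 6 := by
    simp only [frameCoord, Matrix.cons_val]
    linear_combination y 7 ^ 2 * y 6 * sin_sq_add_cos_sq (y 5)
  rw [h]
  positivity

theorem hasFDerivAt_frameCoord {y : PVTOLSpace} (h6 : y 6 ≠ 0) :
    HasFDerivAt frameCoord (frameDeriv y) y := by
  rw [hasFDerivAt_pi']
  have h := fun i => hasFDerivAt_apply (𝕜 := ℝ) (F' := fun _ : Fin 9 => ℝ) i y
  have h26 : 2 * y 6 ≠ 0 := mul_ne_zero two_ne_zero h6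
  have hr := ((h 7).mul (h 8)).mul ((hasDerivAt_inv h26).comp_hasFDerivAt y ((h 6).const_mul 2))
  intro j
  fin_cases j
  · exact ((h 7).mul (h 5).sin).neg.congr_fderiv (by
      ext v; simp [frameDeriv]; ring)
  · exact ((((h 7).mul (h 6)).mul (h 5).cos).neg.add (hr.mul (h 5).sin)).congr_fderiv (by
      ext v; simp [frameDeriv, div_eq_mul_inv]; field_simp; ring)
  · exact ((h 7).mul (h 5).cos).congr_fderiv (by
      ext v; simp [frameDeriv]; ring)
  · exact ((((h 7).mul (h 6)).mul (h 5).sin).neg.sub (hr.mul (h 5).cos)).congr_fderiv (by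
      ext v; simp [frameDeriv, div_eq_mul_inv]; field_simp; ring)
  · exact (h 2).congr_fderiv (by ext v; simp [frameDeriv])
  · exact (h 4).congr_fderiv (by ext v; simp [frameDeriv])
  · exact (h 1).congr_fderiv (by ext v; simp [frameDeriv])
  · exact (h 3).congr_fderiv (by ext v; simp [frameDeriv])
  · exact (h 0).congr_fderiv (by ext v; simp [frameDeriv])

theorem contDiffAt_frameCoord {y : PVTOLSpace} (h6 : y 6 ≠ 0) :
    ContDiffAt ℝ ∞ frameCoord y := by
  rw [contDiffAt_pi]
  have h26 : 2 * y 6 ≠ 0 := mul_ne_zero two_ne_zero h6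
  intro j
  fin_cases j <;> simp only [frameCoord] <;> simp <;> fun_prop (disch := assumption)

/-- The frame maps the symmetries to left-invariant vector fields. -/
theorem frameDeriv_affineFieldAt (ξ : Fin 9 → ℝ) {y : PVTOLSpace} (h6 : y 6 ≠ 0) :
    frameDeriv y (affineFieldAt ξ y) = leftAt ξ (frameCoord y) := by
  have hsq := sin_sq_add_cos_sq (y 5)
  rw [frameDeriv_apply, affineFieldAt, leftAt, frameCoord]
  simp only [Matrix.cons_val]
  generalize sin (y 5) = s at hsq
  generalize cos (y 5) = c at hsq
  funext j
  fin_cases j <;> simp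
  · linear_combination (y 7 * (ξ 1 * c - ξ 0 * s)) * hsq
  · field_simp
    linear_combination (y 7 * (y 8 * (ξ 0 * s - ξ 1 * c) - 2 * y 6 ^ 2 * (ξ 0 * c + ξ 1 * s))) * hsq
  · linear_combination (y 7 * (ξ 3 * c - ξ 2 * s)) * hsq
  · field_simp
    linear_combination (y 7 * (y 8 * (ξ 2 * s - ξ 3 * c) - 2 * y 6 ^ 2 * (ξ 2 * c + ξ 3 * s))) * hsq

end ThrustFrames

end

noncomputable section

/-! ### Generic points and the local Lie group structure -/

section GenericPoints

open Real FrameGroup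

variable {h g lam : ℝ}

theorem flatCoord_ne_zero {p : PVTOLSpace} (hp : p ∈ pvtolGeneric h lam) :
    flatCoord (h / lam) g lam p 6 ≠ 0 ∧ flatCoord (h / lam) g lam p 7 ≠ 0 :=
  ⟨hp.1, sub_ne_zero.2 hp.2⟩

theorem isOpen_pvtolGeneric : IsOpen (pvtolGeneric h lam) :=
  (isOpen_ne_fun (by fun_prop) (by fun_prop)).inter (isOpen_ne_fun (by fun_prop) (by fun_prop))

theorem dense_pvtolGeneric : Dense (pvtolGeneric h lam) := by
  intro p
  -- Along this curve `θ₁` and `u₁ - k θ₁²` both grow at unit speed, so at most two parameters give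
  -- non-generic points.
  let γ : ℝ → PVTOLSpace := fun s => Function.update (Function.update p 6 (p 6 + s)) 7
    (p 7 - h / lam * p 6 ^ 2 + s + h / lam * (p 6 + s) ^ 2)
  have h0 : γ 0 = p := by simp [γ]
  have hγ : Continuous γ := by
    refine Continuous.update (Continuous.update continuous_const 6 ?_) 7 ?_ <;> fun_prop
  have hd : Dense ({-p 6, -(p 7 - h / lam * p 6 ^ 2)}ᶜ : Set ℝ) := 
    (Set.countable_insert.2 (Set.countable_singleton _)).dense_compl ℝ
  rw [← h0]
  refine map_mem_closure hγ (hd 0) fun s hs => ?_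
  simp only [Set.mem_compl_iff, Set.mem_insert_iff, Set.mem_singleton_iff, not_or] at hs
  have h6 : γ s 6 = p 6 + s := by simp [γ]
  have h7 : γ s 7 = p 7 - h / lam * p 6 ^ 2 + s + h / lam * (p 6 + s) ^ 2 := by simp [γ]
  refine ⟨fun h => hs.1 ?_, fun h => hs.2 ?_⟩
  · linear_combination h - h6
  · rw [h6, h7] at h
    linear_combination h

/-- The frame at a point of the time-state-control space. -/
def pvtolFrame (h g lam : ℝ) (p : PVTOLSpace) : Fin 9 → ℝ := frameCoord (flatCoord (h / lam) g lam p)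

/-- The derivative of the frame. -/
def pvtolFrameDeriv (h g lam : ℝ) (p : PVTOLSpace) : PVTOLSpace →L[ℝ] (Fin 9 → ℝ) :=
  (frameDeriv (flatCoord (h / lam) g lam p)).comp (toFlat (h / lam) g lam p)

theorem det_pvtolFrame {p : PVTOLSpace} (hp : p ∈ pvtolGeneric h lam) :
    pvtolFrame h g lam p 0 * pvtolFrame h g lam p 3 -
      pvtolFrame h g lam p 1 * pvtolFrame h g lam p 2 ≠ 0 :=
  det_frameCoord (flatCoord_ne_zero hp).1 (flatCoord_ne_zero hp).2

theorem hasFDerivAt_pvtolFrame {p : PVTOLSpace} (hp : p ∈ pvtolGeneric h lam) :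
    HasFDerivAt (pvtolFrame h g lam) (pvtolFrameDeriv h g lam p) p :=
  (hasFDerivAt_frameCoord (flatCoord_ne_zero hp).1).comp p (hasFDerivAt_flatCoord _ _ _ p)

theorem contDiffAt_pvtolFrame {p : PVTOLSpace} (hp : p ∈ pvtolGeneric h lam) :
    ContDiffAt ℝ ∞ (pvtolFrame h g lam) p :=
  (contDiffAt_frameCoord (flatCoord_ne_zero hp).1).comp p (contDiff_flatCoord _ _ _).contDiffAt

theorem pvtolFrameDeriv_affine (hlam : lam ≠ 0) {p : PVTOLSpace} (hp : p ∈ pvtolGeneric h lam)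
    (ξ : Fin 9 → ℝ) :
    pvtolFrameDeriv h g lam p (ofFlat (h / lam) g lam p
      (affineFieldAt ξ (flatCoord (h / lam) g lam p))) = leftAt ξ (pvtolFrame h g lam p) := by
  rw [pvtolFrameDeriv, ContinuousLinearMap.comp_apply, toFlat_ofFlat _ _ hlam]
  exact frameDeriv_affineFieldAt ξ (flatCoord_ne_zero hp).1

/-- The symmetries are mapped to the fields `ξ y`, which already fill the tangent space because `y`
is invertible. -/
theorem surjective_pvtolFrameDeriv (hlam : lam ≠ 0) {p : PVTOLSpace}
    (hp : p ∈ pvtolGeneric h lam) : Function.Surjective (pvtolFrameDeriv h g lam p) := by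
  intro w
  obtain ⟨ξ, hξ⟩ := LinearMap.injective_iff_surjective.1
    (leftMap_injective (det_pvtolFrame (g := g) hp)) w
  exact ⟨_, (pvtolFrameDeriv_affine hlam hp ξ).trans hξ⟩

theorem injective_pvtolFrameDeriv (hlam : lam ≠ 0) {p : PVTOLSpace}
    (hp : p ∈ pvtolGeneric h lam) : Function.Injective (pvtolFrameDeriv h g lam p) :=
  (LinearMap.injective_iff_surjective
    (f := (pvtolFrameDeriv h g lam p : PVTOLSpace →ₗ[ℝ] PVTOLSpace))).2
    (surjective_pvtolFrameDeriv hlam hp)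

/-- The derivative of the frame at a generic point, as an isomorphism. -/
def pvtolFrameEquiv (g : ℝ) (hlam : lam ≠ 0) {p : PVTOLSpace} (hp : p ∈ pvtolGeneric h lam) :
    PVTOLSpace ≃L[ℝ] (Fin 9 → ℝ) :=
  (LinearEquiv.ofBijective (pvtolFrameDeriv h g lam p : PVTOLSpace →ₗ[ℝ] (Fin 9 → ℝ))
    ⟨injective_pvtolFrameDeriv hlam hp, surjective_pvtolFrameDeriv hlam hp⟩).toContinuousLinearEquiv

theorem hasFDerivAt_pvtolFrame_equiv (hlam : lam ≠ 0) {p : PVTOLSpace}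
    (hp : p ∈ pvtolGeneric h lam) : HasFDerivAt (pvtolFrame h g lam)
      (pvtolFrameEquiv g hlam hp : PVTOLSpace →L[ℝ] (Fin 9 → ℝ)) p :=
  (hasFDerivAt_pvtolFrame hp).congr_fderiv (by ext v; rfl)

/-- In flat components every affine symmetry has `ω` component proportional to `ω` and `v` component
proportional to `v`, so the zero sets of both are obstructions. Elsewhere the frame reduces the
claim to the span of the fields `ξ y`. -/
theorem span_pvtolFieldExt_eq_top_iff (hlam : lam ≠ 0) (p : PVTOLSpace) :
    Submodule.span ℝ (Set.range fun i => pvtolFieldExt h g lam i p) = ⊤ ↔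
      p ∈ pvtolGeneric h lam := by
  rw [Submodule.eq_top_iff']
  simp only [Submodule.mem_span_range_iff_exists_fun, sum_pvtolFieldExt g hlam]
  constructor
  · intro hs
    refine ⟨fun h6 => ?_, fun h7 => ?_⟩
    · obtain ⟨u, hu⟩ := hs (Pi.single 6 1)
      have h1 := congrFun hu 6
      rw [ofFlat_apply] at h1
      simp [affineFieldAt, flatCoord, h6] at h1
    · obtain ⟨u, hu⟩ := hs (Pi.single 7 1)
      have h1 := congrFun (congrArg (toFlat (h / lam) g lam p) hu) 7
      rw [toFlat_ofFlat _ _ hlam, toFlat_apply] at h1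
      simp [affineFieldAt, flatCoord, h7] at h1
  · intro hp v
    obtain ⟨ξ, hξ⟩ := LinearMap.injective_iff_surjective.1
      (leftMap_injective (det_pvtolFrame (g := g) hp)) (pvtolFrameDeriv h g lam p v)
    refine ⟨(affineParam g).symm ξ, injective_pvtolFrameDeriv (g := g) hlam hp ?_⟩
    rw [LinearEquiv.apply_symm_apply, pvtolFrameDeriv_affine hlam hp]
    exact hξ

/-- The values at the identity of the right-invariant distribution. -/
def frameDistribution : Submodule ℝ (Fin 9 → ℝ) :=
  Submodule.span ℝ {![1, 0, 0, 1, 0, 0, 0, 0, 0], ![0, 1, 0, 0, 0, 0, 0, 0, 0],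
    ![0, 0, 1, 0, 1, 0, 0, 0, 1]}

theorem mem_frameDistribution_iff (d : Fin 9 → ℝ) :
    d ∈ frameDistribution ↔ ∃ a b c : ℝ, d = ![a, b, c, a, c, 0, 0, 0, c] := by
  rw [frameDistribution, Submodule.mem_span_triple]
  have h1 : ∀ a b c : ℝ, a • (![1, 0, 0, 1, 0, 0, 0, 0, 0] : Fin 9 → ℝ) +
      b • ![0, 1, 0, 0, 0, 0, 0, 0, 0] + c • ![0, 0, 1, 0, 1, 0, 0, 0, 1] =
        ![a, b, c, a, c, 0, 0, 0, c] := by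
    intro a b c
    funext j
    fin_cases j <;> simp
  simp only [h1, eq_comm]

/-- The derivative of the frame on the distribution. -/
theorem frameDeriv_distribution {y : PVTOLSpace} (h6 : y 6 ≠ 0) (h7 : y 7 ≠ 0)
    {a b c α β : ℝ} (hα : α = a * (y 8 / (2 * y 6)) + b / y 7)
    (hβ : β = a * (3 * y 8 ^ 2 / (4 * y 6 ^ 2) - y 6 ^ 2) - c / (2 * y 6)) :
    frameDeriv y ![a, a * y 2, -(a * (y 7 * sin (y 5))), a * y 4, a * (y 7 * cos (y 5)),
        a * y 6, a * y 8, b, c] = rightAt (frameCoord y) ![α, β, a, α, a, 0, 0, 0, a] := by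
  rw [frameDeriv_apply, rightAt, frameCoord, hα, hβ]
  simp only [Matrix.cons_val]
  generalize sin (y 5) = s
  generalize cos (y 5) = c
  -- The equal diagonal entries `α` reflect the choice of the second column: the determinant `v² ω`
  -- has logarithmic derivative `2 α` along the distribution when `α` is as in `hα`.
  funext j
  fin_cases j <;> simp <;> field_simp <;> ring

theorem mem_pvtolDistribution_iff_frame (hlam : lam ≠ 0) {p : PVTOLSpace}
    (hp : p ∈ pvtolGeneric h lam) (v : PVTOLSpace) :
    v ∈ pvtolDistribution h g lam p ↔ ∃ d ∈ frameDistribution,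
      pvtolFrameDeriv h g lam p v = rightAt (pvtolFrame h g lam p) d := by
  obtain ⟨h6, h7⟩ := flatCoord_ne_zero (g := g) hp
  rw [mem_pvtolDistribution_iff g hlam]
  constructor
  · rintro ⟨a, b, c, hv⟩
    refine ⟨_, (mem_frameDistribution_iff _).2 ⟨_, _, _, rfl⟩,
      (congrArg (frameDeriv _) hv).trans (frameDeriv_distribution h6 h7 rfl rfl)⟩
  · rintro ⟨d, hd, hv⟩
    obtain ⟨α, β, a, rfl⟩ := (mem_frameDistribution_iff _).1 hd
    have key : ∀ {u : PVTOLSpace}, frameDeriv (flatCoord (h / lam) g lam p) u =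
        rightAt (frameCoord (flatCoord (h / lam) g lam p)) ![α, β, a, α, a, 0, 0, 0, a] →
        toFlat (h / lam) g lam p v = u := by
      intro u hu
      have hvu : v = ofFlat (h / lam) g lam p u := by
        refine injective_pvtolFrameDeriv (g := g) hlam hp (hv.trans (hu.symm.trans ?_))
        rw [pvtolFrameDeriv, ContinuousLinearMap.comp_apply, toFlat_ofFlat _ _ hlam]
      rw [hvu, toFlat_ofFlat _ _ hlam]
    -- The rates of `v` and `w` are found by solving the formulas for `α` and `β`, which is possible
    -- since `v` and `ω` are nonzero.
    refine ⟨a, flatCoord (h / lam) g lam p 7 * (α - a * (flatCoord (h / lam) g lam p 8 /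
        (2 * flatCoord (h / lam) g lam p 6))),
      2 * flatCoord (h / lam) g lam p 6 * (a * (3 * flatCoord (h / lam) g lam p 8 ^ 2 /
        (4 * flatCoord (h / lam) g lam p 6 ^ 2) - flatCoord (h / lam) g lam p 6 ^ 2) - β),
      key (frameDeriv_distribution h6 h7 ?_ ?_)⟩
    · rw [mul_div_cancel_left₀ _ h7, add_sub_cancel]
    · rw [mul_div_cancel_left₀ _ (mul_ne_zero two_ne_zero h6), sub_sub_cancel]

/-- The frame is a local diffeomorphism at generic points. -/
theorem exists_pvtolFrame_diffeomorph (hlam : lam ≠ 0) (Ω : TopologicalSpace.Opens PVTOLSpace)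
    {p : PVTOLSpace} (hp : p ∈ (Ω : Set PVTOLSpace) ∩ pvtolGeneric h lam) :
    ∃ φ : OpenPartialHomeomorph PVTOLSpace FrameGroup, p ∈ φ.source ∧
      φ.source ⊆ Ω ∩ pvtolGeneric h lam ∧
      ContMDiffOn 𝓘(ℝ, PVTOLSpace) 𝓘(ℝ, Fin 9 → ℝ) ∞ φ φ.source ∧
      ContMDiffOn 𝓘(ℝ, Fin 9 → ℝ) 𝓘(ℝ, PVTOLSpace) ∞ φ.symm φ.target ∧
      ∀ q ∈ φ.source, coord (φ q) = pvtolFrame h g lam q := by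
  have hF := contDiffAt_pvtolFrame (g := g) hp.2
  have hF' := hasFDerivAt_pvtolFrame_equiv (g := g) hlam hp.2
  have hn : (∞ : WithTop ℕ∞) ≠ 0 := by simp
  -- The inverse function theorem gives a local inverse; restricting to generic points of `Ω` keeps
  -- the frame in the range of `coord`, where the chart can be inverted.
  let e := (hF.toOpenPartialHomeomorph _ hF' hn).restrOpen (Ω ∩ pvtolGeneric h lam)
    (Ω.isOpen.inter isOpen_pvtolGeneric)
  let ι := isOpenEmbedding_coord.toOpenPartialHomeomorph coord
  have hes : ∀ q ∈ e.source, q ∈ (Ω : Set PVTOLSpace) ∩ pvtolGeneric h lam := fun q hq => hq.2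
  have hιt : ∀ q ∈ e.source, e q ∈ ι.target := by
    intro q hq
    rw [isOpenEmbedding_coord.toOpenPartialHomeomorph_target]
    exact ⟨⟨_, det_pvtolFrame (hes q hq).2⟩, rfl⟩
  have hps : p ∈ e.source := ⟨hF.mem_toOpenPartialHomeomorph_source hF' hn, hp⟩
  have hφs : ∀ q ∈ (e.trans ι.symm).source, q ∈ e.source := fun q hq => hq.1
  refine ⟨e.trans ι.symm, ⟨hps, hιt p hps⟩, fun q hq => hes q (hφs q hq), ?_, ?_, ?_⟩
  · have he : ContMDiffOn 𝓘(ℝ, PVTOLSpace) 𝓘(ℝ, Fin 9 → ℝ) ∞ e (e.trans ι.symm).source :=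
      fun q hq => (contDiffAt_pvtolFrame (hes q (hφs q hq)).2).contMDiffAt.contMDiffWithinAt
    exact (contMDiffOn_isOpenEmbedding_symm isOpenEmbedding_coord).comp he fun q hq =>
      ⟨⟨_, det_pvtolFrame (hes q (hφs q hq)).2⟩, rfl⟩
  · intro x hx
    have hx' : ι x ∈ e.target := hx.2
    have hq := hes _ (e.map_target hx')
    have hs : ContDiffAt ℝ ∞ e.symm (ι x) :=
      e.contDiffAt_symm hx' (hasFDerivAt_pvtolFrame_equiv hlam hq.2) (contDiffAt_pvtolFrame hq.2)
    exact (hs.contMDiffAt.comp x contMDiff_coord.contMDiffAt).contMDiffWithinAt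
  · intro q hq
    exact ι.right_inv (hιt q (hφs q hq))

/-- The frames provide local Lie group structures. -/
theorem isLocallyLieGroup_extendedSymmetries (hlam : lam ≠ 0)
    (Ω : TopologicalSpace.Opens PVTOLSpace) (hΩ : IsConnected (Ω : Set PVTOLSpace)) :
    IsLocallyLieGroup (extendedSymmetries Ω h g lam) (pvtolDistribution h g lam)
      (Ω ∩ pvtolGeneric h lam) := by
  -- Both Lie algebras are `ℝ⁹` with `affineBracket`, so the affine parameters themselves are the
  -- isomorphism.
  let Ψ : GroupLieAlgebra 𝓘(ℝ, Fin 9 → ℝ) FrameGroup ≃ₗ⁅ℝ⁆ extendedSymmetries Ω h g lam :=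
    { extendedEquiv hlam hΩ h g with
      map_lie' := by
        intro ξ η
        exact (congrArg (extendedEquiv hlam hΩ h g) (lie_eq_affineBracket ξ η)).trans
          (extendedEquiv_lie hlam hΩ ξ η).symm }
  refine ⟨Fin 9 → ℝ, inferInstance, inferInstance, inferInstance, FrameGroup, inferInstance,
    inferInstance, inferInstance, inferInstance, Ψ.symm, fun p hp => ?_⟩
  obtain ⟨φ, hpφ, hφs, hφ, hφ', hφF⟩ := exists_pvtolFrame_diffeomorph (g := g) hlam Ω hp
  have hd : ∀ q ∈ φ.source, ∀ v : PVTOLSpace, mfderiv 𝓘(ℝ, PVTOLSpace) 𝓘(ℝ, Fin 9 → ℝ) φ q v =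
      pvtolFrameDeriv h g lam q v := fun q hq => mfderiv_apply_of_coord_comp
    ((hφ.contMDiffAt (φ.open_source.mem_nhds hq)).mdifferentiableAt (by simp))
    (hasFDerivAt_pvtolFrame (hφs hq).2)
    (Filter.eventually_of_mem (φ.open_source.mem_nhds hq) hφF)
  refine ⟨φ, hpφ, fun q hq => (hφs hq).1, hφ, hφ', fun X q hq => ?_, frameDistribution,
    fun q hq v => ?_⟩
  · obtain ⟨ξ, rfl⟩ := Ψ.surjective X
    refine (hd q hq _).trans (Eq.trans ?_ ((mulInvariantVectorField_apply ξ (φ q)).symm.trans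
      (congrArg (fun ζ => mulInvariantVectorField ζ (φ q)) (Ψ.symm_apply_apply ξ).symm)))
    rw [hφF q hq]
    exact (congrArg (pvtolFrameDeriv h g lam q) (affineVF_apply ξ (hφs hq).1)).trans
      (pvtolFrameDeriv_affine hlam (hφs hq).2 ξ)
  · rw [mem_pvtolDistribution_iff_frame hlam (hφs hq).2]
    refine exists_congr fun d => and_congr_right fun _ => ?_
    rw [← hφF q hq]
    exact (Eq.congr (hd q hq v) (mfderiv_mul_right_apply d (φ q))).symm

end GenericPoints

end

theorem mainTheorem12 (h g lam : ℝ) (hlam : lam ≠ 0)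
    (Ω : TopologicalSpace.Opens PVTOLSpace) (hΩ : IsConnected (Ω : Set PVTOLSpace)) :
    -- the control symmetry algebra has the basis `X₁, …, X₈`
    (∃ b : Module.Basis (Fin 8) ℝ (controlSymmetries Ω (pvtolDistribution h g lam) pvtolTime),
      ∀ i, ∀ p ∈ Ω, (b i).1.1 p = pvtolField h g lam i p) ∧
    -- its Levi decomposition
    HasLeviDecompositionSl2 (controlSymmetries Ω (pvtolDistribution h g lam) pvtolTime)
      LieS59 actS59 ∧
    -- the vector fields `X₁, …, X₈, ∂_t` are a basis of a Lie algebra of symmetries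
    (∃ L : LieSubalgebra ℝ (SmoothVF Ω),
      L ≤ infinitesimalSymmetries Ω (pvtolDistribution h g lam) ∧
      (∃ b : Module.Basis (Fin 9) ℝ L,
        ∀ i, ∀ p ∈ Ω, (b i).1.1 p = pvtolFieldExt h g lam i p) ∧
      HasLeviDecompositionSl2 L LieS6140 actS6140 ∧
      IsLocallyLieGroup L (pvtolDistribution h g lam) (Ω ∩ pvtolGeneric h lam)) ∧
    -- the nilradical of the six-dimensional radical
    (∃ N : LieIdeal ℝ LieS6140, IsNilradical N ∧ Nonempty (N ≃ₗ⁅ℝ⁆ LieN51)) ∧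
    -- the nine vector fields span the tangent space exactly at the generic points
    (∀ p : PVTOLSpace,
      Submodule.span ℝ (Set.range fun i => pvtolFieldExt h g lam i p) = ⊤ ↔
        p ∈ pvtolGeneric h lam) ∧
    -- the generic points form an open dense set
    IsOpen (pvtolGeneric h lam) ∧ Dense (pvtolGeneric h lam) :=
  ⟨exists_control_basis hlam hΩ, hasLeviDecomposition_control hlam hΩ,
    ⟨extendedSymmetries Ω h g lam, fun _ hX => hX.1, exists_extended_basis hlam hΩ,
      hasLeviDecomposition_extended hlam hΩ, isLocallyLieGroup_extendedSymmetries hlam Ω hΩ⟩,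
    ⟨LieS6140.nilradical, LieS6140.isNilradical_nilradical, ⟨LieS6140.nilradicalEquiv⟩⟩,
    span_pvtolFieldExt_eq_top_iff hlam, isOpen_pvtolGeneric, dense_pvtolGeneric⟩
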